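/- **Notation.** For a matrix $X$, $X^T$, $\bar X$, $X^\dagger$ are the transpose, the entrywise conjugate and the conjugate transpose, and $\|X\|$ is the operator norm with respect to the Euclidean norms. $U_p=[0,\,I_p]$ and $U^1_p=[I_p,\,0]$ are $p\times(p+1)$ matrices, $e_1^p\in\mathbb R^p$ is the first and $e_p^p$ the last unit vector. The upper Cholesky factor of a positive definite $X$ is the upper triangular $B$ with positive diagonal and $X=BB^\dagger$. For a Laurent polynomial $p$ in $z,w$ put $p^\dagger(z,w)=\overline{p(1/\bar z,1/\bar w)}$; for a vector $V$ of polynomials belonging to the level $(n,m)$ let $V^{\leftarrow}$ be the column vector with entries $z^nw^mV_a^\dagger$. For column vectors $V,W$, $VW^\dagger$ is the matrix with entries $V_aW_b^\dagger$. Matrices without rows or columns are allowed. **Construction.** Let $u_{i,j}\in\mathbb C$ $(i,j\in\mathbb Z)$ satisfy $u_{i,-j}=\bar u_{-i,j}$. For every level $(n,m)$, $n,m\ge 0$, one constructs recursively matrices $\hat E_{n,m},A_{n,m}$ of size $(m+1)\times(m+1)$ (for $n\ge1$), $\tilde{\hat E}_{n,m},\tilde A_{n,m}$ of size $(n+1)\times(n+1)$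 (for $m\ge1$), $K_{n,m},K^1_{n,m}$ of size $m\times n$, $\Gamma_{n,m},\Gamma^1_{n,m}$ of size $m\times(m+1)$, $\tilde\Gamma_{n,m},\tilde\Gamma^1_{n,m}$ of size $n\times(n+1)$, $I_{n,m},I^1_{n,m}$ of size $(m+1)\times(n+1)$, and polynomial vectors $\Phi_{n,m}$ (length $m+1$), $\tilde\Phi_{n,m}$ (length $n+1$). One puts $\tilde K=K^\dagger$, $\tilde K^1=(K^1)^T$, $\tilde I=I^\dagger$, $\tilde I^1=(I^1)^T$. The "tilde version" of a formula arises by interchanging $n$ with $m$ (in indices and sizes), $z$ with $w$, and quantities without a tilde with those with a tilde. Let $\Phi^m_{n,n}$ be the $(m+1)\times(m+1)$ matrix for which $\Phi^m_{n,n}[w^m,\dots,w,1]^T$ is the coefficient of $z^n$ in $\Phi_{n,m}$, and $\tilde\Phi^n_{m,m}$ the $(n+1)\times(n+1)$ matrix for which $\tilde\Phi^n_{m,m}[z^n,\dots,z,1]^T$ is the coefficient of $w^m$ in $\tilde\Phi_{n,m}$. *Level $(0,0)$.* $\Phi_{0,0}=\tilde\Phi_{0,0}=1/\sqrt{u_{0,0}}$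 and $I_{0,0}=I^1_{0,0}=1$; the $K$'s and $\Gamma$'s are empty. *Level $(n,0)$, $n\ge1$.* $\hat E_{n,0}=u_{n,0}$, $A_{n,0}=\sqrt{1-|u_{n,0}|^2}$, $\tilde\Gamma_{n,0}=U_n$, $I_{n,0}=(e_1^{n+1})^T$; the matrices $K,K^1,\Gamma,\Gamma^1$ are empty; $\tilde\Gamma^1_{n,0}U_n^T=I_{n-1,0}^\dagger\hat E_{n,0}I^1_{n-1,0}+\tilde\Gamma_{n-1,0}^\dagger\tilde\Gamma^1_{n-1,0}$, the first column of $\tilde\Gamma^1_{n,0}$ vanishes except for its first entry, which is nonnegative and makes the first row a unit vector; $I^1_{n,0}$ is given by (c) and $\Phi_{n,0}$ by (d) below; $\tilde\Phi_{n,0}=I_{n,0}^\dagger\Phi_{n,0}+\tilde\Gamma_{n,0}^\dagger\tilde\Phi_{n-1,0}$. *Level $(0,m)$, $m\ge1$:* the tilde version, with $\tilde{\hat E}_{0,m}=u_{0,m}$. *Level $(n,m)$, $n,m\ge1$.* $K_{1,1}=u_{-1,1}$; for $(n,m)\ne(1,1)$, $K_{n,m}=\Phi^{m-1}_{n,n}\,X\,(\tilde\Phi^{n-1}_{m,m})^\dagger$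 with $$X=u_{-n,m}\,e_m^m(e_n^n)^T+(U^1_{m-1})^TH+e_m^m(e_m^m)^T\tilde H\,U^1_{n-1},$$ $$H=(\Phi^{m-2}_{n,n})^{-1}\bigl(K_{n,m-1}-K^1_{n,m-1}\tilde{\hat E}_{n-1,m}^\dagger\bigr)(\tilde A_{n-1,m}^{-1})^\dagger\bigl((\tilde\Phi^{n-1}_{m,m})^\dagger\bigr)^{-1},$$ $$\tilde H=(\Phi^{m-1}_{n,n})^{-1}A_{n,m-1}^{-1}\bigl(K_{n-1,m}-\hat E_{n,m-1}\bar K^1_{n-1,m}\bigr)\bigl((\tilde\Phi^{n-2}_{m,m})^\dagger\bigr)^{-1},$$ where $\Phi^{m-2}_{n,n}=\Gamma^1_{n,m-1}\Phi^{m-1}_{n,n}(U^1_{m-1})^T$ and $\tilde\Phi^{n-2}_{m,m}=\tilde\Gamma^1_{n-1,m}\tilde\Phi^{n-1}_{m,m}(U^1_{n-1})^T$ ($H$ is empty for $m=1$, $\tilde H$ for $n=1$). $K^1_{n,m}$ has $(1,1)$ entry $\bar u_{n,m}$; its rows below the first are $(\Gamma_{n,m-1}U_{m-1}^T)^{-1}\bigl(K^1_{n,m-1}-K_{n,m-1}\tilde{\hat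 E}_{n-1,m}\bigr)(\tilde A_{n-1,m}^{-1})^T$; the other entries of its first row are those of the first row of $A_{n,m-1}^{-1}\bigl(K^1_{n-1,m}-\hat E_{n,m-1}\bar K_{n-1,m}\bigr)(U_{n-1}\tilde\Gamma_{n-1,m}^T)^{-1}$. $\Gamma_{n,m}=BU_m$ with $B$ the upper Cholesky factor of $I-K_{n,m}K_{n,m}^\dagger$, and $\tilde\Gamma_{n,m}$ is given by the tilde version. (a) Let $\hat\Gamma_{n-1,m}$ be the first row of $\Gamma^1_{n-1,m}$ stacked on $\Gamma_{n-1,m}$. Then $$\hat\Gamma_{n-1,m}\hat E_{n,m}=U_m^T\bigl(A_{n,m-1}K_{n,m}(I^1_{n-1,m})^\dagger+\hat E_{n,m-1}\bar\Gamma^1_{n-1,m}\bigr)+e_1^{m+1}(e_1^m)^T\bigl(A_{n,m-1}K^1_{n,m}I_{n-1,m}^T+\hat E_{n,m-1}\bar\Gamma_{n-1,m}\bigr),$$ and $\tilde{\hat E}_{n,m}$ is given by the tilde version; $A_{n,m}$, $\tilde A_{n,m}$ are the upper Cholesky factors of $I-\hat E_{n,m}\hat E_{n,m}^\dagger$ and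 $I-\tilde{\hat E}_{n,m}\tilde{\hat E}_{n,m}^\dagger$. (b) With $\tilde{\hat\Gamma}_{n,m-1}$ the first row of $\tilde\Gamma^1_{n,m-1}$ stacked on $\tilde\Gamma_{n,m-1}$ and $S=(U_m\Gamma_{n,m}^\dagger)^{-1}$ put $$H^2_{n,m}=I_{n,m-1}\bigl((I^1_{n,m-1})^\dagger\bar K_{n,m}\tilde A_{n-1,m}^T+(\tilde\Gamma^1_{n,m-1})^\dagger\tilde{\hat E}_{n-1,m}\bigr)U_n(\tilde{\hat\Gamma}_{n,m-1}^T)^{-1}(I^1_{n,m-1})^TS,$$ $$H^1_{n,m}=\tilde A_{n-1,m}^Te_1^n(e_1^{n+1})^T(\tilde{\hat\Gamma}_{n,m-1}^T)^{-1}(I^1_{n,m-1})^TS+\overline{\tilde A_{n-1,m}}^{\,-1}\tilde{\hat E}_{n-1,m}^\dagger\tilde A_{n-1,m}K_{n,m}^\dagger S,$$ $$H^3_{n,m}=(H^2_{n,m}+K^1_{n,m}H^1_{n,m})(H^2_{n,m}+K^1_{n,m}H^1_{n,m})^\dagger+K^1_{n,m}(K^1_{n,m})^\dagger .$$ Then $$\Gamma^1_{n,m}U_m^T=\bigl(I_{n,m-1}\tilde{\hat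 E}_{n,m}(I^1_{n,m-1})^T+\Gamma_{n,m-1}^\dagger\Gamma^1_{n,m-1}+K^1_{n,m}\overline{\tilde A_{n-1,m}}^{\,-1}\tilde{\hat E}_{n-1,m}^\dagger\tilde A_{n-1,m}K_{n,m}^\dagger\bigr)S,$$ and the first column of $\Gamma^1_{n,m}$ vanishes except for its first entry $\sqrt{1-(e_1^m)^TH^3_{n,m}e_1^m}$; $\tilde\Gamma^1_{n,m}$ is given by the tilde version. $I_{n,m}$ has first row and first column equal to zero except for $(I_{n,m})_{1,1}=1$, and $I_{n,m}\tilde\Gamma_{n,m}^\dagger=-\Gamma_{n,m}^\dagger K_{n,m}$. (c) $I^1_{n,m}=-\overline{A_{n,m}}^{\,-1}\hat E_{n,m}^\dagger A_{n,m}I_{n,m}+A_{n,m}^TI^1_{n-1,m}\tilde\Gamma_{n,m}$. (d) $A_{n,m}\Phi_{n,m}=z\Phi_{n-1,m}-\hat E_{n,m}\Phi^{\leftarrow}_{n-1,m}$, and $\tilde\Phi_{n,m}$ is given by the tilde version. **Theorem.** Let $u_{i,j}\in\mathbb C$ with $u_{i,-j}=\bar u_{-i,j}$ be such that on all levels $$u_{0,0}>0,\quad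 |\hat E_{i,0}|<1\ (i\ge1),\quad |\tilde{\hat E}_{0,j}|<1\ (j\ge1),\quad \|K_{i,j}\|<1\ \text{ and }\ (e_1^j)^TH^3_{i,j}e_1^j<1\ (i,j\ge1).$$ Then there is a unique linear functional $\mathcal L$ on the Laurent polynomials in $z,w$ for which the constructed polynomials are orthonormal, that is, $$\mathcal L(\Phi_{i,m}\Phi_{j,m}^\dagger)=\delta_{ij}I_{m+1},\qquad \mathcal L(\tilde\Phi_{n,i}\tilde\Phi_{n,j}^\dagger)=\delta_{ij}I_{n+1}\qquad(n,m,i,j\ge0).$$ It is positive definite: $\mathcal L(pp^\dagger)>0$ for all $p\ne0$. It extends to a continuous linear functional on $C(\mathbb T^2)$, again denoted by $\mathcal L$, and there is a finite positive Borel measure $\mu$ on the bicircle $\mathbb T^2$ such that $$\mathcal L(f)=\Bigl(\frac1{2\pi}\Bigr)^2\int_{\mathbb T^2}f\,d\mu\qquad\text{for all } f\in C(\mathbb T^2).$$ -/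

import Mathlib

open scoped Matrix

noncomputable section

/-- The circle carries its Borel sigma-algebra. -/
instance Circle.instMeasurableSpaceBorel : MeasurableSpace Circle := borel Circle

instance Circle.instBorelSpaceBorel : BorelSpace Circle := ⟨rfl⟩

namespace Bicircle

/-! ### Laurent polynomials in `z, w` -/

/-- Laurent polynomials in two variables: the exponent `(i, j)` stands for `z ^ i * w ^ j`. -/
abbrev BiLaurent : Type := AddMonoidAlgebra ℂ (ℤ × ℤ)

/-- The monomial `z ^ i * w ^ j`. -/
def mono (i j : ℤ) : BiLaurent := AddMonoidAlgebra.single (i, j) 1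

/-- `p† (z, w) = conj (p (1 / conj z, 1 / conj w))`: conjugate the coefficients and negate the
exponents. -/
def dagger (p : BiLaurent) : BiLaurent :=
  p.coeff.sum fun a c => AddMonoidAlgebra.single (-a) (star c)

/-- The function `(z, w) ↦ z ^ i * w ^ j` on the bicircle. -/
def monoFun (a : ℤ × ℤ) : C(Circle × Circle, ℂ) where
  toFun x := ((x.1 ^ a.1 * x.2 ^ a.2 : Circle) : ℂ)
  continuous_toFun := by
    have h : Continuous fun x : Circle × Circle => x.1 ^ a.1 * x.2 ^ a.2 :=
      ((continuous_zpow a.1).comp continuous_fst).mul ((continuous_zpow a.2).comp continuous_snd)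
    exact (show Continuous fun y : Circle => (y : ℂ) by fun_prop).comp h

/-- A Laurent polynomial as a continuous function on the bicircle. -/
def toFun (p : BiLaurent) : C(Circle × Circle, ℂ) := p.coeff.sum fun a c => c • monoFun a

/-- The reverse `z ^ n * w ^ m * p†` of a (vector) polynomial `p` of degree at most `(n, m)`.
For a vector the result is again indexed like `p`, that is, it is the transpose of the row
vector usually denoted by an arrow. -/
def rev {k : ℕ} (n m : ℕ) (v : Fin k → BiLaurent) : Fin k → BiLaurent :=
  fun i => mono n m * dagger (v i)

/-- Product of a scalar matrix and a vector of Laurent polynomials. -/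
def act {p q : ℕ} (A : Matrix (Fin p) (Fin q) ℂ) (v : Fin q → BiLaurent) : Fin p → BiLaurent :=
  fun i => ∑ j, A i j • v j

/-! ### Matrices -/

/-- The `p × (p + 1)` matrix `[0, I]`. -/
def shiftU (p : ℕ) : Matrix (Fin p) (Fin (p + 1)) ℂ :=
  Matrix.of fun i j => if j = i.succ then 1 else 0

/-- The `p × (p + 1)` matrix `[I, 0]`. -/
def shiftU1 (p : ℕ) : Matrix (Fin p) (Fin (p + 1)) ℂ :=
  Matrix.of fun i j => if j = i.castSucc then 1 else 0

/-- The matrix with `(1, 1)` entry `1` and all other entries `0`. -/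
def corner (p q : ℕ) : Matrix (Fin (p + 1)) (Fin (q + 1)) ℂ := Matrix.single 0 0 1

/-- Entrywise complex conjugate. -/
def cj {p q : ℕ} (A : Matrix (Fin p) (Fin q) ℂ) : Matrix (Fin p) (Fin q) ℂ := A.map star

/-- `B` is the upper Cholesky factor of `M`: upper triangular, with positive diagonal, and
`M = B * Bᴴ`. -/
def IsUpperCholesky {p : ℕ} (M B : Matrix (Fin p) (Fin p) ℂ) : Prop :=
  B.BlockTriangular id ∧ (∀ i, 0 < (B i i).re ∧ (B i i).im = 0) ∧ M = B * Bᴴ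

open Classical in
/-- The upper Cholesky factor of a positive definite matrix (zero if there is none). -/
def upperCholesky {p : ℕ} (M : Matrix (Fin p) (Fin p) ℂ) : Matrix (Fin p) (Fin p) ℂ :=
  if h : ∃ B, IsUpperCholesky M B then h.choose else 0

/-- The first row of `G1` stacked on `G`. -/
def stack {p : ℕ} (G1 G : Matrix (Fin (p + 1)) (Fin (p + 2)) ℂ) :
    Matrix (Fin (p + 2)) (Fin (p + 2)) ℂ :=
  Matrix.of (Matrix.vecCons (G1 0) G)

/-! ### The data on one level

A quantity with a `t` at the end is the one with a tilde, which belongs to the reverse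
lexicographical ordering.  Throughout, `Kt = Kᴴ`, `K1t = K1ᵀ`, `It = Iᴴ`, `I1t = I1ᵀ`.
The vector `Φ` has components `φ ^ m, …, φ ^ 0` and `Φt` has components `φt ^ n, …, φt ^ 0`. -/

/-- The coefficients and polynomials on the level `(n, m)`.  The coefficients `E`, `A` exist only
for `0 < n`, `Et`, `At` only for `0 < m`, and `H3` only for `0 < n` and `0 < m`;
otherwise these fields are filled with `0` and never used. -/
structure Level (n m : ℕ) where
  E : Matrix (Fin (m + 1)) (Fin (m + 1)) ℂ
  A : Matrix (Fin (m + 1)) (Fin (m + 1)) ℂ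
  Et : Matrix (Fin (n + 1)) (Fin (n + 1)) ℂ
  At : Matrix (Fin (n + 1)) (Fin (n + 1)) ℂ
  K : Matrix (Fin m) (Fin n) ℂ
  K1 : Matrix (Fin m) (Fin n) ℂ
  H3 : Matrix (Fin m) (Fin m) ℂ
  G : Matrix (Fin m) (Fin (m + 1)) ℂ
  G1 : Matrix (Fin m) (Fin (m + 1)) ℂ
  Gt : Matrix (Fin n) (Fin (n + 1)) ℂ
  Gt1 : Matrix (Fin n) (Fin (n + 1)) ℂ
  I : Matrix (Fin (m + 1)) (Fin (n + 1)) ℂ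
  I1 : Matrix (Fin (m + 1)) (Fin (n + 1)) ℂ
  Φ : Fin (m + 1) → BiLaurent
  Φt : Fin (n + 1) → BiLaurent

/-- The coefficient of `z ^ n` in `Φ`, an `(m + 1) × (m + 1)` matrix acting on
`[w ^ m, …, w, 1]ᵀ`. -/
def Level.lead {n m : ℕ} (l : Level n m) : Matrix (Fin (m + 1)) (Fin (m + 1)) ℂ :=
  Matrix.of fun i j => (l.Φ i).coeff ((n : ℤ), (m : ℤ) - (j : ℕ))

/-- The coefficient of `w ^ m` in `Φt`, an `(n + 1) × (n + 1)` matrix acting on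
`[z ^ n, …, z, 1]ᵀ`. -/
def Level.leadt {n m : ℕ} (l : Level n m) : Matrix (Fin (n + 1)) (Fin (n + 1)) ℂ :=
  Matrix.of fun i j => (l.Φt i).coeff ((n : ℤ) - (j : ℕ), (m : ℤ))

/-! ### Formulas for the coefficients

Each of the next formulas is used once as it stands, and once with the roles of the two
orderings interchanged. -/

/-- The solution `X` of
`stack G1 G * X = Uᵀ (A K I1ᴴ + E conj G1) + e₁ e₁ᵀ (A K1 Iᵀ + E conj G)`. -/
def formulaE {p q : ℕ} (A E : Matrix (Fin (p + 1)) (Fin (p + 1)) ℂ)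
    (K K1 : Matrix (Fin (p + 1)) (Fin q) ℂ) (I I1 : Matrix (Fin (p + 2)) (Fin q) ℂ)
    (G G1 : Matrix (Fin (p + 1)) (Fin (p + 2)) ℂ) : Matrix (Fin (p + 2)) (Fin (p + 2)) ℂ :=
  (stack G1 G)⁻¹ *
    ((shiftU (p + 1))ᵀ * (A * K * I1ᴴ + E * cj G1) +
      corner (p + 1) p * (A * K1 * Iᵀ + E * cj G))

/-- The matrix `H²`. -/
def formulaH2 {p q : ℕ} (I I1 : Matrix (Fin (p + 1)) (Fin (q + 2)) ℂ)
    (At Et : Matrix (Fin (q + 1)) (Fin (q + 1)) ℂ)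
    (Gt Gt1 : Matrix (Fin (q + 1)) (Fin (q + 2)) ℂ)
    (K : Matrix (Fin (p + 1)) (Fin (q + 1)) ℂ) (G : Matrix (Fin (p + 1)) (Fin (p + 2)) ℂ) :
    Matrix (Fin (p + 1)) (Fin (p + 1)) ℂ :=
  I * (I1ᴴ * cj K * Atᵀ + Gt1ᴴ * Et) * shiftU (q + 1) * ((stack Gt1 Gt)ᵀ)⁻¹ * I1ᵀ *
    (shiftU (p + 1) * Gᴴ)⁻¹

/-- The matrix `H¹`. -/
def formulaH1 {p q : ℕ} (I1 : Matrix (Fin (p + 1)) (Fin (q + 2)) ℂ)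
    (At Et : Matrix (Fin (q + 1)) (Fin (q + 1)) ℂ)
    (Gt Gt1 : Matrix (Fin (q + 1)) (Fin (q + 2)) ℂ)
    (K : Matrix (Fin (p + 1)) (Fin (q + 1)) ℂ) (G : Matrix (Fin (p + 1)) (Fin (p + 2)) ℂ) :
    Matrix (Fin (q + 1)) (Fin (p + 1)) ℂ :=
  Atᵀ * corner q (q + 1) * ((stack Gt1 Gt)ᵀ)⁻¹ * I1ᵀ * (shiftU (p + 1) * Gᴴ)⁻¹ +
    (cj At)⁻¹ * Etᴴ * At * Kᴴ * (shiftU (p + 1) * Gᴴ)⁻¹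

/-- The matrix `H³ = (H² + K¹ H¹) (H² + K¹ H¹)ᴴ + K¹ (K¹)ᴴ`. -/
def formulaH3 {p q : ℕ} (I I1 : Matrix (Fin (p + 1)) (Fin (q + 2)) ℂ)
    (At Et : Matrix (Fin (q + 1)) (Fin (q + 1)) ℂ)
    (Gt Gt1 : Matrix (Fin (q + 1)) (Fin (q + 2)) ℂ)
    (K K1 : Matrix (Fin (p + 1)) (Fin (q + 1)) ℂ) (G : Matrix (Fin (p + 1)) (Fin (p + 2)) ℂ) :
    Matrix (Fin (p + 1)) (Fin (p + 1)) ℂ :=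
  (formulaH2 I I1 At Et Gt Gt1 K G + K1 * formulaH1 I1 At Et Gt Gt1 K G) *
      (formulaH2 I I1 At Et Gt Gt1 K G + K1 * formulaH1 I1 At Et Gt Gt1 K G)ᴴ +
    K1 * K1ᴴ

/-- `G1 * Uᵀ`, that is, all columns of `G1` except the first, on a level off the axes. -/
def formulaG1U {p q : ℕ} (I I1 : Matrix (Fin (p + 1)) (Fin (q + 2)) ℂ)
    (EtNew : Matrix (Fin (q + 2)) (Fin (q + 2)) ℂ)
    (Gp G1p : Matrix (Fin p) (Fin (p + 1)) ℂ) (At Et : Matrix (Fin (q + 1)) (Fin (q + 1)) ℂ)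
    (K K1 : Matrix (Fin (p + 1)) (Fin (q + 1)) ℂ) (G : Matrix (Fin (p + 1)) (Fin (p + 2)) ℂ) :
    Matrix (Fin (p + 1)) (Fin (p + 1)) ℂ :=
  (I * EtNew * I1ᵀ + Gpᴴ * G1p + K1 * (cj At)⁻¹ * Etᴴ * At * Kᴴ) * (shiftU (p + 1) * Gᴴ)⁻¹

/-- `G1` from `B = G1 * Uᵀ`: its `(1, 1)` entry is `√(1 - h)`, and the other entries of its first
column vanish. -/
def formulaG1 {p : ℕ} (h : ℝ) (B : Matrix (Fin (p + 1)) (Fin (p + 1)) ℂ) :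
    Matrix (Fin (p + 1)) (Fin (p + 2)) ℂ :=
  Matrix.single 0 0 ((Real.sqrt (1 - h) : ℝ) : ℂ) + B * shiftU (p + 1)

/-- The matrix `I`: first row and column are those of the identity, and `I * Gtᴴ = -Gᴴ * K`. -/
def formulaI {p q : ℕ} (K : Matrix (Fin p) (Fin q) ℂ) (G : Matrix (Fin p) (Fin (p + 1)) ℂ)
    (Gt : Matrix (Fin q) (Fin (q + 1)) ℂ) : Matrix (Fin (p + 1)) (Fin (q + 1)) ℂ :=
  corner p q - Gᴴ * K * (shiftU q * Gtᴴ)⁻¹ * shiftU q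

/-- `I1 = - conj A⁻¹ Eᴴ A I + Aᵀ I1' Gt`, with `I1'` from the level before. -/
def formulaI1 {p q : ℕ} (A E : Matrix (Fin (p + 1)) (Fin (p + 1)) ℂ)
    (I : Matrix (Fin (p + 1)) (Fin (q + 2)) ℂ) (I1p : Matrix (Fin (p + 1)) (Fin (q + 1)) ℂ)
    (Gt : Matrix (Fin (q + 1)) (Fin (q + 2)) ℂ) : Matrix (Fin (p + 1)) (Fin (q + 2)) ℂ :=
  -((cj A)⁻¹ * Eᴴ * A * I) + Aᵀ * I1p * Gt

/-- The solution `X` of `A X = (z or w) * v - E * (reverse of v)`, where `v` belongs to the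
level `(n, m)`. -/
def formulaΦ {p : ℕ} (A E : Matrix (Fin p) (Fin p) ℂ) (x : BiLaurent) (n m : ℕ)
    (v : Fin p → BiLaurent) : Fin p → BiLaurent :=
  act A⁻¹ ((fun i => x * v i) - act E (rev n m v))

/-! ### The construction from the parameters `u i j` -/

/-- Level `(0, 0)`. -/
def levelOrigin (u : ℤ → ℤ → ℂ) : Level 0 0 where
  E := 0
  A := 0
  Et := 0
  At := 0
  K := 0
  K1 := 0
  H3 := 0
  G := 0
  G1 := 0
  Gt := 0
  Gt1 := 0
  I := 1
  I1 := 1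
  Φ := fun _ => AddMonoidAlgebra.single 0 ((1 / Real.sqrt (u 0 0).re : ℝ) : ℂ)
  Φt := fun _ => AddMonoidAlgebra.single 0 ((1 / Real.sqrt (u 0 0).re : ℝ) : ℂ)

/-- Level `(n + 1, 0)` from level `(n, 0)`, with `E = u_{n+1,0}`.  As `K1` is empty here, the first
row of `Gt1` is a unit vector, which gives its `(1, 1)` entry. -/
def levelRight (u : ℤ → ℤ → ℂ) (n : ℕ) (l : Level n 0) : Level (n + 1) 0 :=
  let E : Matrix (Fin 1) (Fin 1) ℂ := Matrix.of fun _ _ => u (n + 1) 0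
  let A : Matrix (Fin 1) (Fin 1) ℂ :=
    Matrix.of fun _ _ => ((Real.sqrt (1 - ‖u (n + 1) 0‖ ^ 2) : ℝ) : ℂ)
  let Gt := shiftU (n + 1)
  let B := l.Iᴴ * E * l.I1 + l.Gtᴴ * l.Gt1
  let I : Matrix (Fin 1) (Fin (n + 2)) ℂ := corner 0 (n + 1)
  let Φ := formulaΦ A E (mono 1 0) n 0 l.Φ
  { E := E
    A := A
    Et := 0
    At := 0
    K := 0
    K1 := 0
    H3 := 0
    G := 0
    G1 := 0
    Gt := Gt
    Gt1 := formulaG1 (∑ j, ‖B 0 j‖ ^ 2) B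
    I := I
    I1 := formulaI1 A E I l.I1 Gt
    Φ := Φ
    Φt := act Iᴴ Φ + act Gtᴴ l.Φt }

/-- Level `(0, m + 1)` from level `(0, m)`, with `Et = u_{0,m+1}`.  As `K1` is empty here, the first
row of `G1` is a unit vector, which gives its `(1, 1)` entry. -/
def levelUp (u : ℤ → ℤ → ℂ) (m : ℕ) (l : Level 0 m) : Level 0 (m + 1) :=
  let Et : Matrix (Fin 1) (Fin 1) ℂ := Matrix.of fun _ _ => u 0 (m + 1)
  let At : Matrix (Fin 1) (Fin 1) ℂ :=
    Matrix.of fun _ _ => ((Real.sqrt (1 - ‖u 0 (m + 1)‖ ^ 2) : ℝ) : ℂ)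
  let G := shiftU (m + 1)
  let B := l.I * Et * l.I1ᵀ + l.Gᴴ * l.G1
  let I : Matrix (Fin (m + 2)) (Fin 1) ℂ := corner (m + 1) 0
  let Φt := formulaΦ At Et (mono 0 1) 0 m l.Φt
  { E := 0
    A := 0
    Et := Et
    At := At
    K := 0
    K1 := 0
    H3 := 0
    G := G
    G1 := formulaG1 (∑ j, ‖B 0 j‖ ^ 2) B
    Gt := 0
    Gt1 := 0
    I := I
    I1 := (formulaI1 At Et Iᴴ l.I1ᵀ G)ᵀ
    Φ := act I Φt + act Gᴴ l.Φ
    Φt := Φt }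

/-- The matrix `K` on level `(n + 1, m + 1)`, from `P` on level `(n + 1, m)` and `Q` on level
`(n, m + 1)`.  Writing `X = P.lead⁻¹ * K * (Q.leadtᴴ)⁻¹`, the last entry of `X` is the parameter
`u_{-(n+1),m+1}`, the rows of `X` above the last one are `H`, and the columns before the last one
are `Ht`.  The matrices `P.G1 * P.lead * (shiftU1 m)ᵀ` and `Q.Gt1 * Q.leadt * (shiftU1 n)ᵀ` are the
leading coefficients of `Φ` on level `(n + 1, m - 1)` and of `Φt` on level `(n - 1, m + 1)`.  On
level `(1, 1)` the scalar `K` itself is the parameter `u_{-1,1}`. -/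
def stepK (u : ℤ → ℤ → ℂ) (n m : ℕ) (P : Level (n + 1) m) (Q : Level n (m + 1)) :
    Matrix (Fin (m + 1)) (Fin (n + 1)) ℂ :=
  let H : Matrix (Fin m) (Fin (n + 1)) ℂ :=
    (P.G1 * P.lead * (shiftU1 m)ᵀ)⁻¹ * (P.K * (Q.At⁻¹)ᴴ - P.K1 * Q.Etᴴ * (Q.At⁻¹)ᴴ) *
      (Q.leadtᴴ)⁻¹
  let Ht : Matrix (Fin (m + 1)) (Fin n) ℂ :=
    P.lead⁻¹ * (P.A⁻¹ * Q.K - P.A⁻¹ * P.E * cj Q.K1) * ((Q.Gt1 * Q.leadt * (shiftU1 n)ᵀ)ᴴ)⁻¹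
  if n = 0 ∧ m = 0 then Matrix.of fun _ _ => u (-1) 1
  else
    P.lead *
      (Matrix.single (Fin.last m) (Fin.last n) (u (-(n + 1)) (m + 1)) + (shiftU1 m)ᵀ * H +
        Matrix.single (Fin.last m) (Fin.last m) (1 : ℂ) * Ht * shiftU1 n) *
      Q.leadtᴴ

/-- The matrix `K1` on level `(n + 1, m + 1)`, from `P` on level `(n + 1, m)` and `Q` on level
`(n, m + 1)`: its `(1, 1)` entry is `conj u_{n+1,m+1}`, its rows below the first one are `R`, and
the other entries of its first row are those of `C`. -/
def stepK1 (u : ℤ → ℤ → ℂ) (n m : ℕ) (P : Level (n + 1) m) (Q : Level n (m + 1)) :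
    Matrix (Fin (m + 1)) (Fin (n + 1)) ℂ :=
  let R : Matrix (Fin m) (Fin (n + 1)) ℂ :=
    (P.G * (shiftU m)ᵀ)⁻¹ * (P.K1 * (Q.At⁻¹)ᵀ - P.K * Q.Et * (Q.At⁻¹)ᵀ)
  let C : Matrix (Fin (m + 1)) (Fin n) ℂ :=
    (P.A⁻¹ * Q.K1 - P.A⁻¹ * P.E * cj Q.K) * (shiftU n * Q.Gtᵀ)⁻¹
  Matrix.single 0 0 (star (u (n + 1) (m + 1))) + (shiftU m)ᵀ * R +
    corner m m * C * shiftU n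

/-- Level `(n + 1, m + 1)` from `P` on level `(n + 1, m)` and `Q` on level `(n, m + 1)`. -/
def levelStep (u : ℤ → ℤ → ℂ) (n m : ℕ) (P : Level (n + 1) m) (Q : Level n (m + 1)) :
    Level (n + 1) (m + 1) :=
  let K := stepK u n m P Q
  let K1 := stepK1 u n m P Q
  let G := upperCholesky (1 - K * Kᴴ) * shiftU (m + 1)
  let Gt := upperCholesky (1 - Kᴴ * K) * shiftU (n + 1)
  let E := formulaE P.A P.E K K1 Q.I Q.I1 Q.G Q.G1
  let Et := formulaE Q.At Q.Et Kᴴ K1ᵀ P.Iᴴ P.I1ᵀ P.Gt P.Gt1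
  let A := upperCholesky (1 - E * Eᴴ)
  let At := upperCholesky (1 - Et * Etᴴ)
  let H3 := formulaH3 P.I P.I1 Q.At Q.Et P.Gt P.Gt1 K K1 G
  let H3t := formulaH3 Q.Iᴴ Q.I1ᵀ P.A P.E Q.G Q.G1 Kᴴ K1ᵀ Gt
  let I := formulaI K G Gt
  { E := E
    A := A
    Et := Et
    At := At
    K := K
    K1 := K1
    H3 := H3
    G := G
    G1 := formulaG1 (H3 0 0).re (formulaG1U P.I P.I1 Et P.G P.G1 Q.At Q.Et K K1 G)
    Gt := Gt
    Gt1 := formulaG1 (H3t 0 0).re (formulaG1U Q.Iᴴ Q.I1ᵀ E Q.Gt Q.Gt1 P.A P.E Kᴴ K1ᵀ Gt)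
    I := I
    I1 := formulaI1 A E I Q.I1 Gt
    Φ := formulaΦ A E (mono 1 0) n (m + 1) Q.Φ
    Φt := formulaΦ At Et (mono 0 1) (n + 1) m P.Φt }

/-- All levels `(0, m)`. -/
def columnZero (u : ℤ → ℤ → ℂ) : (m : ℕ) → Level 0 m
  | 0 => levelOrigin u
  | m + 1 => levelUp u m (columnZero u m)

/-- All levels `(n + 1, m)` from all levels `(n, m)`. -/
def columnSucc (u : ℤ → ℤ → ℂ) (n : ℕ) (c : (m : ℕ) → Level n m) : (m : ℕ) → Level (n + 1) m
  | 0 => levelRight u n (c 0)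
  | m + 1 => levelStep u n m (columnSucc u n c m) (c (m + 1))

/-- The coefficients and polynomials constructed from the parameters `u` on the level `(n, m)`. -/
def level (u : ℤ → ℤ → ℂ) : (n m : ℕ) → Level n m
  | 0 => columnZero u
  | n + 1 => columnSucc u n (level u n)

open scoped Matrix.Norms.L2Operator in
/-- The conditions on the parameters, on all levels.  The norm of `K` is its operator norm with
respect to the Euclidean norms. -/
structure Admissible (u : ℤ → ℤ → ℂ) : Prop where
  origin : 0 < (u 0 0).re ∧ (u 0 0).im = 0
  right : ∀ n : ℕ, ‖(level u (n + 1) 0).E 0 0‖ < 1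
  up : ∀ m : ℕ, ‖(level u 0 (m + 1)).Et 0 0‖ < 1
  contraction : ∀ n m : ℕ, ‖(level u (n + 1) (m + 1)).K‖ < 1
  schur : ∀ n m : ℕ, ((level u (n + 1) (m + 1)).H3 0 0).re < 1

/-! ### The functional -/

/-- `L (p p†) > 0` for every nonzero `p`. -/
def IsPositiveDefinite (L : BiLaurent →ₗ[ℂ] ℂ) : Prop :=
  ∀ p : BiLaurent, p ≠ 0 → 0 < (L (p * dagger p)).re ∧ (L (p * dagger p)).im = 0

/-- The polynomials constructed from `u` are orthonormal for `L`:
`L (Φ_{i,m} Φ_{j,m}†) = δ_{ij} I` and `L (Φt_{n,i} Φt_{n,j}†) = δ_{ij} I`. -/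
def IsBuiltFrom (u : ℤ → ℤ → ℂ) (L : BiLaurent →ₗ[ℂ] ℂ) : Prop :=
  (∀ m i j : ℕ, ∀ a b : Fin (m + 1),
      L ((level u i m).Φ a * dagger ((level u j m).Φ b)) = if i = j ∧ a = b then 1 else 0) ∧
    ∀ n i j : ℕ, ∀ a b : Fin (n + 1),
      L ((level u n i).Φt a * dagger ((level u n j).Φt b)) = if i = j ∧ a = b then 1 else 0

end Bicircle

end

noncomputable section
namespace Bicircle

/-! ### The involution on Laurent polynomials -/

/-! Write ⟨V, W⟩ for the matrix of the values L(V_a W_b†). For a hermitian functional L that is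
positive definite, let Φ on level (n, m) be the orthonormal basis of the complement of the box n ×
(m+1) in the box (n+1) × (m+1), normalised by an upper triangular leading matrix with positive
diagonal (`IsLex`), and Φt the same with the variables exchanged. Every matrix of the construction
is then an inner product: K = ⟨Φ_{n,m-1}, Φt_{n-1,m}⟩, K1 = ⟨zwΦ_{n,m-1}, z^n w^m Φt_{n-1,m}†⟩, Γ =
⟨Φ_{n,m-1}, Φ_{n,m}⟩, Γ1 = ⟨wΦ_{n,m-1}, Φ_{n,m}⟩, A = ⟨zΦ_{n-1,m}, Φ_{n,m}⟩, E = ⟨zΦ_{n-1,m},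
Φ_{n-1,m}^←⟩, I = ⟨Φ, Φt⟩, I1 = ⟨Φ^←, Φt⟩. The formulas between them come from one device: an inner
product is expanded in orthonormal bases of successive complements (`Comp.ins`, `Comp.ins₂`), in two
ways, and the results are compared. Everything is done for two unimodular variables x, y, so that
exchanging them gives the tilde versions.

The theorem reads these identities backwards. When the levels (n+1, m) and (n, m+1) are known, all
entries of K and K1 on level (n+1, m+1) are forced, up to the normalisation of K by leading
matrices, except one in each; these two are the free parameters (`stepK_eq`, `stepK1_eq`). The
condition ‖K‖ < 1 allows Φ_{n+1,m} to be orthonormalised modulo Φt_{n,m+1} (`psi_comp`). The number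
1 - (H3)_{11} is the squared distance from w times the first entry of Φ_{n+1,m} to the sum of the
two smaller boxes; if it is positive there is one new polynomial, the common first entry of Φ and Φt
(`exists_top`). So the form extends positively to the larger box, and all data on the new level are
the inner products they should be (`good_step`).

The functional exists because the free parameters prescribe it at polynomials whose leading
exponents, together with their negatives and 0, are distinct, all other exponents being smaller;
this is a triangular system (`exists_herm_functional`). It is solved before anything is known about
the levels, and the prescribed value is granted as soon as the leading term is known to be there, so
that the induction over the levels in `exists_good` is not circular.

Positive definiteness passes from boxes to all Laurent polynomials by a shift. Uniqueness holds
because every monomial is a product p q† with p and q in the span of the Φ's of one row of levels.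
The measure is a weak limit of discrete probability measures whose moments are the Fejér means of
the moments of L (`exists_fejer_measure`). -/

theorem dagger_single (a : ℤ × ℤ) (c : ℂ) :
    dagger (AddMonoidAlgebra.single a c) = AddMonoidAlgebra.single (-a) (star c) := by
  simp [dagger]

theorem dagger_add (p q : BiLaurent) : dagger (p + q) = dagger p + dagger q := by
  classical
  simp only [dagger, AddMonoidAlgebra.coeff_add]
  exact Finsupp.sum_add_index (by simp) (by simp)

/-- The involution as an additive homomorphism. -/
def daggerHom : BiLaurent →+ BiLaurent where
  toFun := dagger
  map_zero' := by simp [dagger]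
  map_add' := dagger_add

theorem dagger_zero : dagger 0 = 0 := daggerHom.map_zero

theorem dagger_sub (p q : BiLaurent) : dagger (p - q) = dagger p - dagger q :=
  daggerHom.map_sub p q

theorem dagger_sum {ι : Type*} (s : Finset ι) (f : ι → BiLaurent) :
    dagger (∑ i ∈ s, f i) = ∑ i ∈ s, dagger (f i) := map_sum daggerHom f s

theorem dagger_smul (c : ℂ) (p : BiLaurent) : dagger (c • p) = star c • dagger p := by
  induction p using AddMonoidAlgebra.induction_linear with
  | zero => simp [dagger_zero]
  | add p q hp hq => rw [smul_add, dagger_add, hp, hq, dagger_add, smul_add]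
  | single a d => simp [dagger_single]

theorem dagger_mul (p q : BiLaurent) : dagger (p * q) = dagger p * dagger q := by
  induction p using AddMonoidAlgebra.induction_linear with
  | zero => simp [dagger_zero]
  | add p p' hp hp' => rw [add_mul, dagger_add, hp, hp', dagger_add, add_mul]
  | single a c =>
    induction q using AddMonoidAlgebra.induction_linear with
    | zero => simp [dagger_zero]
    | add p p' hp hp' => rw [mul_add, dagger_add, hp, hp', dagger_add, mul_add]
    | single b d => simp [dagger_single, AddMonoidAlgebra.single_mul_single, add_comm]

theorem dagger_dagger (p : BiLaurent) : dagger (dagger p) = p := by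
  induction p using AddMonoidAlgebra.induction_linear with
  | zero => simp [dagger_zero]
  | add p q hp hq => rw [dagger_add, dagger_add, hp, hq]
  | single a d => simp [dagger_single]

theorem dagger_mono (i j : ℤ) : dagger (mono i j) = mono (-i) (-j) := by
  simp [mono, dagger_single]

theorem mono_mul_mono (i j k l : ℤ) : mono i j * mono k l = mono (i + k) (j + l) := by
  simp [mono, AddMonoidAlgebra.single_mul_single]

theorem mono_zero : mono 0 0 = 1 := rfl

theorem mono_pow (i j : ℤ) (k : ℕ) : mono i j ^ k = mono (k * i) (k * j) := by
  induction k with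
  | zero => simp [mono_zero]
  | succ k ih => rw [pow_succ, ih, mono_mul_mono]; push_cast; ring_nf

theorem dagger_one : dagger 1 = 1 := by rw [← mono_zero, dagger_mono]; simp

theorem dagger_pow (p : BiLaurent) (k : ℕ) : dagger (p ^ k) = dagger p ^ k := by
  induction k with
  | zero => simp [dagger_one]
  | succ k ih => rw [pow_succ, dagger_mul, ih, pow_succ]

/-- A unit `x` with inverse `x†`. -/
def IsUni (x : BiLaurent) : Prop := x * dagger x = 1

theorem isUni_mono (i j : ℤ) : IsUni (mono i j) := by
  simp [IsUni, dagger_mono, mono_mul_mono, mono_zero]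

theorem IsUni.mul {x y : BiLaurent} (hx : IsUni x) (hy : IsUni y) : IsUni (x * y) := by
  unfold IsUni at *
  rw [dagger_mul, mul_mul_mul_comm, hx, hy, one_mul]

theorem IsUni.pow {x : BiLaurent} (hx : IsUni x) (k : ℕ) : IsUni (x ^ k) := by
  unfold IsUni at *
  rw [dagger_pow, ← mul_pow, hx, one_pow]

/-! ### Vectors of polynomials and Gram matrices -/

variable {L : BiLaurent →ₗ[ℂ] ℂ} {k l j : ℕ}

/-- The functional is hermitian. -/
def Herm (L : BiLaurent →ₗ[ℂ] ℂ) : Prop := ∀ p, L (dagger p) = star (L p)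

/-- The matrix with entries `L (V a * (W b)†)`. -/
def gram (L : BiLaurent →ₗ[ℂ] ℂ) (V : Fin k → BiLaurent) (W : Fin l → BiLaurent) :
    Matrix (Fin k) (Fin l) ℂ := Matrix.of fun a b => L (V a * dagger (W b))

/-- Multiplication of a vector by a polynomial. -/
def scale (x : BiLaurent) (V : Fin k → BiLaurent) : Fin k → BiLaurent := fun a => x * V a

/-- The vector with entries `x * (V a)†`. -/
def rvv (x : BiLaurent) (V : Fin k → BiLaurent) : Fin k → BiLaurent := fun a => x * dagger (V a)

theorem gram_apply (V : Fin k → BiLaurent) (W : Fin l → BiLaurent) (a : Fin k) (b : Fin l) :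
    gram L V W a b = L (V a * dagger (W b)) := rfl

theorem act_apply (A : Matrix (Fin k) (Fin l) ℂ) (V : Fin l → BiLaurent) (a : Fin k) :
    act A V a = ∑ b, A a b • V b := rfl

theorem act_act (A : Matrix (Fin k) (Fin l) ℂ) (B : Matrix (Fin l) (Fin j) ℂ)
    (V : Fin j → BiLaurent) : act A (act B V) = act (A * B) V := by
  funext a
  simp only [act_apply, Matrix.mul_apply, Finset.smul_sum, Finset.sum_smul, smul_smul]
  exact Finset.sum_comm

theorem act_one (V : Fin k → BiLaurent) : act 1 V = V := by
  funext a
  simp [act_apply, Matrix.one_apply]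

theorem act_add_vec (A : Matrix (Fin k) (Fin l) ℂ) (V W : Fin l → BiLaurent) :
    act A (V + W) = act A V + act A W := by
  funext a
  simp [act_apply, smul_add, Finset.sum_add_distrib]

theorem act_sub_vec (A : Matrix (Fin k) (Fin l) ℂ) (V W : Fin l → BiLaurent) :
    act A (V - W) = act A V - act A W := by
  funext a
  simp [act_apply, smul_sub, Finset.sum_sub_distrib]

theorem scale_act (x : BiLaurent) (A : Matrix (Fin k) (Fin l) ℂ) (V : Fin l → BiLaurent) :
    scale x (act A V) = act A (scale x V) := by
  funext a
  simp [act_apply, scale, Finset.mul_sum]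

theorem gram_act_left (A : Matrix (Fin j) (Fin k) ℂ) (V : Fin k → BiLaurent)
    (W : Fin l → BiLaurent) : gram L (act A V) W = A * gram L V W := by
  ext a b
  simp [gram_apply, act_apply, Matrix.mul_apply, Finset.sum_mul]

theorem gram_act_right (V : Fin k → BiLaurent) (A : Matrix (Fin j) (Fin l) ℂ)
    (W : Fin l → BiLaurent) : gram L V (act A W) = gram L V W * Aᴴ := by
  ext a b
  simp [gram_apply, act_apply, Matrix.mul_apply, Finset.mul_sum, dagger_sum, dagger_smul,
    mul_comm]

theorem gram_add_left (V V' : Fin k → BiLaurent) (W : Fin l → BiLaurent) :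
    gram L (V + V') W = gram L V W + gram L V' W := by
  ext a b
  simp [gram_apply, add_mul]

theorem gram_sub_left (V V' : Fin k → BiLaurent) (W : Fin l → BiLaurent) :
    gram L (V - V') W = gram L V W - gram L V' W := by
  ext a b
  simp [gram_apply, sub_mul]

theorem gram_add_right (V : Fin k → BiLaurent) (W W' : Fin l → BiLaurent) :
    gram L V (W + W') = gram L V W + gram L V W' := by
  ext a b
  simp [gram_apply, mul_add, dagger_add]

theorem gram_sub_right (V : Fin k → BiLaurent) (W W' : Fin l → BiLaurent) :
    gram L V (W - W') = gram L V W - gram L V W' := by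
  ext a b
  simp [gram_apply, mul_sub, dagger_sub]

theorem Herm.swap (hL : Herm L) (p q : BiLaurent) :
    star (L (p * dagger q)) = L (q * dagger p) := by
  rw [← hL, dagger_mul, dagger_dagger, mul_comm]

theorem gram_conjTranspose (hL : Herm L) (V : Fin k → BiLaurent) (W : Fin l → BiLaurent) :
    (gram L V W)ᴴ = gram L W V := by
  ext a b
  simp only [Matrix.conjTranspose_apply, gram_apply, hL.swap]

theorem gram_scale {x : BiLaurent} (hx : IsUni x) (V : Fin k → BiLaurent)
    (W : Fin l → BiLaurent) : gram L (scale x V) (scale x W) = gram L V W := by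
  ext a b
  simp only [gram_apply, scale, dagger_mul]
  rw [mul_mul_mul_comm, hx, one_mul]

theorem gram_rvv {x : BiLaurent} (hx : IsUni x) (V : Fin k → BiLaurent)
    (W : Fin l → BiLaurent) : gram L (rvv x V) (rvv x W) = (gram L W V)ᵀ := by
  ext a b
  simp only [gram_apply, rvv, dagger_mul, dagger_dagger, Matrix.transpose_apply]
  rw [mul_mul_mul_comm, hx, one_mul, mul_comm]

theorem gram_rvv' (hL : Herm L) {x : BiLaurent} (hx : IsUni x) (V : Fin k → BiLaurent)
    (W : Fin l → BiLaurent) : gram L (rvv x V) (rvv x W) = cj (gram L V W) := by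
  rw [gram_rvv hx, ← gram_conjTranspose hL]
  rfl

/-- Raising the degree of the reversal by one compensates for a multiplication by the variable.
Reverses taken on neighbouring levels are compared in this way. -/
theorem rvv_mul_scale {x : BiLaurent} (hx : IsUni x) (v : BiLaurent) (V : Fin k → BiLaurent) :
    rvv (v * x) (scale x V) = rvv v V := by
  funext a
  simp only [rvv, scale, dagger_mul]
  have hx' : x * dagger x = 1 := hx
  linear_combination (v * dagger (V a)) * hx'

theorem scale_rvv (x v : BiLaurent) (V : Fin k → BiLaurent) :
    scale x (rvv v V) = rvv (v * x) V := by
  funext a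
  simp only [rvv, scale]
  ring

/-- `L (rvv x V, W)` is symmetric under exchange. -/
theorem gram_rvv_transpose (x : BiLaurent) (V : Fin k → BiLaurent) (W : Fin l → BiLaurent) :
    (gram L (rvv x V) W)ᵀ = gram L (rvv x W) V := by
  ext a b
  simp only [Matrix.transpose_apply, gram_apply, rvv]
  congr 1
  ring

end Bicircle
end

noncomputable section
namespace Bicircle

variable {L : BiLaurent →ₗ[ℂ] ℂ} {k l j : ℕ}

/-! ### Image subspaces -/

/-- The subspace `x * S` for a unit `x` with inverse `x†`. -/
def mulS (x : BiLaurent) (S : Submodule ℂ BiLaurent) : Submodule ℂ BiLaurent where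
  carrier := {p | dagger x * p ∈ S}
  zero_mem' := by simp
  add_mem' := fun {p q} hp hq => by simpa [mul_add] using S.add_mem hp hq
  smul_mem' := fun c p hp => by simpa using S.smul_mem c hp

/-- The subspace of all `x * s†` with `s ∈ S`, for a unit `x` with inverse `x†`. -/
def rvS (x : BiLaurent) (S : Submodule ℂ BiLaurent) : Submodule ℂ BiLaurent where
  carrier := {p | x * dagger p ∈ S}
  zero_mem' := by simp [dagger_zero]
  add_mem' := fun {p q} hp hq => by simpa [mul_add, dagger_add] using S.add_mem hp hq
  smul_mem' := fun c p hp => by simpa [dagger_smul] using S.smul_mem (star c) hp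

theorem mem_mulS {x p : BiLaurent} {S : Submodule ℂ BiLaurent} :
    p ∈ mulS x S ↔ dagger x * p ∈ S := Iff.rfl

theorem mem_rvS {x p : BiLaurent} {S : Submodule ℂ BiLaurent} :
    p ∈ rvS x S ↔ x * dagger p ∈ S := Iff.rfl

theorem IsUni.dagger_mul_cancel {x : BiLaurent} (hx : IsUni x) (p : BiLaurent) :
    dagger x * (x * p) = p := by
  rw [← mul_assoc, mul_comm (dagger x), hx, one_mul]

theorem IsUni.mul_dagger_cancel {x : BiLaurent} (hx : IsUni x) (p : BiLaurent) :
    x * (dagger x * p) = p := by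
  rw [← mul_assoc, hx, one_mul]

theorem IsUni.rev_rev {x : BiLaurent} (hx : IsUni x) (p : BiLaurent) :
    x * dagger (x * dagger p) = p := by
  rw [dagger_mul, dagger_dagger, hx.mul_dagger_cancel]

theorem mul_mem_mulS {x p : BiLaurent} (hx : IsUni x) {S : Submodule ℂ BiLaurent} :
    x * p ∈ mulS x S ↔ p ∈ S := by
  rw [mem_mulS, hx.dagger_mul_cancel]

theorem rev_mem_rvS {x p : BiLaurent} (hx : IsUni x) {S : Submodule ℂ BiLaurent} :
    x * dagger p ∈ rvS x S ↔ p ∈ S := by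
  rw [mem_rvS, hx.rev_rev]

/-! ### Orthogonal complements -/

/-- All components of `V` are orthogonal to `S`. -/
def Perp (L : BiLaurent →ₗ[ℂ] ℂ) (V : Fin k → BiLaurent) (S : Submodule ℂ BiLaurent) : Prop :=
  ∀ a, ∀ s ∈ S, L (V a * dagger s) = 0

/-- The subspace contains all components of `V`. -/
def Inn (V : Fin k → BiLaurent) (S : Submodule ℂ BiLaurent) : Prop := ∀ a, V a ∈ S

theorem Inn.mono {V : Fin k → BiLaurent} {S T : Submodule ℂ BiLaurent} (h : Inn V S)
    (hST : S ≤ T) : Inn V T := fun a => hST (h a)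

theorem Perp.mono {V : Fin k → BiLaurent} {S T : Submodule ℂ BiLaurent} (h : Perp L V T)
    (hST : S ≤ T) : Perp L V S := fun a s hs => h a s (hST hs)

theorem Inn.act {V : Fin k → BiLaurent} {S : Submodule ℂ BiLaurent} (h : Inn V S)
    (A : Matrix (Fin l) (Fin k) ℂ) : Inn (act A V) S :=
  fun _ => S.sum_mem fun b _ => S.smul_mem _ (h b)

theorem Inn.sub {V W : Fin k → BiLaurent} {S : Submodule ℂ BiLaurent} (h : Inn V S)
    (h' : Inn W S) : Inn (V - W) S := fun a => S.sub_mem (h a) (h' a)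

theorem Inn.add {V W : Fin k → BiLaurent} {S : Submodule ℂ BiLaurent} (h : Inn V S)
    (h' : Inn W S) : Inn (V + W) S := fun a => S.add_mem (h a) (h' a)

theorem Perp.gram_zero {V : Fin k → BiLaurent} {W : Fin l → BiLaurent} {S : Submodule ℂ BiLaurent}
    (h : Perp L V S) (hW : Inn W S) : gram L V W = 0 := by
  ext a b
  exact h a _ (hW b)

theorem Perp.gram_zero' (hL : Herm L) {V : Fin k → BiLaurent} {W : Fin l → BiLaurent}
    {S : Submodule ℂ BiLaurent} (h : Perp L V S) (hW : Inn W S) : gram L W V = 0 := by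
  rw [← gram_conjTranspose hL, h.gram_zero hW, Matrix.conjTranspose_zero]

theorem Inn.scale {V : Fin k → BiLaurent} {S : Submodule ℂ BiLaurent} (h : Inn V S)
    {x : BiLaurent} (hx : IsUni x) : Inn (scale x V) (mulS x S) :=
  fun a => (mul_mem_mulS hx).2 (h a)

theorem Inn.rvv {V : Fin k → BiLaurent} {S : Submodule ℂ BiLaurent} (h : Inn V S)
    {x : BiLaurent} (hx : IsUni x) : Inn (rvv x V) (rvS x S) :=
  fun a => (rev_mem_rvS hx).2 (h a)

theorem Perp.scale {V : Fin k → BiLaurent} {S : Submodule ℂ BiLaurent} (h : Perp L V S)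
    {x : BiLaurent} : Perp L (scale x V) (mulS x S) := by
  intro a s hs
  have := h a _ hs
  rw [dagger_mul, dagger_dagger] at this
  rw [← this, Bicircle.scale]
  congr 1
  ring

theorem Perp.rvv (hL : Herm L) {V : Fin k → BiLaurent} {S : Submodule ℂ BiLaurent}
    (h : Perp L V S) {x : BiLaurent} : Perp L (rvv x V) (rvS x S) := by
  intro a s hs
  have := h a _ hs
  rw [← star_inj, hL.swap, star_zero] at this
  rw [← this, Bicircle.rvv]
  congr 1
  ring

theorem Perp.act {V : Fin k → BiLaurent} {S : Submodule ℂ BiLaurent} (h : Perp L V S)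
    (A : Matrix (Fin l) (Fin k) ℂ) : Perp L (act A V) S := by
  intro a s hs
  simp [act_apply, Finset.sum_mul, h _ s hs]

theorem Perp.sub {V W : Fin k → BiLaurent} {S : Submodule ℂ BiLaurent} (h : Perp L V S)
    (h' : Perp L W S) : Perp L (V - W) S := by
  intro a s hs
  simp [sub_mul, h _ s hs, h' _ s hs]

/-- `W` is an orthonormal basis of the orthogonal complement of `S` in `S'`. -/
structure Comp (L : BiLaurent →ₗ[ℂ] ℂ) (W : Fin k → BiLaurent) (S S' : Submodule ℂ BiLaurent) :
    Prop where
  inn : Inn W S'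
  perp : Perp L W S
  norm : gram L W W = 1
  red : ∀ p ∈ S', ∃ C : Fin k → ℂ, p - ∑ b, C b • W b ∈ S

theorem Perp.of_gram_comp {W : Fin k → BiLaurent} {S S' : Submodule ℂ BiLaurent}
    (hW : Comp L W S S') {V : Fin l → BiLaurent} (h : Perp L V S) (h' : gram L V W = 0) :
    Perp L V S' := by
  intro a s hs
  obtain ⟨C, hC⟩ := hW.red s hs
  have h1 := h a _ hC
  have h2 : ∀ b, L (V a * dagger (W b)) = 0 := fun b => congrFun (congrFun h' a) b
  rw [dagger_sub, dagger_sum, mul_sub, map_sub, Finset.mul_sum, map_sum, sub_eq_zero] at h1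
  rw [h1]
  refine Finset.sum_eq_zero fun b _ => ?_
  rw [dagger_smul, mul_smul_comm, map_smul, h2, smul_zero]

/-- Pairing the decomposition with `W b` identifies its coefficients as inner products, so the
remainder in `S` is the vector minus its projection. -/
theorem Comp.red_vec {W : Fin k → BiLaurent} {S S' : Submodule ℂ BiLaurent}
    (hW : Comp L W S S') {V : Fin l → BiLaurent} (hV : Inn V S') (hL : Herm L) :
    Inn (V - act (gram L V W) W) S := by
  intro a
  obtain ⟨C, hC⟩ := hW.red _ (hV a)
  have : ∀ b, gram L V W a b = C b := by
    intro b
    have h1 := hW.perp b _ hC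
    rw [← star_inj, hL.swap, star_zero, sub_mul, map_sub, sub_eq_zero] at h1
    rw [gram_apply, h1, Finset.sum_mul, map_sum]
    have h2 : ∀ c, L (C c • W c * dagger (W b)) = C c * (1 : Matrix (Fin k) (Fin k) ℂ) c b := by
      intro c
      rw [← hW.norm, smul_mul_assoc, map_smul]
      rfl
    rw [Finset.sum_congr rfl fun c _ => h2 c]
    simp [Matrix.one_apply]
  simpa [act_apply, this] using hC

/-- Insertion of a complete orthonormal system. -/
theorem Comp.ins {W : Fin k → BiLaurent} {S S' : Submodule ℂ BiLaurent}
    (hW : Comp L W S S') (hL : Herm L) {V : Fin l → BiLaurent} (hV : Inn V S')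
    {U : Fin j → BiLaurent} (hU : Perp L U S) :
    gram L V U = gram L V W * gram L W U := by
  -- Only the remainder of `V` has to be orthogonal to `U`; hence `U` need not lie in `S'`.
  have h := hU.gram_zero' hL (hW.red_vec hV hL)
  rwa [gram_sub_left, gram_act_left, sub_eq_zero] at h

theorem Comp.ins' {W : Fin k → BiLaurent} {S S' : Submodule ℂ BiLaurent}
    (hW : Comp L W S S') (hL : Herm L) {V : Fin l → BiLaurent} (hV : Perp L V S)
    {U : Fin j → BiLaurent} (hU : Inn U S') :
    gram L V U = gram L V W * gram L W U := by
  have h := hW.ins hL hU hV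
  rw [← gram_conjTranspose hL, h, Matrix.conjTranspose_mul, gram_conjTranspose hL,
    gram_conjTranspose hL]

/-- Insertion of two orthonormal systems that fill successive complements. -/
theorem Comp.ins₂ {i : ℕ} {W : Fin k → BiLaurent} {Z : Fin i → BiLaurent}
    {S S' S'' : Submodule ℂ BiLaurent}
    (hW : Comp L W S' S'') (hZ : Comp L Z S S') (hL : Herm L) {V : Fin l → BiLaurent}
    (hV : Inn V S'') {U : Fin j → BiLaurent} (hU : Perp L U S) :
    gram L V U = gram L V W * gram L W U + gram L V Z * gram L Z U := by
  have h := hZ.ins hL (hW.red_vec hV hL) hU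
  have h0 : gram L W Z = 0 := hW.perp.gram_zero hZ.inn
  rw [gram_sub_left, gram_sub_left, gram_act_left, gram_act_left, h0, Matrix.mul_zero,
    sub_zero, sub_eq_iff_eq_add] at h
  rw [h, add_comm]

theorem Comp.ins₂' {i : ℕ} {W : Fin k → BiLaurent} {Z : Fin i → BiLaurent}
    {S S' S'' : Submodule ℂ BiLaurent}
    (hW : Comp L W S' S'') (hZ : Comp L Z S S') (hL : Herm L) {V : Fin l → BiLaurent}
    (hV : Perp L V S) {U : Fin j → BiLaurent} (hU : Inn U S'') :
    gram L V U = gram L V W * gram L W U + gram L V Z * gram L Z U := by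
  have h := hW.ins₂ hZ hL hU hV
  rw [← gram_conjTranspose hL, h, Matrix.conjTranspose_add, Matrix.conjTranspose_mul,
    Matrix.conjTranspose_mul]
  simp only [gram_conjTranspose hL]

theorem Comp.scale {W : Fin k → BiLaurent} {S S' : Submodule ℂ BiLaurent}
    (hW : Comp L W S S') {x : BiLaurent} (hx : IsUni x) :
    Comp L (scale x W) (mulS x S) (mulS x S') where
  inn := hW.inn.scale hx
  perp := hW.perp.scale
  norm := by rw [gram_scale hx, hW.norm]
  red p hp := by
    obtain ⟨C, hC⟩ := hW.red _ hp
    refine ⟨C, ?_⟩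
    rw [mem_mulS, mul_sub, Finset.mul_sum]
    simpa [Bicircle.scale, mul_smul_comm, hx.dagger_mul_cancel] using hC

theorem Comp.rvv (hL : Herm L) {W : Fin k → BiLaurent} {S S' : Submodule ℂ BiLaurent}
    (hW : Comp L W S S') {x : BiLaurent} (hx : IsUni x) :
    Comp L (rvv x W) (rvS x S) (rvS x S') where
  inn := hW.inn.rvv hx
  perp := hW.perp.rvv hL
  norm := by rw [gram_rvv hx, hW.norm, Matrix.transpose_one]
  red p hp := by
    obtain ⟨C, hC⟩ := hW.red _ hp
    refine ⟨fun b => star (C b), ?_⟩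
    rw [mem_rvS, dagger_sub, dagger_sum, mul_sub, Finset.mul_sum]
    simpa [Bicircle.rvv, dagger_smul, mul_smul_comm, hx.rev_rev] using hC

/-- The form is positive definite on `S`. -/
def PD (L : BiLaurent →ₗ[ℂ] ℂ) (S : Submodule ℂ BiLaurent) : Prop :=
  ∀ p ∈ S, p ≠ 0 → 0 < (L (p * dagger p)).re

theorem PD.eq_zero {S : Submodule ℂ BiLaurent} (h : PD L S) {p : BiLaurent} (hp : p ∈ S)
    (h0 : L (p * dagger p) = 0) : p = 0 := by
  by_contra hne
  have := h p hp hne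
  simp [h0] at this

theorem PD.mono {S T : Submodule ℂ BiLaurent} (h : PD L T) (hST : S ≤ T) : PD L S :=
  fun p hp => h p (hST hp)

/-- Pythagoras: the value at `p` is the value at its component in `S` plus the squared length of the
coefficient vector, and one of the two is positive. -/
theorem Comp.pd {W : Fin k → BiLaurent} {S S' : Submodule ℂ BiLaurent}
    (hW : Comp L W S S') (hL : Herm L) (h : PD L S) : PD L S' := by
  intro p hp hp0
  obtain ⟨C, hC⟩ := hW.red p hp
  set s := p - ∑ b, C b • W b with hs
  let Cm : Matrix (Fin 1) (Fin k) ℂ := Matrix.of fun _ b => C b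
  have hpe : (fun _ : Fin 1 => p) = (fun _ => s) + act Cm W := by
    funext _
    simp [hs, act_apply, Cm]
  have hsW : gram L (fun _ : Fin 1 => s) W = 0 := hW.perp.gram_zero' hL (fun _ => hC)
  have hWs : gram L W (fun _ : Fin 1 => s) = 0 := hW.perp.gram_zero (fun _ => hC)
  have h1 : L (p * dagger p) = L (s * dagger s) + ∑ b, C b * star (C b) := by
    have : gram L (fun _ : Fin 1 => p) (fun _ : Fin 1 => p) =
        gram L (fun _ : Fin 1 => s) (fun _ : Fin 1 => s) + Cm * Cmᴴ := by
      rw [hpe, gram_add_left, gram_add_right, gram_add_right, gram_act_left, gram_act_left,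
        gram_act_right, gram_act_right, hsW, hWs, hW.norm]
      simp
    simpa [gram_apply, Matrix.mul_apply, Cm] using congrFun (congrFun this 0) 0
  have h2 : (∑ b, C b * star (C b)).re = ∑ b, ‖C b‖ ^ 2 := by
    rw [Complex.re_sum]
    refine Finset.sum_congr rfl fun b _ => ?_
    rw [Complex.star_def, Complex.mul_conj, Complex.ofReal_re, Complex.normSq_eq_norm_sq]
  rw [h1, Complex.add_re, h2]
  by_cases hs0 : s = 0
  · have hC0 : ∃ b, C b ≠ 0 := by
      by_contra! hC0
      apply hp0
      have : p = s + ∑ b, C b • W b := by rw [hs]; abel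
      rw [this, hs0]
      simp [hC0]
    obtain ⟨b, hb⟩ := hC0
    have : 0 < ∑ b, ‖C b‖ ^ 2 :=
      Finset.sum_pos' (fun _ _ => by positivity) ⟨b, Finset.mem_univ _, by positivity⟩
    simpa [hs0] using this
  · have := h s hC hs0
    positivity

end Bicircle
end

noncomputable section
namespace Bicircle

/-! ### Upper triangular matrices with positive diagonal -/

/-- Upper triangular with positive diagonal. -/
def UT {p : ℕ} (T : Matrix (Fin p) (Fin p) ℂ) : Prop :=
  T.BlockTriangular id ∧ ∀ i, 0 < (T i i).re ∧ (T i i).im = 0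

section
variable {p : ℕ} {S T : Matrix (Fin p) (Fin p) ℂ}

theorem UT.diag_ne_zero (h : UT T) (i : Fin p) : T i i ≠ 0 := by
  intro h0
  have := (h.2 i).1
  simp [h0] at this

theorem UT.isUnit_det (h : UT T) : IsUnit T.det := by
  rw [Matrix.det_of_isUpperTriangular h.1, isUnit_iff_ne_zero]
  exact Finset.prod_ne_zero_iff.2 fun i _ => h.diag_ne_zero i

theorem blockTriangular_mul_diag (hS : S.BlockTriangular id) (hT : T.BlockTriangular id)
    (i : Fin p) : (S * T) i i = S i i * T i i := by
  rw [Matrix.mul_apply]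
  refine Finset.sum_eq_single i (fun j _ hj => ?_) (by simp)
  rcases lt_or_gt_of_ne hj with hlt | hgt
  · rw [hS (i := i) (j := j) hlt, zero_mul]
  · rw [hT (i := j) (j := i) hgt, mul_zero]

theorem UT.mul (hS : UT S) (hT : UT T) : UT (S * T) := by
  refine ⟨hS.1.mul hT.1, fun i => ?_⟩
  rw [blockTriangular_mul_diag hS.1 hT.1, Complex.mul_re, Complex.mul_im, (hS.2 i).2, (hT.2 i).2]
  simpa using mul_pos (hS.2 i).1 (hT.2 i).1

theorem UT.mul_inv_self (hT : UT T) : T * T⁻¹ = 1 := Matrix.mul_nonsing_inv _ hT.isUnit_det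

theorem UT.inv_mul_self (hT : UT T) : T⁻¹ * T = 1 := Matrix.nonsing_inv_mul _ hT.isUnit_det

theorem UT.inv (hT : UT T) : UT T⁻¹ := by
  have : Invertible T := T.invertibleOfIsUnitDet hT.isUnit_det
  have h1 : T⁻¹.BlockTriangular id := Matrix.blockTriangular_inv_of_blockTriangular hT.1
  refine ⟨h1, fun i => ?_⟩
  have h2 : T i i * T⁻¹ i i = 1 := by
    rw [← blockTriangular_mul_diag hT.1 h1, hT.mul_inv_self, Matrix.one_apply_eq]
  have h3 : T i i = ((T i i).re : ℂ) := Complex.ext rfl (by simp [(hT.2 i).2])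
  have h4 : T⁻¹ i i = (((T i i).re⁻¹ : ℝ) : ℂ) := by
    rw [eq_inv_of_mul_eq_one_right h2, h3]
    simp
  rw [h4]
  exact ⟨by simpa using (hT.2 i).1, Complex.ofReal_im _⟩

/-- This is how the coefficients `A` are seen to be Cholesky factors: they carry one leading matrix
to another. -/
theorem UT.of_mul_eq (hS : UT S) (hT : UT T) {A : Matrix (Fin p) (Fin p) ℂ} (h : A * T = S) :
    UT A := by
  have : A = S * T⁻¹ := by rw [← h, Matrix.mul_assoc, hT.mul_inv_self, Matrix.mul_one]
  rw [this]
  exact hS.mul hT.inv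

/-- The adjoint of `T` is its inverse, hence again upper triangular. So `T` is diagonal, with
positive diagonal entries of modulus one. -/
theorem UT.eq_one (hT : UT T) (h : T * Tᴴ = 1) : T = 1 := by
  have h1 : Tᴴ = T⁻¹ := (Matrix.inv_eq_right_inv h).symm
  have h2 := hT.inv.1
  rw [← h1] at h2
  have hd : ∀ i j, i ≠ j → T i j = 0 := by
    intro i j hij
    rcases lt_or_gt_of_ne hij with hlt | hgt
    · have := h2 (i := j) (j := i) hlt
      simpa using this
    · exact hT.1 hgt
  ext i j
  by_cases hij : i = j
  · subst hij
    have h3 : T i i * star (T i i) = 1 := by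
      have := congrFun (congrFun h i) i
      rw [Matrix.mul_apply, Finset.sum_eq_single i] at this
      · simpa using this
      · intro j _ hj
        rw [hd i j hj.symm, zero_mul]
      · simp
    obtain ⟨h4, h5⟩ := hT.2 i
    have h6 : T i i = ((T i i).re : ℂ) := Complex.ext rfl (by simp [h5])
    rw [h6] at h3 ⊢
    have h7 : (T i i).re * (T i i).re = 1 := by
      rw [Complex.star_def, Complex.conj_ofReal] at h3
      exact_mod_cast h3
    have h8 : (T i i).re = 1 := by nlinarith
    simp [h8]
  · rw [hd i j hij, Matrix.one_apply_ne hij]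

theorem UT.cholesky_unique (hS : UT S) (hT : UT T) (h : S * Sᴴ = T * Tᴴ) : S = T := by
  have h1 : (T⁻¹ * S) * (T⁻¹ * S)ᴴ = 1 := by
    rw [Matrix.conjTranspose_mul, Matrix.mul_assoc, ← Matrix.mul_assoc S, h, Matrix.mul_assoc T,
      ← Matrix.mul_assoc, hT.inv_mul_self, Matrix.one_mul, ← Matrix.conjTranspose_mul,
      hT.inv_mul_self, Matrix.conjTranspose_one]
  have h2 := (hT.inv.mul hS).eq_one h1
  calc S = T * (T⁻¹ * S) := by rw [← Matrix.mul_assoc, hT.mul_inv_self, Matrix.one_mul]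
    _ = T := by rw [h2, Matrix.mul_one]

theorem upperCholesky_eq (hT : UT T) {M : Matrix (Fin p) (Fin p) ℂ} (h : M = T * Tᴴ) :
    upperCholesky M = T := by
  have hex : ∃ B, IsUpperCholesky M B := ⟨T, hT.1, hT.2, h⟩
  rw [upperCholesky, dif_pos hex]
  obtain ⟨h1, h2, h3⟩ := hex.choose_spec
  exact UT.cholesky_unique ⟨h1, h2⟩ hT (h3.symm.trans h)

end

/-- The block matrix `[[t, v], [0, T]]`. -/
def consUT {p : ℕ} (t : ℂ) (v : Fin p → ℂ) (T : Matrix (Fin p) (Fin p) ℂ) :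
    Matrix (Fin (p + 1)) (Fin (p + 1)) ℂ :=
  Matrix.of (Matrix.vecCons (Matrix.vecCons t v) fun i => Matrix.vecCons 0 (T i))

theorem consUT_ut {p : ℕ} {t : ℂ} (ht : 0 < t.re ∧ t.im = 0) (v : Fin p → ℂ)
    {T : Matrix (Fin p) (Fin p) ℂ} (hT : UT T) : UT (consUT t v T) := by
  refine ⟨fun i j hij => ?_, fun i => ?_⟩
  · refine Fin.cases (fun hij => ?_) (fun i hij => ?_) i hij
    · exact absurd hij (by simp)
    · refine Fin.cases (fun _ => rfl) (fun j hij => ?_) j hij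
      exact hT.1 (by simpa using hij)
  · refine Fin.cases ht (fun i => hT.2 i) i

/-- Induction on the size, splitting off the first row and column. With M' = B'B'ᴴ for the lower
right block and r for the rest of the first row, the factor is [[t, v], [0, B']] where v = r(B'ᴴ)⁻¹
and t² is the Schur complement M₀₀ - vvᴴ. -/
theorem exists_cholesky {p : ℕ} (M : Matrix (Fin p) (Fin p) ℂ) (hH : Mᴴ = M)
    (hM : ∀ v : Fin p → ℂ, v ≠ 0 → 0 < (v ⬝ᵥ (M *ᵥ star v)).re) :
    ∃ B, UT B ∧ M = B * Bᴴ := by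
  induction p with
  | zero => exact ⟨1, ⟨fun i => i.elim0, fun i => i.elim0⟩, by ext i; exact i.elim0⟩
  | succ p ih =>
    let M' : Matrix (Fin p) (Fin p) ℂ := M.submatrix Fin.succ Fin.succ
    obtain ⟨B', hB', hMB⟩ := ih M' (by ext i j; exact congrFun (congrFun hH i.succ) j.succ) (by
      intro v hv
      have := hM (Fin.cons 0 v) (by
        intro h0
        apply hv
        funext i
        simpa using congrFun h0 i.succ)
      simpa [dotProduct, Matrix.mulVec, Fin.sum_univ_succ, M'] using this)
    let r : Matrix (Fin 1) (Fin p) ℂ := Matrix.of fun _ j => M 0 j.succ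
    let v : Matrix (Fin 1) (Fin p) ℂ := r * (B'⁻¹)ᴴ
    have hv : v * B'ᴴ = r := by
      rw [Matrix.mul_assoc, ← Matrix.conjTranspose_mul, hB'.mul_inv_self,
        Matrix.conjTranspose_one, Matrix.mul_one]
    let c : Matrix (Fin 1) (Fin p) ℂ := v * B'⁻¹
    have hcM : c * M' = r := by
      rw [hMB, Matrix.mul_assoc, ← Matrix.mul_assoc _ B', hB'.inv_mul_self, Matrix.one_mul, hv]
    have hcr : r * cᴴ = v * vᴴ := by
      rw [Matrix.conjTranspose_mul, ← Matrix.mul_assoc]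
    -- The test vector (1, -rM'⁻¹) minimises the form among vectors with first entry 1; the value
    -- there is the Schur complement.
    have hpos := hM (Fin.cons 1 fun j => -c 0 j) (by
      intro h0
      simpa using congrFun h0 0)
    have hM00 : (M 0 0).im = 0 := by
      have := congrFun (congrFun hH 0) 0
      simp only [Matrix.conjTranspose_apply] at this
      have h2 := congrArg Complex.im this
      simp only [Complex.star_def, Complex.conj_im] at h2
      linarith
    have hvv : (v * vᴴ) 0 0 = ((∑ j, ‖v 0 j‖ ^ 2 : ℝ) : ℂ) := by
      rw [Matrix.mul_apply]
      push_cast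
      refine Finset.sum_congr rfl fun j _ => ?_
      rw [Matrix.conjTranspose_apply, Complex.star_def, Complex.mul_conj, Complex.normSq_eq_norm_sq]
      push_cast
      rfl
    set s : ℝ := ∑ j, ‖v 0 j‖ ^ 2 with hs
    have hM0j : ∀ j : Fin p, M j.succ 0 = star (r 0 j) := fun j =>
      (congrFun (congrFun hH j.succ) 0).symm
    have hval : (Fin.cons 1 fun j => -c 0 j : Fin (p + 1) → ℂ) ⬝ᵥ
        (M *ᵥ star (Fin.cons 1 fun j => -c 0 j : Fin (p + 1) → ℂ)) = M 0 0 - (v * vᴴ) 0 0 := by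
      have e1 : ∑ j, r 0 j * star (c 0 j) = (v * vᴴ) 0 0 := by
        rw [← hcr, Matrix.mul_apply]
        rfl
      have e2 : ∀ j, ∑ i, c 0 i * M i.succ j.succ = r 0 j := fun j => by
        rw [← hcM, Matrix.mul_apply]
        rfl
      have e3 : ∑ i, c 0 i * ∑ j, M i.succ (Fin.succ j) * star (c 0 j) = (v * vᴴ) 0 0 := by
        rw [← e1]
        simp_rw [← e2, Finset.mul_sum, Finset.sum_mul]
        rw [Finset.sum_comm]
        simp_rw [mul_assoc]
      have e4 : ∑ i, c 0 i * M i.succ 0 = (v * vᴴ) 0 0 := by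
        have : star ((v * vᴴ) 0 0) = (v * vᴴ) 0 0 := by
          rw [hvv]; simp
        rw [← this, ← e1, star_sum]
        refine Finset.sum_congr rfl fun i _ => ?_
        rw [hM0j, star_mul', star_star, mul_comm]
      simp only [dotProduct, Matrix.mulVec, Fin.sum_univ_succ, Fin.cons_zero, Fin.cons_succ,
        Pi.star_apply, star_one, star_neg, mul_one, one_mul, mul_neg, neg_mul, neg_add,
        mul_add, Finset.sum_neg_distrib, Finset.sum_add_distrib]
      change ∑ j, M 0 (Fin.succ j) * star (c 0 j) = _ at e1
      rw [e1, neg_neg, e4, e3]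
      ring
    rw [hval, hvv, Complex.sub_re, Complex.ofReal_re] at hpos
    have hMre : M 0 0 = ((M 0 0).re : ℂ) := Complex.ext rfl (by simp [hM00])
    refine ⟨consUT ((Real.sqrt ((M 0 0).re - s) : ℝ) : ℂ) (v 0) B',
      consUT_ut ⟨by simpa using hpos, Complex.ofReal_im _⟩ _ hB', ?_⟩
    have hsq : (((M 0 0).re : ℂ)) =
        ((Real.sqrt ((M 0 0).re - s) : ℝ) : ℂ) * star ((Real.sqrt ((M 0 0).re - s) : ℝ) : ℂ)
          + (v * vᴴ) 0 0 := by
      rw [Complex.star_def, Complex.conj_ofReal, ← Complex.ofReal_mul,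
        Real.mul_self_sqrt hpos.le, hvv]
      push_cast
      ring
    have hr : ∀ j, M 0 (Fin.succ j) = ∑ i, v 0 i * star (B' j i) := fun j => by
      change r 0 j = _
      rw [← hv, Matrix.mul_apply]
      rfl
    ext i j
    refine Fin.cases ?_ (fun i => ?_) i <;> refine Fin.cases ?_ (fun j => ?_) j
    · rw [Matrix.mul_apply, Fin.sum_univ_succ]
      exact hMre.trans hsq
    · rw [Matrix.mul_apply, Fin.sum_univ_succ, hr]
      simp [consUT]
    · rw [Matrix.mul_apply, Fin.sum_univ_succ, hM0j]
      change star (M 0 i.succ) = _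
      rw [hr, star_sum]
      simp [consUT, mul_comm]
    · rw [Matrix.mul_apply, Fin.sum_univ_succ]
      have := congrFun (congrFun hMB i) j
      rw [Matrix.mul_apply] at this
      simpa [consUT, M'] using this

end Bicircle
end

noncomputable section
namespace Bicircle

variable {L : BiLaurent →ₗ[ℂ] ℂ} {k l j : ℕ} {x y : BiLaurent}

/-! ### Boxes -/

/-- The span of all `x ^ i * y ^ j` with `i < N` and `j < M`. -/
def box (x y : BiLaurent) (N M : ℕ) : Submodule ℂ BiLaurent :=
  Submodule.span ℂ {p | ∃ i < N, ∃ j < M, x ^ i * y ^ j = p}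

theorem mem_box {N M i j : ℕ} (hi : i < N) (hj : j < M) : x ^ i * y ^ j ∈ box x y N M :=
  Submodule.subset_span ⟨i, hi, j, hj, rfl⟩

theorem box_le {N M : ℕ} {S : Submodule ℂ BiLaurent}
    (h : ∀ i < N, ∀ j < M, x ^ i * y ^ j ∈ S) : box x y N M ≤ S := by
  refine Submodule.span_le.2 ?_
  rintro _ ⟨i, hi, j, hj, rfl⟩
  exact h i hi j hj

theorem box_mono {N M N' M' : ℕ} (h : N ≤ N') (h' : M ≤ M') : box x y N M ≤ box x y N' M' :=
  box_le fun _ hi _ hj => mem_box (hi.trans_le h) (hj.trans_le h')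

theorem box_swap (x y : BiLaurent) (N M : ℕ) : box x y N M = box y x M N :=
  le_antisymm (box_le fun _ hi _ hj => by rw [mul_comm]; exact mem_box hj hi)
    (box_le fun _ hi _ hj => by rw [mul_comm]; exact mem_box hj hi)

theorem box_zero_left (M : ℕ) : box x y 0 M = ⊥ :=
  le_bot_iff.1 (box_le fun _ hi => absurd hi (Nat.not_lt_zero _))

theorem mul_mem_box {N M : ℕ} {p : BiLaurent} (hp : p ∈ box x y N M) :
    x * p ∈ box x y (N + 1) M := by
  have : box x y N M ≤ (box x y (N + 1) M).comap (LinearMap.mulLeft ℂ x) :=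
    box_le fun i hi j hj => by
      have := mem_box (x := x) (y := y) (Nat.succ_lt_succ hi) hj
      rwa [Nat.succ_eq_add_one, pow_succ', mul_assoc] at this
  exact this hp

theorem mul_mem_box' {N M : ℕ} {p : BiLaurent} (hp : p ∈ box x y N M) :
    y * p ∈ box x y N (M + 1) := by
  rw [box_swap] at hp ⊢
  exact mul_mem_box hp

theorem mulS_mono {S T : Submodule ℂ BiLaurent} (h : S ≤ T) : mulS x S ≤ mulS x T :=
  fun _ hp => h hp

theorem mulS_box_le (hx : IsUni x) (N M : ℕ) : mulS x (box x y N M) ≤ box x y (N + 1) M := by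
  intro p hp
  rw [← hx.mul_dagger_cancel p]
  exact mul_mem_box hp

theorem mulS_box_le' (hy : IsUni y) (N M : ℕ) : mulS y (box x y N M) ≤ box x y N (M + 1) := by
  rw [box_swap x y N M, box_swap x y N (M + 1)]
  exact mulS_box_le hy _ _

theorem rev_pow (hx : IsUni x) {n i : ℕ} (hi : i ≤ n) : x ^ n * dagger (x ^ i) = x ^ (n - i) := by
  obtain ⟨d, rfl⟩ := Nat.exists_eq_add_of_le hi
  have : x ^ i * dagger (x ^ i) = 1 := hx.pow i
  rw [pow_add, mul_right_comm, this, one_mul]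
  congr 1
  omega

theorem rev_mem_box (hx : IsUni x) (hy : IsUni y) {n m : ℕ} {p : BiLaurent}
    (hp : p ∈ box x y (n + 1) (m + 1)) : x ^ n * y ^ m * dagger p ∈ box x y (n + 1) (m + 1) := by
  have : box x y (n + 1) (m + 1) ≤ rvS (x ^ n * y ^ m) (box x y (n + 1) (m + 1)) :=
    box_le fun i hi j hj => by
      rw [mem_rvS, dagger_mul, mul_mul_mul_comm, rev_pow hx (Nat.lt_succ_iff.1 hi),
        rev_pow hy (Nat.lt_succ_iff.1 hj)]
      exact mem_box (by omega) (by omega)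
  exact this hp

theorem rvS_box (hx : IsUni x) (hy : IsUni y) (n m : ℕ) :
    rvS (x ^ n * y ^ m) (box x y (n + 1) (m + 1)) = box x y (n + 1) (m + 1) := by
  refine le_antisymm (fun p hp => ?_) fun p hp => rev_mem_box hx hy hp
  rw [← ((hx.pow n).mul (hy.pow m)).rev_rev p]
  exact rev_mem_box hx hy hp

/-- The reversal sends the exponents 0, …, n-1 of x to n, …, 1. So the box of smaller x-degree
becomes its own translate by x. -/
theorem rvS_box_lower (hx : IsUni x) (hy : IsUni y) (n m : ℕ) :
    rvS (x ^ n * y ^ m) (box x y n (m + 1)) = mulS x (box x y n (m + 1)) := by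
  obtain _ | n := n
  · ext p
    rw [box_zero_left, mem_rvS, mem_mulS, Submodule.mem_bot, Submodule.mem_bot]
    constructor
    · intro h
      rw [← ((hx.pow 0).mul (hy.pow m)).rev_rev p, h, dagger_zero, mul_zero, mul_zero]
    · intro h
      rw [← hx.mul_dagger_cancel p, h, mul_zero, dagger_zero, mul_zero]
  · have hx' : x * dagger x = 1 := hx
    ext p
    rw [mem_rvS, mem_mulS]
    constructor
    · intro h
      have h1 := rev_mem_box hx hy h
      have h2 : x ^ n * y ^ m * dagger (x ^ (n + 1) * y ^ m * dagger p) = dagger x * p := by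
        have h3 : x ^ n * dagger (x ^ n) = 1 := hx.pow n
        have h4 : y ^ m * dagger (y ^ m) = 1 := hy.pow m
        rw [dagger_mul, dagger_mul, dagger_dagger, pow_succ, dagger_mul]
        linear_combination (y ^ m * dagger (y ^ m) * dagger x * p) * h3 + dagger x * p * h4
      rwa [h2] at h1
    · intro h
      have h1 := rev_mem_box hx hy h
      have h2 : x ^ n * y ^ m * dagger (dagger x * p) = x ^ (n + 1) * y ^ m * dagger p := by
        rw [dagger_mul, dagger_dagger]
        ring
      rwa [h2] at h1

/-- The monomials `x ^ n * y ^ (M - 1), …, x ^ n`. -/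
def monoVec (x y : BiLaurent) (n M : ℕ) : Fin M → BiLaurent := fun b => x ^ n * y ^ (b.rev : ℕ)

theorem monoVec_succ (n M : ℕ) (b : Fin M) : monoVec x y n (M + 1) b.succ = monoVec x y n M b := by
  simp [monoVec, Fin.rev_succ]

theorem monoVec_castSucc (n M : ℕ) (b : Fin M) :
    monoVec x y n (M + 1) b.castSucc = y * monoVec x y n M b := by
  simp only [monoVec, Fin.rev_castSucc, Fin.val_succ, pow_succ]
  ring

theorem scale_monoVec (n M : ℕ) : scale x (monoVec x y n M) = monoVec x y (n + 1) M := by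
  funext b
  simp only [monoVec, scale, pow_succ]
  ring

theorem shiftU_act (V : Fin (k + 1) → BiLaurent) : act (shiftU k) V = fun b => V b.succ := by
  funext b
  simp [act_apply, shiftU]

theorem shiftU1_act (V : Fin (k + 1) → BiLaurent) :
    act (shiftU1 k) V = fun b => V b.castSucc := by
  funext b
  simp [act_apply, shiftU1]

theorem monoVec_inn (n M : ℕ) : Inn (monoVec x y n M) (box x y (n + 1) M) :=
  fun b => mem_box (by omega) (by omega)

theorem exists_lead {n M : ℕ} {p : BiLaurent} (hp : p ∈ box x y (n + 1) M) :
    ∃ C : Fin M → ℂ, p - ∑ b, C b • monoVec x y n M b ∈ box x y n M := by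
  induction hp using Submodule.span_induction with
  | mem p hp =>
    obtain ⟨i, hi, j, hj, rfl⟩ := hp
    rcases Nat.lt_succ_iff_lt_or_eq.1 hi with h | rfl
    · exact ⟨0, by simpa using mem_box h hj⟩
    · refine ⟨Pi.single (Fin.rev ⟨j, hj⟩) 1, ?_⟩
      rw [Finset.sum_eq_single (Fin.rev ⟨j, hj⟩)]
      · simp [monoVec]
      · intro b _ hb
        simp [hb]
      · simp
  | zero => exact ⟨0, by simp⟩
  | add p q _ _ hp hq =>
    obtain ⟨C, hC⟩ := hp
    obtain ⟨D, hD⟩ := hq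
    refine ⟨C + D, ?_⟩
    have := (box x y n M).add_mem hC hD
    simp only [Pi.add_apply, add_smul, Finset.sum_add_distrib]
    convert this using 1
    abel
  | smul c p _ hp =>
    obtain ⟨C, hC⟩ := hp
    refine ⟨c • C, ?_⟩
    have := (box x y n M).smul_mem c hC
    simpa [smul_sub, Finset.smul_sum, smul_smul] using this

/-! ### Orthonormal polynomials for the lexicographical ordering -/

/-- `Φ` consists of the last `M` orthonormal polynomials in the box `(n + 1) × M`, ordered
lexicographically, and `T` is the matrix of the coefficients of `x ^ n`. -/
structure IsLex (L : BiLaurent →ₗ[ℂ] ℂ) (x y : BiLaurent) (n M : ℕ) (Φ : Fin M → BiLaurent)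
    (T : Matrix (Fin M) (Fin M) ℂ) : Prop where
  ut : UT T
  lead : Inn (Φ - act T (monoVec x y n M)) (box x y n M)
  perp : Perp L Φ (box x y n M)
  norm : gram L Φ Φ = 1

variable {n M m : ℕ} {Φ : Fin M → BiLaurent} {T : Matrix (Fin M) (Fin M) ℂ}

theorem isLex_empty (Φ : Fin 0 → BiLaurent) (T : Matrix (Fin 0) (Fin 0) ℂ) :
    IsLex L x y n 0 Φ T :=
  ⟨⟨fun i => i.elim0, fun i => i.elim0⟩, fun i => i.elim0, fun i => i.elim0,
    Matrix.ext fun i => i.elim0⟩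

theorem IsLex.inn (h : IsLex L x y n M Φ T) : Inn Φ (box x y (n + 1) M) := by
  have := (h.lead.mono (box_mono (Nat.le_succ n) le_rfl)).add ((monoVec_inn n M).act T)
  rwa [sub_add_cancel] at this

theorem IsLex.comp (h : IsLex L x y n M Φ T) : Comp L Φ (box x y n M) (box x y (n + 1) M) where
  inn := h.inn
  perp := h.perp
  norm := h.norm
  red p hp := by
    obtain ⟨C, hC⟩ := exists_lead hp
    let Cm : Matrix (Fin 1) (Fin M) ℂ := Matrix.of fun _ b => C b
    refine ⟨fun b => (Cm * T⁻¹) 0 b, ?_⟩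
    have h1 := h.lead.act (Cm * T⁻¹) 0
    rw [act_sub_vec, act_act, Matrix.mul_assoc, h.ut.inv_mul_self, Matrix.mul_one] at h1
    have h2 := Submodule.sub_mem _ hC h1
    simp only [Pi.sub_apply, act_apply] at h2
    convert h2 using 1
    simp [Cm]

theorem IsLex.comp_rev (hL : Herm L) (hx : IsUni x) (hy : IsUni y)
    {Φ : Fin (m + 1) → BiLaurent} {T : Matrix (Fin (m + 1)) (Fin (m + 1)) ℂ}
    (h : IsLex L x y n (m + 1) Φ T) :
    Comp L (rvv (x ^ n * y ^ m) Φ) (mulS x (box x y n (m + 1))) (box x y (n + 1) (m + 1)) := by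
  have := h.comp.rvv hL ((hx.pow n).mul (hy.pow m))
  rwa [rvS_box hx hy, rvS_box_lower hx hy] at this

/-- Modulo the lower box, to which Φ is orthogonal, V is S times the monomials and Φ is T times
them. Inner products with Φ are thus read off from leading coefficients alone; triangularity and
invertibility of A, Γ and Γ1 all come from this. -/
theorem IsLex.gram_mul_lead (h : IsLex L x y n M Φ T) {V : Fin k → BiLaurent}
    {S : Matrix (Fin k) (Fin M) ℂ} (hL : Herm L)
    (hV : Inn (V - act S (monoVec x y n M)) (box x y n M)) : gram L V Φ * T = S := by
  have h1 : gram L V Φ = S * gram L (monoVec x y n M) Φ := by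
    rw [← gram_act_left, ← sub_eq_zero, ← gram_sub_left]
    exact h.perp.gram_zero' hL hV
  have h2 : T * gram L (monoVec x y n M) Φ = 1 := by
    rw [← h.norm, ← gram_act_left, ← sub_eq_zero, ← gram_sub_left]
    rw [← neg_sub Φ]
    have : Inn (-(Φ - act T (monoVec x y n M))) (box x y n M) :=
      fun a => Submodule.neg_mem _ (h.lead a)
    exact h.perp.gram_zero' hL this
  rw [h1, Matrix.mul_assoc, mul_eq_one_comm.1 h2, Matrix.mul_one]

end Bicircle
end

noncomputable section
namespace Bicircle

variable {L : BiLaurent →ₗ[ℂ] ℂ} {k l j : ℕ} {x y : BiLaurent} {n m M : ℕ}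

theorem IsLex.comp_t {Φ : Fin M → BiLaurent} {T : Matrix (Fin M) (Fin M) ℂ}
    (h : IsLex L y x n M Φ T) : Comp L Φ (box x y M n) (box x y M (n + 1)) := by
  rw [box_swap x y, box_swap x y]
  exact h.comp

theorem IsLex.comp_rev_t (hL : Herm L) (hx : IsUni x) (hy : IsUni y)
    {Φ : Fin (n + 1) → BiLaurent} {T : Matrix (Fin (n + 1)) (Fin (n + 1)) ℂ}
    (h : IsLex L y x m (n + 1) Φ T) :
    Comp L (rvv (x ^ n * y ^ m) Φ) (mulS y (box x y (n + 1) m)) (box x y (n + 1) (m + 1)) := by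
  rw [box_swap x y, box_swap x y, mul_comm]
  exact h.comp_rev hL hy hx

theorem scale_scale (V : Fin k → BiLaurent) : scale x (scale y V) = scale (x * y) V := by
  funext a
  simp only [scale]
  ring

/-! ### Leading coefficients -/

section lead

variable {V : Fin M → BiLaurent} {S : Matrix (Fin M) (Fin M) ℂ}

theorem IsLex.lead_scale (hx : IsUni x) (h : IsLex L x y n M V S) :
    Inn (scale x V - act S (monoVec x y (n + 1) M)) (box x y (n + 1) M) := by
  have h1 := (h.lead.scale hx).mono (mulS_box_le hx n M)
  rw [← scale_monoVec, ← scale_act]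
  intro a
  have := h1 a
  simpa [scale, mul_sub] using this

theorem IsLex.lead_up (h : IsLex L x y n M V S) :
    Inn (V - act (S * shiftU M) (monoVec x y n (M + 1))) (box x y n (M + 1)) := by
  have h1 := h.lead.mono (box_mono le_rfl (Nat.le_succ M))
  rw [← act_act, shiftU_act]
  simp only [monoVec_succ]
  exact h1

theorem IsLex.lead_up1 (hy : IsUni y) (h : IsLex L x y n M V S) :
    Inn (scale y V - act (S * shiftU1 M) (monoVec x y n (M + 1))) (box x y n (M + 1)) := by
  have h1 := (h.lead.scale hy).mono (mulS_box_le' hy n M)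
  rw [← act_act, shiftU1_act]
  simp only [monoVec_castSucc]
  intro a
  have := h1 a
  rw [show (fun b => y * monoVec x y n M b) = scale y (monoVec x y n M) from rfl, ← scale_act]
  simpa [scale, mul_sub] using this

theorem IsLex.A_mul_lead (hL : Herm L) (hx : IsUni x) (h : IsLex L x y n M V S)
    {Φ : Fin M → BiLaurent} {T : Matrix (Fin M) (Fin M) ℂ} (hΦ : IsLex L x y (n + 1) M Φ T) :
    gram L (scale x V) Φ * T = S := hΦ.gram_mul_lead hL (h.lead_scale hx)

theorem IsLex.A_ut (hL : Herm L) (hx : IsUni x) (h : IsLex L x y n M V S)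
    {Φ : Fin M → BiLaurent} {T : Matrix (Fin M) (Fin M) ℂ} (hΦ : IsLex L x y (n + 1) M Φ T) :
    UT (gram L (scale x V) Φ) := UT.of_mul_eq h.ut hΦ.ut (h.A_mul_lead hL hx hΦ)

variable {Φ : Fin (M + 1) → BiLaurent} {T : Matrix (Fin (M + 1)) (Fin (M + 1)) ℂ}

theorem IsLex.G_mul_lead (hL : Herm L) (h : IsLex L x y n M V S)
    (hΦ : IsLex L x y n (M + 1) Φ T) : gram L V Φ * T = S * shiftU M :=
  hΦ.gram_mul_lead hL h.lead_up

theorem IsLex.G1_mul_lead (hL : Herm L) (hy : IsUni y) (h : IsLex L x y n M V S)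
    (hΦ : IsLex L x y n (M + 1) Φ T) : gram L (scale y V) Φ * T = S * shiftU1 M :=
  hΦ.gram_mul_lead hL (h.lead_up1 hy)

theorem mul_ut_apply_zero (hT : UT T) (G : Matrix (Fin k) (Fin (M + 1)) ℂ) (a : Fin k) :
    (G * T) a 0 = G a 0 * T 0 0 := by
  rw [Matrix.mul_apply]
  refine Finset.sum_eq_single 0 (fun b _ hb => ?_) (by simp)
  rw [hT.1 (i := b) (j := 0) (Fin.pos_of_ne_zero hb), mul_zero]

theorem mul_shiftU_zero (A : Matrix (Fin k) (Fin M) ℂ) (a : Fin k) :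
    (A * shiftU M) a 0 = 0 := by
  rw [Matrix.mul_apply]
  refine Finset.sum_eq_zero fun b _ => ?_
  simp [shiftU, (Fin.succ_ne_zero b).symm]

theorem mul_shiftU_succ (A : Matrix (Fin k) (Fin M) ℂ) (a : Fin k) (b : Fin M) :
    (A * shiftU M) a b.succ = A a b := by
  rw [Matrix.mul_apply, Finset.sum_eq_single b]
  · simp [shiftU]
  · intro c _ hc
    simp [shiftU, hc.symm]
  · simp

theorem mul_shiftU1_castSucc (A : Matrix (Fin k) (Fin M) ℂ) (a : Fin k) (b : Fin M) :
    (A * shiftU1 M) a b.castSucc = A a b := by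
  rw [Matrix.mul_apply, Finset.sum_eq_single b]
  · simp [shiftU1]
  · intro c _ hc
    simp [shiftU1, hc.symm]
  · simp

theorem mul_shiftU_transpose (A : Matrix (Fin k) (Fin (M + 1)) ℂ) :
    A * (shiftU M)ᵀ = Matrix.of fun a b => A a b.succ := by
  ext a b
  rw [Matrix.mul_apply, Finset.sum_eq_single b.succ]
  · simp [shiftU]
  · intro c _ hc
    simp [shiftU, hc]
  · simp

theorem mul_shiftU1_transpose (A : Matrix (Fin k) (Fin (M + 1)) ℂ) :
    A * (shiftU1 M)ᵀ = Matrix.of fun a b => A a b.castSucc := by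
  ext a b
  rw [Matrix.mul_apply, Finset.sum_eq_single b.castSucc]
  · simp [shiftU1]
  · intro c _ hc
    simp [shiftU1, hc]
  · simp

theorem shiftU_mul (A : Matrix (Fin (M + 1)) (Fin k) ℂ) :
    shiftU M * A = Matrix.of fun a b => A a.succ b := by
  ext a b
  simp [Matrix.mul_apply, shiftU]

theorem shiftU1_mul (A : Matrix (Fin (M + 1)) (Fin k) ℂ) :
    shiftU1 M * A = Matrix.of fun a b => A a.castSucc b := by
  ext a b
  simp [Matrix.mul_apply, shiftU1]

theorem shiftU_mul_transpose : shiftU M * (shiftU M)ᵀ = 1 := by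
  rw [shiftU_mul]
  ext a b
  simp [shiftU, Matrix.one_apply, Fin.succ_inj]

theorem shiftU1_mul_transpose : shiftU1 M * (shiftU1 M)ᵀ = 1 := by
  rw [shiftU1_mul]
  ext a b
  simp [shiftU1, Matrix.one_apply]

theorem shiftU_conjTranspose : (shiftU M)ᴴ = (shiftU M)ᵀ := by
  ext a b
  simp [shiftU, apply_ite]

theorem IsLex.G_zero (hL : Herm L) (h : IsLex L x y n M V S)
    (hΦ : IsLex L x y n (M + 1) Φ T) (a : Fin M) : gram L V Φ a 0 = 0 := by
  have h1 := mul_ut_apply_zero hΦ.ut (gram L V Φ) a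
  rw [h.G_mul_lead hL hΦ, mul_shiftU_zero] at h1
  exact (mul_eq_zero.1 h1.symm).resolve_right (hΦ.ut.diag_ne_zero 0)

/-- A matrix with vanishing first column is determined by the others. -/
theorem mul_shiftU_mul_shiftU {G : Matrix (Fin k) (Fin (M + 1)) ℂ} (h : ∀ a, G a 0 = 0) :
    G * (shiftU M)ᵀ * shiftU M = G := by
  ext a b
  refine Fin.cases ?_ (fun b => ?_) b
  · rw [mul_shiftU_zero, h]
  · rw [mul_shiftU_succ, mul_shiftU_transpose]
    rfl

/-- After removal of the vanishing first column, the relation between Γ and the leading matrices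
becomes a factorisation of the invertible matrix S. -/
theorem IsLex.GU_isUnit (hL : Herm L) (h : IsLex L x y n M V S)
    (hΦ : IsLex L x y n (M + 1) Φ T) : IsUnit (gram L V Φ * (shiftU M)ᵀ).det := by
  have h1 : gram L V Φ * (shiftU M)ᵀ * (shiftU M * T * (shiftU M)ᵀ) = S := by
    rw [Matrix.mul_assoc (shiftU M), ← Matrix.mul_assoc (gram L V Φ * _),
      mul_shiftU_mul_shiftU (h.G_zero hL hΦ), ← Matrix.mul_assoc, h.G_mul_lead hL hΦ,
      Matrix.mul_assoc, shiftU_mul_transpose, Matrix.mul_one]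
  have h2 := h.ut.isUnit_det
  rw [← h1, Matrix.det_mul] at h2
  exact isUnit_of_mul_isUnit_left h2

/-- Multiplied by the leading matrix T, the stacked matrix becomes upper triangular with positive
diagonal: S in the lower right block and the entry S₀₀ in the corner. -/
theorem IsLex.stack_isUnit (hL : Herm L) (hy : IsUni y) {V : Fin (m + 1) → BiLaurent}
    {S : Matrix (Fin (m + 1)) (Fin (m + 1)) ℂ} (h : IsLex L x y n (m + 1) V S)
    {Φ : Fin (m + 2) → BiLaurent} {T : Matrix (Fin (m + 2)) (Fin (m + 2)) ℂ}
    (hΦ : IsLex L x y n (m + 2) Φ T) :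
    IsUnit (stack (gram L (scale y V) Φ) (gram L V Φ)).det := by
  have h1 : stack (gram L (scale y V) Φ) (gram L V Φ) * T =
      consUT (S 0 0) (fun b => (S * shiftU1 (m + 1)) 0 b.succ) S := by
    ext a b
    refine Fin.cases ?_ (fun a => ?_) a
    · have : (stack (gram L (scale y V) Φ) (gram L V Φ) * T) 0 b =
          (gram L (scale y V) Φ * T) 0 b := rfl
      rw [this, h.G1_mul_lead hL hy hΦ]
      refine Fin.cases ?_ (fun b => rfl) b
      exact mul_shiftU1_castSucc S 0 0
    · have : (stack (gram L (scale y V) Φ) (gram L V Φ) * T) a.succ b =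
          (gram L V Φ * T) a b := rfl
      rw [this, h.G_mul_lead hL hΦ]
      refine Fin.cases (mul_shiftU_zero _ _) (fun b => mul_shiftU_succ _ _ _) b
  have h2 := (consUT_ut (h.ut.2 0) (fun b => (S * shiftU1 (m + 1)) 0 b.succ) h.ut).isUnit_det
  rw [← h1, Matrix.det_mul] at h2
  exact isUnit_of_mul_isUnit_left h2

theorem IsLex.G1_lead_U1 (hL : Herm L) (hy : IsUni y) (h : IsLex L x y n M V S)
    (hΦ : IsLex L x y n (M + 1) Φ T) : gram L (scale y V) Φ * T * (shiftU1 M)ᵀ = S := by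
  rw [h.G1_mul_lead hL hy hΦ, Matrix.mul_assoc, shiftU1_mul_transpose, Matrix.mul_one]

end lead

end Bicircle
end

noncomputable section
namespace Bicircle

variable {L : BiLaurent →ₗ[ℂ] ℂ} {k l j : ℕ} {x y : BiLaurent} {n m : ℕ}

/-! ### The recurrence coefficients as inner products -/

theorem cj_mul {p q r : ℕ} (A : Matrix (Fin p) (Fin q) ℂ) (B : Matrix (Fin q) (Fin r) ℂ) :
    cj (A * B) = cj A * cj B := Matrix.map_mul (f := starRingEnd ℂ)

theorem cj_cj {p q : ℕ} (A : Matrix (Fin p) (Fin q) ℂ) : cj (cj A) = A := by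
  ext a b
  simp [cj]

theorem cj_conjTranspose {p q : ℕ} (A : Matrix (Fin p) (Fin q) ℂ) : cj Aᴴ = Aᵀ := by
  ext a b
  simp [cj]

theorem cj_transpose {p q : ℕ} (A : Matrix (Fin p) (Fin q) ℂ) : (cj A)ᵀ = Aᴴ := rfl

theorem cj_ut {p : ℕ} {T : Matrix (Fin p) (Fin p) ℂ} (hT : UT T) : UT (cj T) := by
  refine ⟨fun i j hij => ?_, fun i => ?_⟩
  · simp [cj, hT.1 hij]
  · simpa [cj] using hT.2 i

theorem gram_conj (hL : Herm L) {u : BiLaurent} (hu : IsUni u) (V : Fin k → BiLaurent)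
    (W : Fin l → BiLaurent) : cj (gram L V W) = gram L (rvv u V) (rvv u W) :=
  (gram_rvv' hL hu V W).symm

theorem rvv_scale_right (hy : IsUni y) (m : ℕ) (u : BiLaurent) (V : Fin k → BiLaurent) :
    rvv (u * y ^ (m + 1)) (scale y V) = rvv (u * y ^ m) V := by
  rw [pow_succ, ← mul_assoc, rvv_mul_scale hy]

theorem rvv_scale_left (hx : IsUni x) (n : ℕ) (u : BiLaurent) (V : Fin k → BiLaurent) :
    rvv (x ^ (n + 1) * u) (scale x V) = rvv (x ^ n * u) V := by
  rw [pow_succ, mul_right_comm, rvv_mul_scale hx]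

theorem scale_rvv_right (m : ℕ) (u : BiLaurent) (V : Fin k → BiLaurent) :
    scale y (rvv (u * y ^ m) V) = rvv (u * y ^ (m + 1)) V := by
  rw [scale_rvv, pow_succ, mul_assoc]

theorem scale_rvv_left (n : ℕ) (u : BiLaurent) (V : Fin k → BiLaurent) :
    scale x (rvv (x ^ n * u) V) = rvv (x ^ (n + 1) * u) V := by
  rw [scale_rvv, pow_succ]
  congr 1
  ring

/-- Both forms of the coefficient `K1`. -/
theorem gram_scale_scale_rvv (hx : IsUni x) (V : Fin k → BiLaurent) (W : Fin l → BiLaurent)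
    (u : BiLaurent) : gram L (scale (x * y) V) (rvv (x ^ (n + 1) * u) W) =
      gram L (scale y V) (rvv (x ^ n * u) W) := by
  rw [← scale_rvv_left, ← scale_scale, gram_scale hx]

theorem gram_scale_rvv_transpose (v u : BiLaurent) (V : Fin k → BiLaurent)
    (W : Fin l → BiLaurent) :
    (gram L (scale v V) (rvv u W))ᵀ = gram L (scale v W) (rvv u V) := by
  ext a b
  simp only [Matrix.transpose_apply, gram_apply, scale, rvv, dagger_mul, dagger_dagger]
  congr 1
  ring

theorem stack_mul {p q : ℕ} (G1 G : Matrix (Fin (p + 1)) (Fin (p + 2)) ℂ)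
    (E : Matrix (Fin (p + 2)) (Fin q) ℂ) (X : Matrix (Fin (p + 1)) (Fin q) ℂ)
    (Y : Matrix (Fin (p + 1)) (Fin q) ℂ) (h : G * E = X) (h1 : G1 * E = Y) :
    stack G1 G * E = (shiftU (p + 1))ᵀ * X + corner (p + 1) p * Y := by
  subst h h1
  ext a b
  refine Fin.cases ?_ (fun a => ?_) a
  · have h1 : ((shiftU (p + 1))ᵀ * (G * E)) 0 b = 0 := by
      rw [Matrix.mul_apply]
      refine Finset.sum_eq_zero fun c _ => ?_
      simp [shiftU, (Fin.succ_ne_zero c).symm]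
    rw [Matrix.add_apply, h1, zero_add, corner, Matrix.single_mul_apply_same, one_mul]
    rfl
  · have h1 : ((shiftU (p + 1))ᵀ * (G * E)) a.succ b = (G * E) a b := by
      rw [Matrix.mul_apply, Finset.sum_eq_single a]
      · simp [shiftU]
      · intro c _ hc
        simp [shiftU, hc.symm]
      · simp
    rw [Matrix.add_apply, h1, corner, Matrix.single_mul_apply_of_ne _ _ _ _ _ (Fin.succ_ne_zero a),
      add_zero]
    rfl

section formulas

variable {p r : Fin (m + 1) → BiLaurent} {q : Fin (m + 2) → BiLaurent}
  {p' : Fin m → BiLaurent}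
  {qt rt : Fin (n + 1) → BiLaurent} {pt : Fin (n + 2) → BiLaurent}
  {Tp Tr : Matrix (Fin (m + 1)) (Fin (m + 1)) ℂ} {Tq : Matrix (Fin (m + 2)) (Fin (m + 2)) ℂ}
  {Tp' : Matrix (Fin m) (Fin m) ℂ}
  {Tqt Trt : Matrix (Fin (n + 1)) (Fin (n + 1)) ℂ} {Tpt : Matrix (Fin (n + 2)) (Fin (n + 2)) ℂ}

/-- Here p, q, r belong to the levels (n+1, m), (n, m+1), (n, m). The vector x r is expanded in x q
on one side, and in p and the reverse of r on the other; both are paired with the reverse of q,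
which is orthogonal to the remainders. This gives ΓE. The same computation for y x r gives Γ1E, of
which only the first row is kept. -/
theorem stack_mul_E (hL : Herm L) (hx : IsUni x) (hy : IsUni y)
    (hp : IsLex L x y (n + 1) (m + 1) p Tp) (hq : IsLex L x y n (m + 2) q Tq)
    (hr : IsLex L x y n (m + 1) r Tr) (hqt : IsLex L y x (m + 1) (n + 1) qt Tqt) :
    stack (gram L (scale y r) q) (gram L r q) *
        gram L (scale x q) (rvv (x ^ n * y ^ (m + 1)) q) =
      (shiftU (m + 1))ᵀ * (gram L (scale x r) p * gram L p qt *
          (gram L (rvv (x ^ n * y ^ (m + 1)) q) qt)ᴴ +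
        gram L (scale x r) (rvv (x ^ n * y ^ m) r) * cj (gram L (scale y r) q)) +
      corner (m + 1) m * (gram L (scale x r) p *
          gram L (scale (x * y) p) (rvv (x ^ (n + 1) * y ^ (m + 1)) qt) * (gram L q qt)ᵀ +
        gram L (scale x r) (rvv (x ^ n * y ^ m) r) * cj (gram L r q)) := by
  have hu : IsUni (x ^ n * y ^ (m + 1)) := (hx.pow n).mul (hy.pow (m + 1))
  have hrq : Perp L (rvv (x ^ n * y ^ (m + 1)) q) (mulS x (box x y n (m + 2))) :=
    (hq.comp_rev hL hx hy).perp
  have hxr : Inn (scale x r) (box x y (n + 2) (m + 1)) :=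
    (hr.inn.scale hx).mono (mulS_box_le hx _ _)
  apply stack_mul
  · have h1 : gram L (scale x r) (rvv (x ^ n * y ^ (m + 1)) q) =
        gram L r q * gram L (scale x q) (rvv (x ^ n * y ^ (m + 1)) q) := by
      rw [← gram_scale hx r q]
      exact (hq.comp.scale hx).ins hL
        ((hr.inn.scale hx).mono (mulS_mono (box_mono le_rfl (Nat.le_succ _)))) hrq
    rw [← h1, hp.comp.ins₂ (hr.comp_rev hL hx hy) hL hxr
      (hrq.mono (mulS_mono (box_mono le_rfl (Nat.le_succ _)))),
      hqt.comp_t.ins' hL (U := rvv (x ^ n * y ^ (m + 1)) q) hp.perp (hq.comp_rev hL hx hy).inn,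
      gram_conjTranspose hL, gram_conj hL hu, rvv_scale_right hy, Matrix.mul_assoc]
  · have h1 : gram L (scale x (scale y r)) (rvv (x ^ n * y ^ (m + 1)) q) =
        gram L (scale y r) q * gram L (scale x q) (rvv (x ^ n * y ^ (m + 1)) q) := by
      rw [← gram_scale hx _ q]
      exact (hq.comp.scale hx).ins hL
        (((hr.inn.scale hy).mono (mulS_box_le' hy _ _)).scale hx) hrq
    -- Multiplying by y raises the y-degree by one, which the box of q still admits.
    have h2 : Perp L (rvv (x ^ n * y ^ (m + 1)) q) (mulS y (mulS x (box x y n (m + 1)))) :=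
      hrq.mono fun s hs => by
        rw [mem_mulS, mem_mulS] at hs
        rw [mem_mulS, ← hy.mul_dagger_cancel (dagger x * s), mul_left_comm (dagger y)]
        exact mul_mem_box' hs
    have h3 : gram L (scale y p) (rvv (x ^ n * y ^ (m + 1)) q) =
        gram L (scale y p) (rvv (x ^ n * y ^ (m + 1)) qt) * (gram L q qt)ᵀ := by
      rw [(hqt.comp_rev_t hL hx hy).ins' hL (hp.perp.scale) (hq.comp_rev hL hx hy).inn,
        gram_rvv hu]
    rw [← h1, scale_scale, mul_comm x y, ← scale_scale,
      (hp.comp.scale hy).ins₂ ((hr.comp_rev hL hx hy).scale hy) hL (hxr.scale hy) h2,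
      gram_scale hy, gram_scale hy, h3, scale_rvv_right, gram_conj hL hu, mul_comm y x,
      gram_scale_scale_rvv hx, Matrix.mul_assoc]

theorem formulaE_eq (hL : Herm L) (hx : IsUni x) (hy : IsUni y)
    (hp : IsLex L x y (n + 1) (m + 1) p Tp) (hq : IsLex L x y n (m + 2) q Tq)
    (hr : IsLex L x y n (m + 1) r Tr) (hqt : IsLex L y x (m + 1) (n + 1) qt Tqt) :
    formulaE (gram L (scale x r) p) (gram L (scale x r) (rvv (x ^ n * y ^ m) r))
      (gram L p qt) (gram L (scale (x * y) p) (rvv (x ^ (n + 1) * y ^ (m + 1)) qt))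
      (gram L q qt) (gram L (rvv (x ^ n * y ^ (m + 1)) q) qt) (gram L r q)
      (gram L (scale y r) q) = gram L (scale x q) (rvv (x ^ n * y ^ (m + 1)) q) := by
  rw [formulaE, ← stack_mul_E hL hx hy hp hq hr hqt, ← Matrix.mul_assoc,
    Matrix.nonsing_inv_mul _ (hr.stack_isUnit hL hy hq), Matrix.one_mul]

/-- The inner product ⟨y p', y rt⟩ = ⟨p', rt⟩ is the old K. Expanding y rt in qt and the reverse of
rt, and then y p' in p, turns it into (Γ1 K) Atᴴ plus a term with the old K1. Thus Γ1 K is known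
from earlier levels. -/
theorem K_rows (hL : Herm L) (hx : IsUni x) (hy : IsUni y)
    (hp : IsLex L x y (n + 1) (m + 1) p Tp) (hp' : IsLex L x y (n + 1) m p' Tp')
    (hqt : IsLex L y x (m + 1) (n + 1) qt Tqt) (hrt : IsLex L y x m (n + 1) rt Trt) :
    gram L (scale y p') p * gram L p qt =
      gram L p' rt * ((gram L (scale y rt) qt)⁻¹)ᴴ -
        gram L (scale (x * y) p') (rvv (x ^ (n + 1) * y ^ m) rt) *
          (gram L (scale y rt) (rvv (x ^ n * y ^ m) rt))ᴴ * ((gram L (scale y rt) qt)⁻¹)ᴴ := by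
  have h1 : gram L (scale y p') qt = gram L (scale y p') p * gram L p qt :=
    hp.comp.ins hL ((hp'.inn.scale hy).mono (mulS_box_le' hy _ _)) (by
      rw [box_swap]; exact hqt.perp)
  have h2 := hqt.comp_t.ins₂' (hrt.comp_rev_t hL hx hy) hL (V := scale y p') (U := scale y rt)
    hp'.perp.scale ((hrt.comp_t.inn.scale hy).mono (mulS_box_le' hy _ _))
  rw [gram_scale hy, h1, ← gram_conjTranspose hL (scale y rt) qt,
    ← gram_conjTranspose hL (scale y rt) (rvv _ rt)] at h2
  have h3 : (gram L (scale y rt) qt)ᴴ * ((gram L (scale y rt) qt)⁻¹)ᴴ = 1 := by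
    rw [← Matrix.conjTranspose_mul, (hrt.A_ut hL hy hqt).inv_mul_self, Matrix.conjTranspose_one]
  rw [gram_scale_scale_rvv hx, h2, Matrix.add_mul, Matrix.mul_assoc _ _ᴴ, h3, Matrix.mul_one,
    add_sub_cancel_right]

/-- As for K, but the pairing is with the reverse of rt, which is expanded in the reverse of qt and
in y rt. Since the first column of Γ vanishes, Γ K1 involves only the rows of K1 below the first. -/
theorem K1_rows (hL : Herm L) (hx : IsUni x) (hy : IsUni y)
    (hp : IsLex L x y (n + 1) (m + 1) p Tp) (hp' : IsLex L x y (n + 1) m p' Tp')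
    (hqt : IsLex L y x (m + 1) (n + 1) qt Tqt) (hrt : IsLex L y x m (n + 1) rt Trt) :
    shiftU m * gram L (scale (x * y) p) (rvv (x ^ (n + 1) * y ^ (m + 1)) qt) =
      (gram L p' p * (shiftU m)ᵀ)⁻¹ *
        (gram L (scale (x * y) p') (rvv (x ^ (n + 1) * y ^ m) rt) *
            ((gram L (scale y rt) qt)⁻¹)ᵀ -
          gram L p' rt * gram L (scale y rt) (rvv (x ^ n * y ^ m) rt) *
            ((gram L (scale y rt) qt)⁻¹)ᵀ) := by
  have hu : IsUni (x ^ n * y ^ (m + 1)) := (hx.pow n).mul (hy.pow (m + 1))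
  have hrqt : Perp L (rvv (x ^ n * y ^ (m + 1)) qt) (mulS y (box x y (n + 1) (m + 1))) :=
    (hqt.comp_rev_t hL hx hy).perp
  have h1 : gram L (scale y p') (rvv (x ^ n * y ^ (m + 1)) qt) = gram L p' p *
      gram L (scale y p) (rvv (x ^ n * y ^ (m + 1)) qt) := by
    rw [← gram_scale hy p' p]
    exact (hp.comp.scale hy).ins hL
      ((hp'.inn.mono (box_mono le_rfl (Nat.le_succ m))).scale hy) hrqt
  have h2 := (hqt.comp_rev_t hL hx hy).ins₂' (hrt.comp_t.scale hy) hL (V := scale y p')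
    (U := rvv (x ^ n * y ^ m) rt) hp'.perp.scale
    ((hrt.comp_rev_t hL hx hy).inn.mono (box_mono le_rfl (Nat.le_succ _)))
  have h4 : gram L (rvv (x ^ n * y ^ (m + 1)) qt) (rvv (x ^ n * y ^ m) rt) =
      (gram L (scale y rt) qt)ᵀ := by
    rw [← rvv_scale_right hy m _ rt, gram_rvv hu]
  have h3 : (gram L (scale y rt) qt)ᵀ * ((gram L (scale y rt) qt)⁻¹)ᵀ = 1 := by
    rw [← Matrix.transpose_mul, (hrt.A_ut hL hy hqt).inv_mul_self, Matrix.transpose_one]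
  rw [gram_scale hy, h4, h1] at h2
  have h5 : gram L p' p * gram L (scale y p) (rvv (x ^ n * y ^ (m + 1)) qt) =
      gram L p' p * (shiftU m)ᵀ * (shiftU m * gram L (scale y p)
        (rvv (x ^ n * y ^ (m + 1)) qt)) := by
    rw [← Matrix.mul_assoc, mul_shiftU_mul_shiftU (hp'.G_zero hL hp)]
  have h6 := Matrix.nonsing_inv_mul _ (hp'.GU_isUnit hL hp)
  rw [gram_scale_scale_rvv hx, gram_scale_scale_rvv hx, h2, Matrix.add_mul, Matrix.mul_assoc _ _ᵀ,
    h3, Matrix.mul_one, add_sub_cancel_right, h5,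
    ← Matrix.mul_assoc, h6, Matrix.one_mul]

/-- The symmetry of the coefficient `E`. -/
theorem E_transpose (u v : BiLaurent) (V : Fin k → BiLaurent) :
    (gram L (scale v V) (rvv u V))ᵀ = gram L (scale v V) (rvv u V) :=
  gram_scale_rvv_transpose v u V V

theorem E_conjTranspose (u v : BiLaurent) (V : Fin k → BiLaurent) :
    (gram L (scale v V) (rvv u V))ᴴ = cj (gram L (scale v V) (rvv u V)) := by
  conv_rhs => rw [← E_transpose]
  rfl

end formulas

end Bicircle
end

/-! ### Further identities: K and K1 from their entries, I1, Γ1 and H3 -/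

noncomputable section
namespace Bicircle

variable {L : BiLaurent →ₗ[ℂ] ℂ} {k l j : ℕ} {x y : BiLaurent} {n m : ℕ}

theorem cj_add {p q : ℕ} (A B : Matrix (Fin p) (Fin q) ℂ) : cj (A + B) = cj A + cj B := by
  ext a b
  simp [cj]

theorem corner_transpose (p q : ℕ) : (corner p q)ᵀ = corner q p := Matrix.transpose_single _ _ _

section formulas

variable {p r : Fin (m + 1) → BiLaurent} {q : Fin (m + 2) → BiLaurent}
  {p' : Fin m → BiLaurent}
  {qt rt : Fin (n + 1) → BiLaurent} {pt : Fin (n + 2) → BiLaurent}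
  {Tp Tr : Matrix (Fin (m + 1)) (Fin (m + 1)) ℂ} {Tq : Matrix (Fin (m + 2)) (Fin (m + 2)) ℂ}
  {Tp' : Matrix (Fin m) (Fin m) ℂ}
  {Tqt Trt : Matrix (Fin (n + 1)) (Fin (n + 1)) ℂ} {Tpt : Matrix (Fin (n + 2)) (Fin (n + 2)) ℂ}

/-- The last entry of `K` together with its rows and columns determines `K`. -/
theorem K_eq_of_last {N M : ℕ} {A : Matrix (Fin (M + 1)) (Fin (M + 1)) ℂ}
    {B : Matrix (Fin (N + 1)) (Fin (N + 1)) ℂ} (hA : UT A) (hB : UT B)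
    {K X : Matrix (Fin (M + 1)) (Fin (N + 1)) ℂ} (hlast : K (Fin.last M) (Fin.last N) =
      (A * X * Bᴴ) (Fin.last M) (Fin.last N))
    (hr : shiftU1 M * (A⁻¹ * K * (Bᴴ)⁻¹) = shiftU1 M * X)
    (hc : ∀ b : Fin N, (A⁻¹ * K * (Bᴴ)⁻¹) (Fin.last M) b.castSucc = X (Fin.last M) b.castSucc) :
    K = A * X * Bᴴ := by
  have hBH : IsUnit (Bᴴ).det := by
    rw [Matrix.det_conjTranspose]
    exact hB.isUnit_det.star
  have hK : K = A * (A⁻¹ * K * (Bᴴ)⁻¹) * Bᴴ := by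
    rw [Matrix.mul_assoc A⁻¹, ← Matrix.mul_assoc A, hA.mul_inv_self, Matrix.one_mul,
      Matrix.mul_assoc, Matrix.nonsing_inv_mul _ hBH, Matrix.mul_one]
  set Y := A⁻¹ * K * (Bᴴ)⁻¹ with hY
  -- By triangularity the last entry of A Z Bᴴ sees only the last entry of Z, so prescribing the
  -- corner of K prescribes the corner of its normalisation.
  have hlast' : ∀ Z : Matrix (Fin (M + 1)) (Fin (N + 1)) ℂ, (A * Z * Bᴴ) (Fin.last M) (Fin.last N) =
      A (Fin.last M) (Fin.last M) * Z (Fin.last M) (Fin.last N) *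
        star (B (Fin.last N) (Fin.last N)) := by
    intro Z
    rw [Matrix.mul_apply, Finset.sum_eq_single (Fin.last N)]
    · rw [Matrix.conjTranspose_apply, Matrix.mul_apply, Finset.sum_eq_single (Fin.last M)]
      · intro c _ hc
        rw [hA.1 (i := Fin.last M) (j := c) (lt_of_le_of_ne (Fin.le_last c) hc), zero_mul]
      · simp
    · intro c _ hc
      rw [Matrix.conjTranspose_apply,
        hB.1 (i := Fin.last N) (j := c) (lt_of_le_of_ne (Fin.le_last c) hc), star_zero, mul_zero]
    · simp
  have hYX : Y = X := by
    ext a b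
    refine Fin.lastCases ?_ (fun a => ?_) a
    · refine Fin.lastCases ?_ hc b
      rw [hK, hlast', hlast'] at hlast
      have h1 : star (B (Fin.last N) (Fin.last N)) ≠ 0 := star_ne_zero.2 (hB.diag_ne_zero _)
      exact mul_left_cancel₀ (hA.diag_ne_zero (Fin.last M)) (mul_right_cancel₀ h1 hlast)
    · have := congrFun (congrFun hr a) b
      simpa [shiftU1_mul] using this
  rw [hK, hYX]

/-- The row formula for the exchanged variables, transposed: K1 of the other ordering is the
transpose of K1. -/
theorem K1_cols (hL : Herm L) (hx : IsUni x) (hy : IsUni y) {q't : Fin n → BiLaurent}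
    {Tq't : Matrix (Fin n) (Fin n) ℂ}
    (hp : IsLex L x y (n + 1) (m + 1) p Tp) (hr : IsLex L x y n (m + 1) r Tr)
    (hqt : IsLex L y x (m + 1) (n + 1) qt Tqt) (hq't : IsLex L y x (m + 1) n q't Tq't) :
    gram L (scale (x * y) p) (rvv (x ^ (n + 1) * y ^ (m + 1)) qt) * (shiftU n)ᵀ =
      ((gram L (scale x r) p)⁻¹ * gram L (scale (x * y) r) (rvv (x ^ n * y ^ (m + 1)) q't) -
        (gram L (scale x r) p)⁻¹ * gram L (scale x r) (rvv (x ^ n * y ^ m) r) *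
          cj (gram L r q't)) * (shiftU n * (gram L q't qt)ᵀ)⁻¹ := by
  have h := congrArg Matrix.transpose (K1_rows hL hy hx hqt hq't hp hr)
  rw [mul_comm y x, mul_comm (y ^ (m + 1)) (x ^ (n + 1)), mul_comm (y ^ (m + 1)) (x ^ n),
    mul_comm (y ^ m) (x ^ n)] at h
  simp only [Matrix.transpose_sub, Matrix.transpose_mul, Matrix.transpose_nonsing_inv,
    Matrix.transpose_transpose, gram_scale_rvv_transpose] at h
  rw [h, ← gram_conjTranspose hL r q't]
  simp only [← Matrix.mul_assoc]
  rfl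

/-- The row formula for the exchanged variables, now with the conjugate transpose, as Kt = Kᴴ. -/
theorem K_cols (hL : Herm L) (hx : IsUni x) (hy : IsUni y) {q't : Fin n → BiLaurent}
    {Tq't : Matrix (Fin n) (Fin n) ℂ}
    (hp : IsLex L x y (n + 1) (m + 1) p Tp) (hr : IsLex L x y n (m + 1) r Tr)
    (hqt : IsLex L y x (m + 1) (n + 1) qt Tqt) (hq't : IsLex L y x (m + 1) n q't Tq't) :
    gram L p qt * (gram L (scale x q't) qt)ᴴ =
      (gram L (scale x r) p)⁻¹ * gram L r q't -
        (gram L (scale x r) p)⁻¹ * gram L (scale x r) (rvv (x ^ n * y ^ m) r) *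
          cj (gram L (scale (x * y) r) (rvv (x ^ n * y ^ (m + 1)) q't)) := by
  have h := congrArg Matrix.conjTranspose (K_rows hL hy hx hqt hq't hp hr)
  rw [mul_comm y x, mul_comm (y ^ (m + 1)) (x ^ n), mul_comm (y ^ m) (x ^ n),
    Matrix.conjTranspose_mul, gram_conjTranspose hL qt p, Matrix.conjTranspose_sub,
    Matrix.conjTranspose_mul, Matrix.conjTranspose_mul, Matrix.conjTranspose_mul,
    Matrix.conjTranspose_conjTranspose, Matrix.conjTranspose_conjTranspose,
    gram_conjTranspose hL q't r, ← Matrix.mul_assoc] at h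
  rw [h, ← gram_scale_rvv_transpose _ _ q't r]
  rfl

/-- Both x Q and the reverse of Q are expanded and paired with φt: the reverse of Q in the reverse
of φ and x Q, and x Q in φ and the reverse of Q. Eliminating ⟨x Q, φt⟩ leaves an equation for I1
with coefficient conj A. -/
theorem formulaI1_eq (hL : Herm L) (hx : IsUni x) (hy : IsUni y) {Q : Fin (m + 1) → BiLaurent}
    {TQ : Matrix (Fin (m + 1)) (Fin (m + 1)) ℂ}
    (hq : IsLex L x y n (m + 1) Q TQ)
    (hqt : IsLex L y x m (n + 1) qt Tqt) {φ : Fin (m + 1) → BiLaurent}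
    {T : Matrix (Fin (m + 1)) (Fin (m + 1)) ℂ} {φt : Fin (n + 2) → BiLaurent}
    {Tt : Matrix (Fin (n + 2)) (Fin (n + 2)) ℂ}
    (hφ : IsLex L x y (n + 1) (m + 1) φ T) (hφt : IsLex L y x m (n + 2) φt Tt) :
    gram L (rvv (x ^ (n + 1) * y ^ m) φ) φt =
      formulaI1 (gram L (scale x Q) φ) (gram L (scale x Q) (rvv (x ^ n * y ^ m) Q))
        (gram L φ φt) (gram L (rvv (x ^ n * y ^ m) Q) qt) (gram L qt φt) := by
  have hu : IsUni (x ^ (n + 1) * y ^ m) := (hx.pow _).mul (hy.pow _)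
  have hrq := hq.comp_rev hL hx hy
  have h1 := (hφ.comp_rev hL hx hy).ins₂' (hq.comp.scale hx) hL
    (V := rvv (x ^ n * y ^ m) Q) hrq.perp hφt.comp_t.inn
  have h2 := hφ.comp.ins₂' hrq hL (V := scale x Q) hq.perp.scale hφt.comp_t.inn
  have h3 : gram L (rvv (x ^ n * y ^ m) Q) φt =
      gram L (rvv (x ^ n * y ^ m) Q) qt * gram L qt φt :=
    hqt.comp_t.ins hL hrq.inn (hφt.comp_t.perp.mono (box_mono (Nat.le_succ _) le_rfl))
  have h4 := hφ.comp.ins₂' hrq hL (V := scale x Q) hq.perp.scale (U := scale x Q)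
    ((hq.comp.inn.scale hx).mono (mulS_box_le hx _ _))
  rw [gram_scale hx, hq.norm, ← gram_conjTranspose hL (scale x Q),
    ← gram_conjTranspose hL (scale x Q), E_conjTranspose] at h4
  have h5 : gram L (rvv (x ^ n * y ^ m) Q) (rvv (x ^ (n + 1) * y ^ m) φ) =
      cj (gram L (scale x Q) φ) := by
    rw [gram_conj hL hu, rvv_scale_left hx]
  rw [h5, h2, h3, ← gram_conjTranspose hL (scale x Q), E_conjTranspose] at h1
  rw [formulaI1, E_conjTranspose]
  have hA := hq.A_ut hL hx hφ
  set A := gram L (scale x Q) φ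
  set E := gram L (scale x Q) (rvv (x ^ n * y ^ m) Q)
  set I1 := gram L (rvv (x ^ n * y ^ m) Q) qt
  set Gt := gram L qt φt
  set J := gram L (rvv (x ^ (n + 1) * y ^ m) φ) φt
  -- The entrywise conjugate of A Aᴴ + E Eᴴ = 1, where Eᴴ = conj E because E is symmetric.
  have h6 : cj A * Aᵀ = 1 - cj E * E := by
    have := congrArg cj h4
    have e1 : cj (A * Aᴴ + E * cj E) = cj A * Aᵀ + cj E * E := by
      rw [cj_add, cj_mul, cj_mul, cj_conjTranspose, cj_cj]
    rw [e1] at this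
    rw [eq_sub_iff_add_eq, ← this]
    ext a b
    simp [cj, Matrix.one_apply, apply_ite]
  have h7 : cj A * J = cj A * (Aᵀ * I1 * Gt) - cj E * (A * gram L φ φt) := by
    rw [Matrix.mul_assoc, ← Matrix.mul_assoc (cj A), h6, Matrix.sub_mul, Matrix.one_mul,
      Matrix.mul_assoc (cj E)]
    rw [Matrix.mul_add] at h1
    rw [← sub_eq_iff_eq_add] at h1
    rw [← h1]
    abel
  have h8 := (cj_ut hA).inv_mul_self
  calc J = (cj A)⁻¹ * (cj A * J) := by rw [← Matrix.mul_assoc, h8, Matrix.one_mul]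
    _ = _ := by
      rw [h7, Matrix.mul_sub, ← Matrix.mul_assoc, h8, Matrix.one_mul]
      simp only [Matrix.mul_assoc]
      abel

/-- The inner products of the reversed vector `qt` with `p`. -/
theorem gram_rvv_qt_p (hL : Herm L) (hx : IsUni x) (hy : IsUni y)
    (hp : IsLex L x y (n + 1) (m + 1) p Tp)
    (hqt : IsLex L y x (m + 1) (n + 1) qt Tqt) (hrt : IsLex L y x m (n + 1) rt Trt) :
    gram L (rvv (x ^ n * y ^ (m + 1)) qt) p = -((cj (gram L (scale y rt) qt))⁻¹ *
      (gram L (scale y rt) (rvv (x ^ n * y ^ m) rt))ᴴ * gram L (scale y rt) qt *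
        (gram L p qt)ᴴ) := by
  have hu : IsUni (x ^ n * y ^ (m + 1)) := (hx.pow _).mul (hy.pow _)
  have hyn : mulS y (box x y (n + 1) m) ≤ box x y (n + 1) (m + 1) := mulS_box_le' hy _ _
  have h1 := (hqt.comp_rev_t hL hx hy).ins₂ (hrt.comp_t.scale hy) hL (V := rvv (x ^ n * y ^ m) rt)
    (U := p) ((hrt.comp_rev_t hL hx hy).inn.mono (box_mono le_rfl (Nat.le_succ _)))
    (hp.perp.mono hyn)
  -- The reverse of rt lies in the smaller box, to which p is orthogonal; its expansion in the
  -- reverse of qt and in y rt is therefore an equation for the unknown inner product.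
  have h0 : gram L (rvv (x ^ n * y ^ m) rt) p = 0 :=
    hp.perp.gram_zero' hL (hrt.comp_rev_t hL hx hy).inn
  have h2 : gram L (scale y rt) p = gram L (scale y rt) qt * gram L qt p :=
    hqt.comp_t.ins hL ((hrt.comp_t.inn.scale hy).mono (mulS_box_le' hy _ _)) hp.perp
  have h5 : gram L (rvv (x ^ n * y ^ m) rt) (rvv (x ^ n * y ^ (m + 1)) qt) =
      cj (gram L (scale y rt) qt) := by
    rw [gram_conj hL hu, rvv_scale_right hy]
  rw [h0, h5, h2, ← gram_conjTranspose hL (scale y rt) (rvv _ rt),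
    ← gram_conjTranspose hL p qt] at h1
  have h8 := (cj_ut (hrt.A_ut hL hy hqt)).inv_mul_self
  have h9 := eq_neg_of_add_eq_zero_left h1.symm
  calc _ = (cj (gram L (scale y rt) qt))⁻¹ * (cj (gram L (scale y rt) qt) *
        gram L (rvv (x ^ n * y ^ (m + 1)) qt) p) := by
        rw [← Matrix.mul_assoc, h8, Matrix.one_mul]
    _ = _ := by rw [h9, Matrix.mul_neg]; simp only [Matrix.mul_assoc]

/-- The coefficients `⟨y p, ψ⟩` for an orthonormal basis `ψ` of the orthogonal complement of a
box in a space that contains `p`. -/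
theorem formulaG1U_eq (hL : Herm L) (hx : IsUni x) (hy : IsUni y) {i : ℕ}
    (hp : IsLex L x y (n + 1) (m + 1) p Tp) (hp' : IsLex L x y (n + 1) m p' Tp')
    (hqt : IsLex L y x (m + 1) (n + 1) qt Tqt) (hrt : IsLex L y x m (n + 1) rt Trt)
    (hpt : IsLex L y x m (n + 2) pt Tpt) {S : Submodule ℂ BiLaurent}
    {ψ : Fin i → BiLaurent} (hψ : Comp L ψ (box x y (n + 1) (m + 2)) S) (hpS : Inn p S) :
    gram L (scale y p) ψ * gram L ψ p =
      gram L p pt * gram L (scale y pt) (rvv (x ^ (n + 1) * y ^ m) pt) *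
          (gram L (rvv (x ^ (n + 1) * y ^ m) p) pt)ᵀ +
        (gram L p' p)ᴴ * gram L (scale y p') p +
        gram L (scale (x * y) p) (rvv (x ^ (n + 1) * y ^ (m + 1)) qt) *
          (cj (gram L (scale y rt) qt))⁻¹ *
          (gram L (scale y rt) (rvv (x ^ n * y ^ m) rt))ᴴ * gram L (scale y rt) qt *
          (gram L p qt)ᴴ := by
  -- The inner product ⟨y p, p⟩ is computed twice: through ψ and the reverse of qt, and (in `h2`)
  -- through the translates y pt and y p'. The first expansion contains the unknown, the second only
  -- known coefficients.
  have h1 := hψ.ins₂' (hqt.comp_rev_t hL hx hy) hL (V := scale y p) hp.perp.scale hpS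
  have h2 := (hpt.comp_t.scale hy).ins₂ (hp'.comp.scale hy) hL (V := scale y p) (U := p)
    (hp.inn.scale hy) (hp.perp.mono (mulS_box_le' hy _ _))
  have h3 : gram L (scale y pt) p = gram L (scale y pt) (rvv (x ^ (n + 1) * y ^ m) pt) *
      gram L (rvv (x ^ (n + 1) * y ^ m) pt) p :=
    (hpt.comp_rev_t hL hx hy).ins' hL hpt.comp_t.perp.scale hp.inn
  rw [gram_rvv_qt_p hL hx hy hp hqt hrt, h2, gram_scale hy, gram_scale hy, h3,
    ← gram_rvv_transpose, ← gram_conjTranspose hL p', Matrix.mul_neg, eq_add_neg_iff_add_eq] at h1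
  rw [gram_scale_scale_rvv hx p, ← h1]
  simp only [Matrix.mul_assoc]

end formulas

/-- Only the first row of `H2 + K1 * H1` is needed; it is the first row of `G1 * Uᵀ`. -/
theorem formulaH_row {p q : ℕ} {I I1 : Matrix (Fin (p + 1)) (Fin (q + 2)) ℂ}
    {EtNew : Matrix (Fin (q + 2)) (Fin (q + 2)) ℂ}
    {Gp G1p : Matrix (Fin p) (Fin (p + 1)) ℂ} {At Et : Matrix (Fin (q + 1)) (Fin (q + 1)) ℂ}
    {Gt Gt1 : Matrix (Fin (q + 1)) (Fin (q + 2)) ℂ}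
    {K K1 : Matrix (Fin (p + 1)) (Fin (q + 1)) ℂ} {G : Matrix (Fin (p + 1)) (Fin (p + 2)) ℂ}
    (hst : IsUnit (stack Gt1 Gt).det) (hsym : EtNewᵀ = EtNew) (hsym' : Etᵀ = Et)
    (hE : stack Gt1 Gt * EtNew = (shiftU (q + 1))ᵀ * (At * Kᴴ * (I1ᵀ)ᴴ + Et * cj Gt1) +
      corner (q + 1) q * (At * K1ᵀ * (Iᴴ)ᵀ + Et * cj Gt))
    (hI0 : ∀ b, I 0 b = if b = 0 then 1 else 0) (hI0' : ∀ a, I a 0 = if a = 0 then 1 else 0)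
    (hGp : ∀ a, Gp a 0 = 0) (hGt : ∀ a, Gt a 0 = 0) (b : Fin (p + 1)) :
    formulaG1U I I1 EtNew Gp G1p At Et K K1 G 0 b =
      (formulaH2 I I1 At Et Gt Gt1 K G + K1 * formulaH1 I1 At Et Gt Gt1 K G) 0 b := by
  set S := (shiftU (p + 1) * Gᴴ)⁻¹
  set Y := ((stack Gt1 Gt)ᵀ)⁻¹
  have hY : (stack Gt1 Gt)ᵀ * Y = 1 := Matrix.mul_nonsing_inv _ (by rwa [Matrix.det_transpose])
  -- The defining equation of the new Et, transposed. It is used to eliminate Et, so that H2 and H1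
  -- refer only to the previous levels and to K and Γ.
  have hE' : EtNew * (stack Gt1 Gt)ᵀ = (I1ᴴ * cj K * Atᵀ + Gt1ᴴ * Et) * shiftU (q + 1) +
      (Iᴴ * (K1 * Atᵀ) + Gtᴴ * Et) * corner q (q + 1) := by
    have := congrArg Matrix.transpose hE
    rw [Matrix.transpose_mul, hsym, Matrix.transpose_add, Matrix.transpose_mul,
      Matrix.transpose_mul, Matrix.transpose_transpose, Matrix.transpose_add,
      Matrix.transpose_add, Matrix.transpose_mul, Matrix.transpose_mul, Matrix.transpose_mul,
      Matrix.transpose_mul, Matrix.transpose_mul, Matrix.transpose_mul, hsym',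
      Matrix.transpose_transpose, Matrix.transpose_transpose, cj_transpose, cj_transpose] at this
    rw [this, corner_transpose, ← Matrix.mul_assoc]
    rfl
  have hEt : EtNew = (I1ᴴ * cj K * Atᵀ + Gt1ᴴ * Et) * shiftU (q + 1) * Y +
      (Iᴴ * (K1 * Atᵀ) + Gtᴴ * Et) * corner q (q + 1) * Y := by
    rw [← Matrix.add_mul, ← hE', Matrix.mul_assoc, hY, Matrix.mul_one]
  -- In the first row, I and Iᴴ act as the identity, while Γᴴ and Γtᴴ vanish. Exactly the terms of
  -- H2 + K1 H1 survive.
  have e1 : ∀ {k : ℕ} (Z : Matrix (Fin (q + 2)) (Fin k) ℂ) (c : Fin k),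
      (I * Z) 0 c = Z 0 c := by
    intro k Z c
    rw [Matrix.mul_apply]
    simp [hI0]
  have e2 : ∀ {k : ℕ} (Z : Matrix (Fin (p + 1)) (Fin k) ℂ) (c : Fin k),
      (Iᴴ * Z) 0 c = Z 0 c := by
    intro k Z c
    rw [Matrix.mul_apply]
    simp [hI0', apply_ite]
  have e3 : ∀ {k : ℕ} (Z : Matrix (Fin (q + 1)) (Fin k) ℂ) (c : Fin k),
      (Gtᴴ * Z) 0 c = 0 := by
    intro k Z c
    rw [Matrix.mul_apply]
    simp [hGt]
  have e4 : ∀ {k : ℕ} (Z : Matrix (Fin p) (Fin k) ℂ) (c : Fin k), (Gpᴴ * Z) 0 c = 0 := by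
    intro k Z c
    rw [Matrix.mul_apply]
    simp [hGp]
  rw [formulaG1U, formulaH2, formulaH1, hEt]
  simp only [Matrix.mul_add, Matrix.add_mul, Matrix.mul_assoc, Matrix.add_apply, e1, e2, e3, e4]
  change _ + (_ + 0) + 0 + _ = _
  simp only [add_zero]
  rw [add_assoc]

end Bicircle
end

noncomputable section
namespace Bicircle

variable {L : BiLaurent →ₗ[ℂ] ℂ} {k l j : ℕ} {x y : BiLaurent} {n m N M : ℕ}

/-! ### Construction of the orthonormal polynomials on the next level -/

/-- `τ` is a unit vector orthogonal to `V` whose component along `e` modulo `V` is positive. -/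
structure IsTop (L : BiLaurent →ₗ[ℂ] ℂ) (V : Submodule ℂ BiLaurent) (e τ : BiLaurent) : Prop where
  perp : ∀ s ∈ V, L (τ * dagger s) = 0
  norm : L (τ * dagger τ) = 1
  lead : ∃ t : ℂ, (0 < t.re ∧ t.im = 0) ∧ τ - t • e ∈ V

/-- The polynomials ψ carry all columns of the leading matrix but the first, and τ, the only one
that contains x^N y^M, adds a row on top; the enlarged leading matrix is again upper triangular with
positive diagonal. -/
theorem IsLex.cons {ψ : Fin M → BiLaurent} {S : Matrix (Fin M) (Fin M) ℂ} {τ : BiLaurent}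
    (hL : Herm L) (hS : UT S)
    (hlead : Inn (ψ - act (S * shiftU M) (monoVec x y N (M + 1))) (box x y N (M + 1)))
    (hperp : Perp L ψ (box x y N (M + 1))) (hnorm : gram L ψ ψ = 1)
    (hψ : Inn ψ (box x y N (M + 1) ⊔ box x y (N + 1) M))
    (hτ : IsTop L (box x y N (M + 1) ⊔ box x y (N + 1) M) (x ^ N * y ^ M) τ) :
    ∃ T, IsLex L x y N (M + 1) (Fin.cons τ ψ : Fin (M + 1) → BiLaurent) T := by
  obtain ⟨t, ht, htV⟩ := hτ.lead
  obtain ⟨a, ha, b, hb, hab⟩ := Submodule.mem_sup.1 htV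
  obtain ⟨C, hC⟩ := exists_lead hb
  have hc : ∀ i, L (τ * dagger (ψ i)) = 0 := fun i => hτ.perp _ (hψ i)
  refine ⟨consUT t C S, consUT_ut ht C hS, ?_, ?_, ?_⟩
  · intro i
    refine Fin.cases ?_ (fun i => ?_) i
    · have h1 := (box x y N (M + 1)).add_mem ha (box_mono le_rfl (Nat.le_succ M) hC)
      have h2 : a + (b - ∑ c, C c • monoVec x y N M c) =
          τ - act (consUT t C S) (monoVec x y N (M + 1)) 0 := by
        rw [act_apply, Fin.sum_univ_succ]
        have h3 : monoVec x y N (M + 1) 0 = x ^ N * y ^ M := by simp [monoVec]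
        simp only [monoVec_succ, h3]
        change _ = τ - (t • _ + ∑ i, C i • _)
        rw [sub_eq_iff_eq_add.1 hab.symm]
        abel
      rw [h2] at h1
      exact h1
    · have h1 := hlead i
      have h2 : (ψ - act (S * shiftU M) (monoVec x y N (M + 1))) i =
          ψ i - act (consUT t C S) (monoVec x y N (M + 1)) i.succ := by
        rw [Pi.sub_apply, act_apply, act_apply, Fin.sum_univ_succ, Fin.sum_univ_succ]
        simp only [mul_shiftU_zero, mul_shiftU_succ]
        rfl
      rw [h2] at h1
      exact h1
  · intro i
    refine Fin.cases ?_ (fun i => ?_) i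
    · exact fun s hs => hτ.perp s (le_sup_left (b := box x y (N + 1) M) hs)
    · exact hperp i
  · ext i j
    refine Fin.cases ?_ (fun i => ?_) i <;> refine Fin.cases ?_ (fun j => ?_) j
    · exact hτ.norm
    · exact hc j
    · have := hL.swap τ (ψ i)
      rw [hc, star_zero] at this
      exact this.symm
    · have := congrFun (congrFun hnorm i) j
      rw [Matrix.one_apply] at this ⊢
      simpa [gram_apply, Fin.succ_inj] using this

section psi

variable {p : Fin (m + 1) → BiLaurent} {qt rt : Fin (n + 1) → BiLaurent}
  {Tp B : Matrix (Fin (m + 1)) (Fin (m + 1)) ℂ} {Tqt : Matrix (Fin (n + 1)) (Fin (n + 1)) ℂ}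

/-- The normalised component of `p` that is orthogonal to `qt`. -/
def psi (B : Matrix (Fin k) (Fin k) ℂ) (K : Matrix (Fin k) (Fin l) ℂ) (p : Fin k → BiLaurent)
    (qt : Fin l → BiLaurent) : Fin k → BiLaurent := act B⁻¹ (p - act K qt)

theorem psi_spec (hB : UT B) (K : Matrix (Fin (m + 1)) (Fin l) ℂ) (qt : Fin l → BiLaurent) :
    p = act B (psi B K p qt) + act K qt := by
  rw [psi, act_act, hB.mul_inv_self, act_one, sub_add_cancel]

/-- The vectors p and qt extend the common box (n+1) × (m+1) in the two directions. The part of p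
orthogonal to qt has Gram matrix 1 - KKᴴ = BBᴴ, and it completes the box extended in y to the sum of
both extensions. -/
theorem psi_comp (hL : Herm L)
    (hp : IsLex L x y (n + 1) (m + 1) p Tp) (hqt : IsLex L y x (m + 1) (n + 1) qt Tqt)
    (hB : UT B) (hK : 1 - gram L p qt * (gram L p qt)ᴴ = B * Bᴴ) :
    Comp L (psi B (gram L p qt) p qt) (box x y (n + 1) (m + 2))
      (box x y (n + 1) (m + 2) ⊔ box x y (n + 2) (m + 1)) where
  inn := by
    refine Inn.act (Inn.sub (hp.inn.mono le_sup_right) (Inn.act ?_ _)) _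
    exact hqt.comp_t.inn.mono le_sup_left
  perp := by
    refine Perp.act (Perp.of_gram_comp hqt.comp_t (Perp.sub hp.perp (Perp.act ?_ _)) ?_) _
    · rw [box_swap]
      exact hqt.perp.mono (box_mono le_rfl le_rfl)
    · rw [gram_sub_left, gram_act_left, hqt.norm, Matrix.mul_one, sub_self]
  norm := by
    rw [psi, gram_act_left, gram_act_right, gram_sub_left, gram_sub_right, gram_sub_right,
      gram_act_left, gram_act_left, gram_act_right, gram_act_right, hp.norm, hqt.norm,
      Matrix.one_mul, ← gram_conjTranspose hL p qt, sub_self, sub_zero, hK,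
      Matrix.mul_assoc B, ← Matrix.conjTranspose_mul, hB.inv_mul_self, Matrix.conjTranspose_one,
      Matrix.mul_one, hB.inv_mul_self]
  red s hs := by
    obtain ⟨a, ha, b, hb, rfl⟩ := Submodule.mem_sup.1 hs
    obtain ⟨C, hC⟩ := hp.comp.red b hb
    let Cm : Matrix (Fin 1) (Fin (m + 1)) ℂ := Matrix.of fun _ b => C b
    refine ⟨(Cm * B) 0, ?_⟩
    have h1 : ∑ c, C c • p c = act (Cm * B) (psi B (gram L p qt) p qt) 0 +
        act (Cm * gram L p qt) qt 0 := by
      rw [← act_act, ← act_act, ← Pi.add_apply, ← act_add_vec, ← psi_spec hB]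
      rfl
    rw [h1] at hC
    have h2 : act (Cm * gram L p qt) qt 0 ∈ box x y (n + 1) (m + 2) := hqt.comp_t.inn.act _ 0
    have h3 := Submodule.add_mem _ (Submodule.add_mem _ ha
      (box_mono (Nat.le_refl _) (Nat.le_succ _) hC)) h2
    convert h3 using 1
    rw [act_apply]
    abel

theorem psi_lead (hp : IsLex L x y (n + 1) (m + 1) p Tp)
    (hqt : IsLex L y x (m + 1) (n + 1) qt Tqt) (K : Matrix (Fin (m + 1)) (Fin (n + 1)) ℂ) :
    Inn (psi B K p qt - act ((B⁻¹ * Tp) * shiftU (m + 1)) (monoVec x y (n + 1) (m + 2)))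
      (box x y (n + 1) (m + 2)) := by
  rw [psi, Matrix.mul_assoc, ← act_act, ← act_sub_vec, sub_right_comm]
  exact (hp.lead_up.sub (hqt.comp_t.inn.act _)).act _

theorem gram_p_psi (hL : Herm L)
    (hp : IsLex L x y (n + 1) (m + 1) p Tp) (hqt : IsLex L y x (m + 1) (n + 1) qt Tqt)
    (hB : UT B) (hK : 1 - gram L p qt * (gram L p qt)ᴴ = B * Bᴴ) :
    gram L p (psi B (gram L p qt) p qt) = B := by
  have hψ := psi_comp hL hp hqt hB hK
  conv_lhs => enter [2]; rw [psi_spec hB (gram L p qt) qt (p := p)]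
  rw [gram_add_left, gram_act_left, gram_act_left, hψ.norm, Matrix.mul_one,
    hψ.perp.gram_zero' hL hqt.comp_t.inn, Matrix.mul_zero, add_zero]

/-- The component of `y * p` orthogonal to the span of `rvv qt`, `ψ`. -/
def topVec (L : BiLaurent →ₗ[ℂ] ℂ) (y : BiLaurent) (p : Fin k → BiLaurent)
    (qr : Fin l → BiLaurent) (ψ : Fin j → BiLaurent) : Fin k → BiLaurent :=
  scale y p - act (gram L (scale y p) qr) qr - act (gram L (scale y p) ψ) ψ

variable {S : Submodule ℂ BiLaurent} {ψ : Fin l → BiLaurent}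

theorem topVec_perp (hL : Herm L) (hx : IsUni x) (hy : IsUni y)
    (hp : IsLex L x y (n + 1) (m + 1) p Tp) (hqt : IsLex L y x (m + 1) (n + 1) qt Tqt)
    (hψ : Comp L ψ (box x y (n + 1) (m + 2)) S) :
    Perp L (topVec L y p (rvv (x ^ n * y ^ (m + 1)) qt) ψ) S := by
  have hq := hqt.comp_rev_t hL hx hy
  have h0 : gram L ψ (rvv (x ^ n * y ^ (m + 1)) qt) = 0 := hψ.perp.gram_zero hq.inn
  refine Perp.of_gram_comp hψ (Perp.sub (Perp.of_gram_comp hq (Perp.sub hp.perp.scale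
    (hq.perp.act _)) ?_) (hψ.perp.act _)) ?_
  · rw [gram_sub_left, gram_act_left, hq.norm, Matrix.mul_one, sub_self]
  · rw [topVec, gram_sub_left, gram_sub_left, gram_act_left, gram_act_left, hψ.norm,
      hψ.perp.gram_zero' hL hq.inn, Matrix.mul_zero, Matrix.mul_one, sub_zero, sub_self]

/-- The vector y p has Gram matrix 1, and the reverse of qt and ψ are orthonormal and orthogonal to
each other; Bessel's remainder is left. -/
theorem topVec_norm (hL : Herm L) (hx : IsUni x) (hy : IsUni y)
    (hp : IsLex L x y (n + 1) (m + 1) p Tp) (hqt : IsLex L y x (m + 1) (n + 1) qt Tqt)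
    (hψ : Comp L ψ (box x y (n + 1) (m + 2)) S) (hS : box x y (n + 1) (m + 2) ≤ S) :
    gram L (topVec L y p (rvv (x ^ n * y ^ (m + 1)) qt) ψ)
        (topVec L y p (rvv (x ^ n * y ^ (m + 1)) qt) ψ) =
      1 - (gram L (scale y p) ψ * (gram L (scale y p) ψ)ᴴ +
        gram L (scale y p) (rvv (x ^ n * y ^ (m + 1)) qt) *
          (gram L (scale y p) (rvv (x ^ n * y ^ (m + 1)) qt))ᴴ) := by
  have hq := hqt.comp_rev_t hL hx hy
  have hD := topVec_perp hL hx hy hp hqt hψ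
  set D := topVec L y p (rvv (x ^ n * y ^ (m + 1)) qt) ψ with hDdef
  have e1 : gram L D (act (gram L (scale y p) (rvv (x ^ n * y ^ (m + 1)) qt))
      (rvv (x ^ n * y ^ (m + 1)) qt)) = 0 := hD.gram_zero ((hq.inn.mono hS).act _)
  have e2 : gram L D (act (gram L (scale y p) ψ) ψ) = 0 := hD.gram_zero (hψ.inn.act _)
  conv_lhs => enter [3]; rw [hDdef, topVec]
  rw [gram_sub_right, gram_sub_right, e1, e2, sub_zero, sub_zero, hDdef, topVec, gram_sub_left,
    gram_sub_left, gram_act_left, gram_act_left, gram_scale hy, hp.norm, gram_conjTranspose hL,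
    gram_conjTranspose hL]
  abel

/-- The corner monomial enters y p with coefficient `Tp a 0`, which vanishes for `a ≠ 0` by
triangularity. So only the first component can leave the sum of the two boxes. -/
theorem topVec_lead (hL : Herm L) (hx : IsUni x) (hy : IsUni y)
    (hp : IsLex L x y (n + 1) (m + 1) p Tp) (hqt : IsLex L y x (m + 1) (n + 1) qt Tqt)
    (hψ : Inn ψ (box x y (n + 1) (m + 2) ⊔ box x y (n + 2) (m + 1))) (a : Fin (m + 1)) :
    topVec L y p (rvv (x ^ n * y ^ (m + 1)) qt) ψ a - Tp a 0 • (x ^ (n + 1) * y ^ (m + 1)) ∈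
      box x y (n + 1) (m + 2) ⊔ box x y (n + 2) (m + 1) := by
  have h1 : (scale y p - act (Tp * shiftU1 (m + 1)) (monoVec x y (n + 1) (m + 2))) a ∈
      box x y (n + 1) (m + 2) ⊔ box x y (n + 2) (m + 1) := Submodule.mem_sup_left (hp.lead_up1 hy a)
  have h2 : act (Tp * shiftU1 (m + 1)) (monoVec x y (n + 1) (m + 2)) a -
      Tp a 0 • (x ^ (n + 1) * y ^ (m + 1)) ∈
      box x y (n + 1) (m + 2) ⊔ box x y (n + 2) (m + 1) := by
    rw [act_apply, Fin.sum_univ_succ]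
    have h3 : (Tp * shiftU1 (m + 1)) a 0 = Tp a 0 := mul_shiftU1_castSucc Tp a 0
    rw [h3, show monoVec x y (n + 1) (m + 2) 0 = x ^ (n + 1) * y ^ (m + 1) by simp [monoVec],
      add_sub_cancel_left]
    refine le_sup_right (a := box x y (n + 1) (m + 2)) ?_
    refine Submodule.sum_mem _ fun b _ => Submodule.smul_mem _ _ ?_
    rw [monoVec_succ]
    exact monoVec_inn (n + 1) (m + 1) b
  have h4 := Submodule.sub_mem _ (Submodule.sub_mem _ (Submodule.add_mem _ h1 h2)
    (((hqt.comp_rev_t hL hx hy).inn.mono (le_sup_left (b := box x y (n + 2) (m + 1)))).act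
      (gram L (scale y p) (rvv (x ^ n * y ^ (m + 1)) qt)) a))
    (hψ.act (gram L (scale y p) ψ) a)
  convert h4 using 1
  simp only [topVec, Pi.sub_apply]
  abel

/-- The top polynomial on the next level, with the coefficients `⟨y p, τ⟩`. -/
theorem exists_top (hL : Herm L) (hx : IsUni x) (hy : IsUni y)
    (hp : IsLex L x y (n + 1) (m + 1) p Tp) (hqt : IsLex L y x (m + 1) (n + 1) qt Tqt)
    (hψ : Comp L ψ (box x y (n + 1) (m + 2))
      (box x y (n + 1) (m + 2) ⊔ box x y (n + 2) (m + 1))) {h : ℝ} (h1 : h < 1)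
    (hh : (gram L (scale y p) ψ * (gram L (scale y p) ψ)ᴴ +
        gram L (scale y p) (rvv (x ^ n * y ^ (m + 1)) qt) *
          (gram L (scale y p) (rvv (x ^ n * y ^ (m + 1)) qt))ᴴ) 0 0 = h) :
    ∃ τ, IsTop L (box x y (n + 1) (m + 2) ⊔ box x y (n + 2) (m + 1))
        (x ^ (n + 1) * y ^ (m + 1)) τ ∧
      ∀ a, L (scale y p a * dagger τ) = if a = 0 then ((Real.sqrt (1 - h) : ℝ) : ℂ) else 0 := by
  have hD := topVec_perp hL hx hy hp hqt hψ
  have hn := topVec_norm hL hx hy hp hqt hψ le_sup_left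
  have hl := topVec_lead hL hx hy hp hqt hψ.inn
  have hdef : scale y p = topVec L y p (rvv (x ^ n * y ^ (m + 1)) qt) ψ +
      (act (gram L (scale y p) (rvv (x ^ n * y ^ (m + 1)) qt)) (rvv (x ^ n * y ^ (m + 1)) qt) +
        act (gram L (scale y p) ψ) ψ) := by
    rw [topVec]
    abel
  have hrest : Inn (act (gram L (scale y p) (rvv (x ^ n * y ^ (m + 1)) qt))
      (rvv (x ^ n * y ^ (m + 1)) qt) + act (gram L (scale y p) ψ) ψ)
      (box x y (n + 1) (m + 2) ⊔ box x y (n + 2) (m + 1)) :=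
    (((hqt.comp_rev_t hL hx hy).inn.mono le_sup_left).act _).add (hψ.inn.act _)
  set D := topVec L y p (rvv (x ^ n * y ^ (m + 1)) qt) ψ
  set V := box x y (n + 1) (m + 2) ⊔ box x y (n + 2) (m + 1)
  have hD0 : L (D 0 * dagger (D 0)) = ((1 - h : ℝ) : ℂ) := by
    have := congrFun (congrFun hn 0) 0
    rw [Matrix.sub_apply, hh, gram_apply] at this
    rw [this]
    simp
  set g : ℝ := Real.sqrt (1 - h) with hg
  have hg0 : 0 < g := Real.sqrt_pos.2 (by linarith)
  have hgg : (g : ℂ) * g = ((1 - h : ℝ) : ℂ) := by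
    rw [← Complex.ofReal_mul, Real.mul_self_sqrt (by linarith)]
  have hgne : (g : ℂ) ≠ 0 := by exact_mod_cast hg0.ne'
  have hstar : star ((g : ℂ)⁻¹) = (g : ℂ)⁻¹ := by
    rw [Complex.star_def, map_inv₀, Complex.conj_ofReal]
  have hperp : ∀ s ∈ V, L (((g : ℂ)⁻¹ • D 0) * dagger s) = 0 := fun s hs => by
    rw [smul_mul_assoc, map_smul, hD 0 s hs, smul_zero]
  refine ⟨(g : ℂ)⁻¹ • D 0, ⟨hperp, ?_, ?_⟩, ?_⟩
  · rw [dagger_smul, hstar, smul_mul_smul_comm, map_smul, hD0, ← hgg, smul_eq_mul]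
    field_simp
  · refine ⟨(g : ℂ)⁻¹ * Tp 0 0, ?_, ?_⟩
    · have := hp.ut.2 0
      rw [← Complex.ofReal_inv, Complex.re_ofReal_mul, Complex.im_ofReal_mul, this.2, mul_zero]
      exact ⟨mul_pos (inv_pos.2 hg0) this.1, rfl⟩
    · have := V.smul_mem ((g : ℂ)⁻¹) (hl 0)
      rwa [smul_sub, smul_smul] at this
  · intro a
    have hV : ∀ s ∈ V, L (s * dagger ((g : ℂ)⁻¹ • D 0)) = 0 := fun s hs => by
      rw [← star_inj, hL.swap, hperp s hs, star_zero]
    have e1 : L (scale y p a * dagger ((g : ℂ)⁻¹ • D 0)) =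
        L (D a * dagger ((g : ℂ)⁻¹ • D 0)) := by
      rw [hdef, Pi.add_apply, add_mul, map_add, hV _ (hrest a), add_zero]
    rw [e1]
    by_cases ha : a = 0
    · subst ha
      rw [if_pos rfl, dagger_smul, mul_smul_comm, map_smul, hD0, hstar, ← hgg, smul_eq_mul]
      field_simp
    -- For `a ≠ 0` the component `D a` lies in `V` itself, to which the new polynomial is
    -- orthogonal.
    · rw [if_neg ha]
      apply hV
      have h3 : Tp a 0 = 0 := hp.ut.1 (Fin.pos_of_ne_zero ha)
      have := hl a
      rwa [h3, zero_smul, sub_zero] at this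

end psi

/-! ### The recurrences -/

section recurrence

variable {Q φ : Fin (m + 1) → BiLaurent} {TQ T : Matrix (Fin (m + 1)) (Fin (m + 1)) ℂ}

/-- Expanding x Q in φ and in the reverse of Q gives 1 = A Aᴴ + E Eᴴ, and A is triangular by its
relation to the leading matrices. -/
theorem A_eq_upperCholesky (hL : Herm L) (hx : IsUni x) (hy : IsUni y)
    (hq : IsLex L x y n (m + 1) Q TQ) (hφ : IsLex L x y (n + 1) (m + 1) φ T) :
    upperCholesky (1 - gram L (scale x Q) (rvv (x ^ n * y ^ m) Q) *
      (gram L (scale x Q) (rvv (x ^ n * y ^ m) Q))ᴴ) = gram L (scale x Q) φ := by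
  have hrq := hq.comp_rev hL hx hy
  have h4 := hφ.comp.ins₂' hrq hL (V := scale x Q) hq.perp.scale (U := scale x Q)
    ((hq.comp.inn.scale hx).mono (mulS_box_le hx _ _))
  rw [gram_scale hx, hq.norm, ← gram_conjTranspose hL (scale x Q),
    ← gram_conjTranspose hL (scale x Q)] at h4
  refine upperCholesky_eq (hq.A_ut hL hx hφ) ?_
  rw [h4, add_sub_cancel_right]

/-- Without its components along φ and along the reverse of Q, the vector x Q lies in the translated
smaller box and is orthogonal to it. By positive definiteness it is zero. -/
theorem formulaΦ_eq (hL : Herm L) (hx : IsUni x) (hy : IsUni y)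
    (hq : IsLex L x y n (m + 1) Q TQ) (hφ : IsLex L x y (n + 1) (m + 1) φ T)
    (hPD : PD L (box x y (n + 1) (m + 1))) :
    act (gram L (scale x Q) φ)⁻¹ (scale x Q -
      act (gram L (scale x Q) (rvv (x ^ n * y ^ m) Q)) (rvv (x ^ n * y ^ m) Q)) = φ := by
  have hrq := hq.comp_rev hL hx hy
  have hA := hq.A_ut hL hx hφ
  have h1 := hφ.comp.red_vec ((hq.comp.inn.scale hx).mono (mulS_box_le hx _ _)) hL
  have h2 := hrq.red_vec h1 hL
  rw [gram_sub_left, gram_act_left, hφ.perp.gram_zero hrq.inn, Matrix.mul_zero, sub_zero] at h2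
  have h3 : Perp L (scale x Q - act (gram L (scale x Q) φ) φ -
      act (gram L (scale x Q) (rvv (x ^ n * y ^ m) Q)) (rvv (x ^ n * y ^ m) Q))
      (mulS x (box x y n (m + 1))) :=
    (hq.perp.scale.sub (((hφ.perp.mono (mulS_box_le hx _ _))).act _)).sub (hrq.perp.act _)
  have h5 : scale x Q - act (gram L (scale x Q) φ) φ -
      act (gram L (scale x Q) (rvv (x ^ n * y ^ m) Q)) (rvv (x ^ n * y ^ m) Q) = 0 := by
    funext a
    exact hPD.eq_zero (mulS_box_le hx _ _ (h2 a)) (h3 a _ (h2 a))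
  rw [sub_right_comm, sub_eq_zero] at h5
  rw [h5, act_act, hA.inv_mul_self, act_one]

end recurrence

end Bicircle
end

/-! ### Systems with a common first polynomial, and the coefficient I -/

noncomputable section
namespace Bicircle

variable {L : BiLaurent →ₗ[ℂ] ℂ} {k l j : ℕ} {x y : BiLaurent} {n m N M : ℕ}

theorem gram_cons_eq (V : Fin (k + 1) → BiLaurent) (τ : BiLaurent) (ψ : Fin l → BiLaurent) (g : ℂ)
    (h : ∀ a, L (V a * dagger τ) = if a = 0 then g else 0) :
    gram L V (Fin.cons τ ψ : Fin (l + 1) → BiLaurent) =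
      Matrix.single 0 0 g + gram L V ψ * shiftU l := by
  ext a b
  refine Fin.cases ?_ (fun b => ?_) b
  · rw [Matrix.add_apply, mul_shiftU_zero, add_zero]
    refine (h a).trans ?_
    by_cases ha : a = 0
    · simp [ha]
    · rw [if_neg ha, Matrix.single_apply_of_row_ne (Ne.symm ha)]
  · rw [Matrix.add_apply, mul_shiftU_succ, Matrix.single_apply_of_col_ne _ _ (Fin.succ_ne_zero b).symm,
      zero_add]
    rfl

theorem gram_cons_eq_zero (V : Fin k → BiLaurent) (τ : BiLaurent) (ψ : Fin l → BiLaurent)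
    (h : ∀ a, L (V a * dagger τ) = 0) :
    gram L V (Fin.cons τ ψ : Fin (l + 1) → BiLaurent) = gram L V ψ * shiftU l := by
  ext a b
  refine Fin.cases ?_ (fun b => ?_) b
  · rw [mul_shiftU_zero]
    exact h a
  · rw [mul_shiftU_succ]
    rfl

theorem IsTop.gram_eq_zero {V : Submodule ℂ BiLaurent} {e τ : BiLaurent} (h : IsTop L V e τ)
    (hL : Herm L) {s : BiLaurent} (hs : s ∈ V) : L (s * dagger τ) = 0 := by
  rw [← star_inj, hL.swap, h.perp s hs, star_zero]

theorem IsTop.gram_cons_cons {V : Submodule ℂ BiLaurent} {e τ : BiLaurent} (h : IsTop L V e τ)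
    (hL : Herm L) {ψ : Fin k → BiLaurent} {χ : Fin l → BiLaurent} (hψ : Inn ψ V) (hχ : Inn χ V) :
    (∀ b, gram L (Fin.cons τ ψ : Fin (k + 1) → BiLaurent) (Fin.cons τ χ : Fin (l + 1) → BiLaurent)
        0 b = if b = 0 then 1 else 0) ∧
      ∀ a, gram L (Fin.cons τ ψ : Fin (k + 1) → BiLaurent)
        (Fin.cons τ χ : Fin (l + 1) → BiLaurent) a 0 = if a = 0 then 1 else 0 := by
  constructor
  · intro b
    refine Fin.cases ?_ (fun b => ?_) b
    · rw [if_pos rfl]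
      exact h.norm
    · rw [if_neg (Fin.succ_ne_zero b)]
      exact h.perp _ (hχ b)
  · intro a
    refine Fin.cases ?_ (fun a => ?_) a
    · rw [if_pos rfl]
      exact h.norm
    · rw [if_neg (Fin.succ_ne_zero a)]
      exact h.gram_eq_zero hL (hψ a)

theorem formulaI_eq {p q : ℕ} {K : Matrix (Fin p) (Fin q) ℂ} {G : Matrix (Fin p) (Fin (p + 1)) ℂ}
    {Gt : Matrix (Fin q) (Fin (q + 1)) ℂ} {I : Matrix (Fin (p + 1)) (Fin (q + 1)) ℂ}
    (hI : ∀ a, I a 0 = if a = 0 then 1 else 0) (hGt : ∀ a, Gt a 0 = 0)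
    (hu : IsUnit (Gt * (shiftU q)ᵀ).det) (h : I * Gtᴴ = -(Gᴴ * K)) : formulaI K G Gt = I := by
  have hu' : IsUnit (shiftU q * Gtᴴ).det := by
    have : shiftU q * Gtᴴ = (Gt * (shiftU q)ᵀ)ᴴ := by
      rw [Matrix.conjTranspose_mul, ← shiftU_conjTranspose, Matrix.conjTranspose_conjTranspose]
    rw [this, Matrix.det_conjTranspose]
    exact hu.star
  have hGt' : (shiftU q)ᵀ * (shiftU q * Gtᴴ) = Gtᴴ := by
    have := congrArg Matrix.conjTranspose (mul_shiftU_mul_shiftU hGt)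
    rwa [Matrix.conjTranspose_mul, Matrix.conjTranspose_mul, ← shiftU_conjTranspose,
      Matrix.conjTranspose_conjTranspose, shiftU_conjTranspose] at this
  have h1 : I * (shiftU q)ᵀ = -(Gᴴ * K * (shiftU q * Gtᴴ)⁻¹) := by
    have : I * (shiftU q)ᵀ * (shiftU q * Gtᴴ) = -(Gᴴ * K) := by
      rw [Matrix.mul_assoc, hGt', h]
    rw [← Matrix.neg_mul, ← this, Matrix.mul_assoc _ _ (_⁻¹), Matrix.mul_nonsing_inv _ hu',
      Matrix.mul_one]
  rw [formulaI, sub_eq_add_neg, ← Matrix.neg_mul, ← h1]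
  ext a b
  refine Fin.cases ?_ (fun b => ?_) b
  · rw [Matrix.add_apply, mul_shiftU_zero, add_zero, hI, corner]
    by_cases ha : a = 0
    · simp [ha]
    · rw [if_neg ha, Matrix.single_apply_of_row_ne (Ne.symm ha)]
  · rw [Matrix.add_apply, mul_shiftU_succ, corner,
      Matrix.single_apply_of_col_ne _ _ (Fin.succ_ne_zero b).symm, zero_add, mul_shiftU_transpose]
    rfl

/-- Since φ is orthogonal to qt, the expansion of ⟨φ, qt⟩ through φt and p reads 0 = I Γtᴴ + Γᴴ K.
-/
theorem I_mul_Gt (hL : Herm L) {φ : Fin (m + 2) → BiLaurent} {φt : Fin (n + 2) → BiLaurent}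
    {p : Fin (m + 1) → BiLaurent} {qt : Fin (n + 1) → BiLaurent}
    {T : Matrix (Fin (m + 2)) (Fin (m + 2)) ℂ} {Tt : Matrix (Fin (n + 2)) (Fin (n + 2)) ℂ}
    {Tp : Matrix (Fin (m + 1)) (Fin (m + 1)) ℂ} {Tqt : Matrix (Fin (n + 1)) (Fin (n + 1)) ℂ}
    (hφ : IsLex L x y (n + 1) (m + 2) φ T) (hφt : IsLex L y x (m + 1) (n + 2) φt Tt)
    (hp : IsLex L x y (n + 1) (m + 1) p Tp) (hqt : IsLex L y x (m + 1) (n + 1) qt Tqt) :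
    gram L φ φt * (gram L qt φt)ᴴ = -((gram L p φ)ᴴ * gram L p qt) := by
  have h1 : Perp L φ (box x y (n + 1) (m + 1)) :=
    hφ.perp.mono (box_mono le_rfl (Nat.le_succ _))
  have h2 : Inn qt (box x y (n + 2) (m + 2)) :=
    hqt.comp_t.inn.mono (box_mono (Nat.le_succ _) le_rfl)
  have h3 := hφt.comp_t.ins₂' hp.comp hL (V := φ) h1 h2
  have h4 : gram L φ qt = 0 := hφ.perp.gram_zero hqt.comp_t.inn
  rw [h4, ← gram_conjTranspose hL qt, ← gram_conjTranspose hL p φ] at h3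
  exact eq_neg_of_add_eq_zero_left h3.symm

/-- The inner products `⟨y p, p⟩`. -/
theorem gram_scale_self (hL : Herm L) (hx : IsUni x) (hy : IsUni y) {p : Fin (m + 1) → BiLaurent}
    {p' : Fin m → BiLaurent} {pt : Fin (N + 1) → BiLaurent}
    {Tp : Matrix (Fin (m + 1)) (Fin (m + 1)) ℂ} {Tp' : Matrix (Fin m) (Fin m) ℂ}
    {Tpt : Matrix (Fin (N + 1)) (Fin (N + 1)) ℂ}
    (hp : IsLex L x y N (m + 1) p Tp) (hp' : IsLex L x y N m p' Tp')
    (hpt : IsLex L y x m (N + 1) pt Tpt) :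
    gram L (scale y p) p =
      gram L p pt * gram L (scale y pt) (rvv (x ^ N * y ^ m) pt) *
          (gram L (rvv (x ^ N * y ^ m) p) pt)ᵀ + (gram L p' p)ᴴ * gram L (scale y p') p := by
  have h2 := (hpt.comp_t.scale hy).ins₂ (hp'.comp.scale hy) hL (V := scale y p) (U := p)
    (hp.inn.scale hy) (hp.perp.mono (mulS_box_le' hy _ _))
  have h3 : gram L (scale y pt) p = gram L (scale y pt) (rvv (x ^ N * y ^ m) pt) *
      gram L (rvv (x ^ N * y ^ m) pt) p :=
    (hpt.comp_rev_t hL hx hy).ins' hL hpt.comp_t.perp.scale hp.inn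
  rw [h2, gram_scale hy, gram_scale hy, h3, ← gram_rvv_transpose, ← gram_conjTranspose hL p',
    Matrix.mul_assoc]

/-! ### The levels on the axes -/

/-- The Szegő recursion. Removing from x q its component along the reverse of q makes it orthogonal
to the whole box, without changing the coefficients of the new power of x; A restores the
normalisation. -/
theorem IsLex.step (hL : Herm L) (hx : IsUni x) (hy : IsUni y) {q : Fin (m + 1) → BiLaurent}
    {Tq A : Matrix (Fin (m + 1)) (Fin (m + 1)) ℂ} (hq : IsLex L x y n (m + 1) q Tq) (hA : UT A)
    (h : 1 - gram L (scale x q) (rvv (x ^ n * y ^ m) q) *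
      (gram L (scale x q) (rvv (x ^ n * y ^ m) q))ᴴ = A * Aᴴ) :
    IsLex L x y (n + 1) (m + 1) (act A⁻¹ (scale x q -
      act (gram L (scale x q) (rvv (x ^ n * y ^ m) q)) (rvv (x ^ n * y ^ m) q))) (A⁻¹ * Tq) where
  ut := hA.inv.mul hq.ut
  lead := by
    rw [← act_act, ← act_sub_vec, sub_right_comm]
    exact ((hq.lead_scale hx).sub ((hq.comp_rev hL hx hy).inn.act _)).act _
  perp := by
    have hrq := hq.comp_rev hL hx hy
    refine Perp.act (Perp.of_gram_comp hrq (Perp.sub hq.perp.scale (hrq.perp.act _)) ?_) _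
    rw [gram_sub_left, gram_act_left, hrq.norm, Matrix.mul_one, sub_self]
  norm := by
    rw [gram_act_left, gram_act_right, gram_sub_left, gram_sub_right, gram_sub_right,
      gram_act_left, gram_act_left, gram_act_right, gram_act_right, gram_scale hx, hq.norm,
      (hq.comp_rev hL hx hy).norm, Matrix.one_mul, ← gram_conjTranspose hL (scale x q), sub_self,
      sub_zero, h, Matrix.mul_assoc A, ← Matrix.conjTranspose_mul, hA.inv_mul_self,
      Matrix.conjTranspose_one, Matrix.mul_one, hA.inv_mul_self]

theorem IsLex.step_A (hx : IsUni x) {q : Fin (m + 1) → BiLaurent}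
    {Tq A : Matrix (Fin (m + 1)) (Fin (m + 1)) ℂ} (hq : IsLex L x y n (m + 1) q Tq) (hA : UT A)
    (h : 1 - gram L (scale x q) (rvv (x ^ n * y ^ m) q) *
      (gram L (scale x q) (rvv (x ^ n * y ^ m) q))ᴴ = A * Aᴴ) :
    gram L (scale x q) (act A⁻¹ (scale x q -
      act (gram L (scale x q) (rvv (x ^ n * y ^ m) q)) (rvv (x ^ n * y ^ m) q))) = A := by
  rw [gram_act_right, gram_sub_right, gram_act_right, gram_scale hx, hq.norm, h, Matrix.mul_assoc,
    ← Matrix.conjTranspose_mul, hA.inv_mul_self, Matrix.conjTranspose_one, Matrix.mul_one]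

section axis

variable {q φ : Fin 1 → BiLaurent} {qt : Fin (n + 1) → BiLaurent} {q't : Fin n → BiLaurent}
  {Tφ : Matrix (Fin 1) (Fin 1) ℂ} {Tqt : Matrix (Fin (n + 1)) (Fin (n + 1)) ℂ}

theorem axis_top (hφ : IsLex L x y (n + 1) 1 φ Tφ) :
    IsTop L (box y x 0 (n + 2) ⊔ box y x 1 (n + 1)) (y ^ 0 * x ^ (n + 1)) (φ 0) where
  perp s hs := by
    rw [box_zero_left, bot_sup_eq, box_swap] at hs
    exact hφ.perp 0 s hs
  norm := congrFun (congrFun hφ.norm 0) 0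
  lead := by
    refine ⟨Tφ 0 0, hφ.ut.2 0, ?_⟩
    rw [box_zero_left, bot_sup_eq, box_swap]
    have := hφ.lead 0
    simpa [act_apply, monoVec] using this

/-- On an axis both orderings run through the same polynomials in one variable, so the new φ is
simply put on top of qt. -/
theorem axis_lex (hL : Herm L) (hφ : IsLex L x y (n + 1) 1 φ Tφ)
    (hqt : IsLex L y x 0 (n + 1) qt Tqt) :
    ∃ T, IsLex L y x 0 (n + 2) (Fin.cons (φ 0) qt : Fin (n + 2) → BiLaurent) T := by
  refine IsLex.cons hL hqt.ut hqt.lead_up ?_ hqt.norm ?_ (axis_top hφ)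
  · have := hqt.perp
    rw [box_zero_left] at this ⊢
    exact this
  · rw [box_zero_left, bot_sup_eq]
    exact hqt.inn

theorem axis_G (hL : Herm L) (hφ : IsLex L x y (n + 1) 1 φ Tφ)
    (hqt : IsLex L y x 0 (n + 1) qt Tqt) :
    gram L qt (Fin.cons (φ 0) qt : Fin (n + 2) → BiLaurent) = shiftU (n + 1) := by
  rw [gram_cons_eq_zero, hqt.norm, Matrix.one_mul]
  exact fun a => (axis_top hφ).gram_eq_zero hL (Submodule.mem_sup_right (hqt.inn a))

theorem axis_I (hL : Herm L) (hφ : IsLex L x y (n + 1) 1 φ Tφ)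
    (hqt : IsLex L y x 0 (n + 1) qt Tqt) :
    gram L φ (Fin.cons (φ 0) qt : Fin (n + 2) → BiLaurent) = corner 0 (n + 1) := by
  ext a b
  obtain rfl : a = 0 := Subsingleton.elim _ _
  have := ((axis_top hφ).gram_cons_cons hL (k := 0) (ψ := Fin.elim0) (fun i => i.elim0)
    (fun i => Submodule.mem_sup_right (hqt.inn i))).1 b
  refine Eq.trans ?_ (this.trans ?_)
  · rfl
  · rw [corner, Matrix.single_apply]
    simp [eq_comm]

/-- Comparison of leading matrices shows that the first column of Γt1 vanishes below its top entry,
and that this entry is positive. Its value then follows because the first row is a unit vector. -/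
theorem axis_G1 (hL : Herm L) (hx : IsUni x) (hφ : IsLex L x y (n + 1) 1 φ Tφ)
    (hqt : IsLex L y x 0 (n + 1) qt Tqt) :
    gram L (scale x qt) (Fin.cons (φ 0) qt : Fin (n + 2) → BiLaurent) =
      formulaG1 (∑ b, ‖gram L (scale x qt) qt 0 b‖ ^ 2) (gram L (scale x qt) qt) := by
  obtain ⟨T, hT⟩ := axis_lex hL hφ hqt
  set φt : Fin (n + 2) → BiLaurent := Fin.cons (φ 0) qt
  have h1 : ∀ a, gram L (scale x qt) φt a 0 * T 0 0 = Tqt a 0 := fun a => by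
    rw [← mul_ut_apply_zero hT.ut, hqt.G1_mul_lead hL hx hT]
    exact mul_shiftU1_castSucc Tqt a 0
  have h0 : ∀ a, a ≠ 0 → L (scale x qt a * dagger (φ 0)) = 0 := fun a ha => by
    have := h1 a
    rw [hqt.ut.1 (i := a) (j := 0) (Fin.pos_of_ne_zero ha)] at this
    exact (mul_eq_zero.1 this).resolve_right (hT.ut.diag_ne_zero 0)
  set g : ℂ := L (scale x qt 0 * dagger (φ 0)) with hg
  have hgT : g * T 0 0 = Tqt 0 0 := h1 0
  have hgr : 0 < g.re ∧ g.im = 0 := by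
    obtain ⟨t1, t2⟩ := hT.ut.2 0
    obtain ⟨s1, s2⟩ := hqt.ut.2 0
    have hre := congrArg Complex.re hgT
    have him := congrArg Complex.im hgT
    rw [Complex.mul_re, t2, mul_zero, sub_zero] at hre
    rw [Complex.mul_im, t2, s2, mul_zero, zero_add] at him
    refine ⟨?_, (mul_eq_zero.1 him).resolve_right t1.ne'⟩
    rw [← hre] at s1
    exact pos_of_mul_pos_left s1 t1.le
  -- Parseval: in degree 0 of y there is no lower box, so the vector of length n+2 is an orthonormal
  -- basis of the whole space containing x qt.
  have hsum : ‖g‖ ^ 2 + ∑ b, ‖gram L (scale x qt) qt 0 b‖ ^ 2 = 1 := by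
    have hin : Inn (scale x qt) (box y x (0 + 1) (n + 2)) :=
      (hqt.inn.scale hx).mono (mulS_box_le' hx _ _)
    have hperp : Perp L (scale x qt) (box y x 0 (n + 2)) := by
      rw [box_zero_left]
      intro a s hs
      rw [(Submodule.mem_bot ℂ).1 hs, dagger_zero, mul_zero, map_zero]
    have h2 := hT.comp.ins hL hin hperp
    rw [gram_scale hx, hqt.norm, ← gram_conjTranspose hL (scale x qt)] at h2
    have h3 := congrFun (congrFun h2 0) 0
    rw [Matrix.one_apply_eq, Matrix.mul_apply, Fin.sum_univ_succ] at h3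
    have e : ∀ c : ℂ, c * star c = ((‖c‖ ^ 2 : ℝ) : ℂ) := fun c => by
      rw [Complex.star_def, Complex.mul_conj, Complex.normSq_eq_norm_sq]
    simp only [Matrix.conjTranspose_apply, e] at h3
    rw [← Complex.ofReal_sum, ← Complex.ofReal_add] at h3
    exact (Complex.ofReal_eq_one.1 h3.symm)
  have hgeq : g = ((Real.sqrt (1 - ∑ b, ‖gram L (scale x qt) qt 0 b‖ ^ 2) : ℝ) : ℂ) := by
    have h4 : g = (g.re : ℂ) := Complex.ext rfl (by simp [hgr.2])
    have h5 : ‖g‖ = g.re := by rw [h4, Complex.norm_real, Complex.ofReal_re, Real.norm_of_nonneg hgr.1.le]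
    rw [← hsum, add_sub_cancel_right, Real.sqrt_sq (norm_nonneg _), h5, ← h4]
  rw [formulaG1, ← hgeq]
  refine gram_cons_eq _ _ _ _ fun a => ?_
  by_cases ha : a = 0
  · rw [if_pos ha, ha]
  · rw [if_neg ha, h0 a ha]

/-- The normalisation on the axes. -/
theorem axis_cholesky {e : ℂ} (he : ‖e‖ < 1) :
    UT (Matrix.of fun _ _ => ((Real.sqrt (1 - ‖e‖ ^ 2) : ℝ) : ℂ) : Matrix (Fin 1) (Fin 1) ℂ) ∧
      1 - (Matrix.of fun _ _ => e : Matrix (Fin 1) (Fin 1) ℂ) *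
          (Matrix.of fun _ _ => e : Matrix (Fin 1) (Fin 1) ℂ)ᴴ =
        (Matrix.of fun _ _ => ((Real.sqrt (1 - ‖e‖ ^ 2) : ℝ) : ℂ) : Matrix (Fin 1) (Fin 1) ℂ) *
          (Matrix.of fun _ _ => ((Real.sqrt (1 - ‖e‖ ^ 2) : ℝ) : ℂ) :
            Matrix (Fin 1) (Fin 1) ℂ)ᴴ := by
  have h1 : 0 < 1 - ‖e‖ ^ 2 := by
    have := norm_nonneg e
    nlinarith
  refine ⟨⟨fun i j hij => ?_, fun i => ?_⟩, ?_⟩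
  · exact absurd hij (by simp [Subsingleton.elim i j])
  · exact ⟨by simpa using Real.sqrt_pos.2 h1, Complex.ofReal_im _⟩
  · ext i j
    obtain rfl : i = 0 := Subsingleton.elim _ _
    obtain rfl : j = 0 := Subsingleton.elim _ _
    simp only [Matrix.sub_apply, Matrix.one_apply_eq, Matrix.mul_apply, Finset.univ_unique,
      Finset.sum_singleton, Matrix.of_apply, Matrix.conjTranspose_apply, Complex.star_def,
      Complex.conj_ofReal]
    rw [← Complex.ofReal_mul, Real.mul_self_sqrt h1.le, Complex.mul_conj,
      Complex.normSq_eq_norm_sq]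
    push_cast
    rfl

end axis

end Bicircle
end

/-! ### The two conditions on a level: the norm of K and the Schur condition -/

noncomputable section
namespace Bicircle

variable {L : BiLaurent →ₗ[ℂ] ℂ} {k l j : ℕ} {x y : BiLaurent} {n m N M : ℕ}

open scoped Matrix.Norms.L2Operator in
-- The form of 1 - KKᴴ at v is ‖v‖² - ‖Kᴴ v̄‖², and Kᴴ has the same operator norm as K.
theorem exists_cholesky_of_norm_lt_one {p q : ℕ} {K : Matrix (Fin p) (Fin q) ℂ} (h : ‖K‖ < 1) :
    ∃ B, UT B ∧ 1 - K * Kᴴ = B * Bᴴ := by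
  refine exists_cholesky _ (by simp) fun v hv => ?_
  have e : ∀ {r : ℕ} (w : Fin r → ℂ), w ⬝ᵥ star w = ((‖WithLp.toLp 2 w‖ ^ 2 : ℝ) : ℂ) := by
    intro r w
    rw [EuclideanSpace.norm_sq_eq, dotProduct]
    push_cast
    refine Finset.sum_congr rfl fun i _ => ?_
    rw [Pi.star_apply, Complex.star_def, Complex.mul_conj, Complex.normSq_eq_norm_sq]
    push_cast
    rfl
  have e1 : v ⬝ᵥ ((K * Kᴴ) *ᵥ star v) = star (Kᴴ *ᵥ star v) ⬝ᵥ star (star (Kᴴ *ᵥ star v)) := by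
    rw [star_star, ← Matrix.mulVec_mulVec, Matrix.dotProduct_mulVec, Matrix.star_mulVec,
      star_star, Matrix.conjTranspose_conjTranspose]
  have e2 : ∀ {r : ℕ} (w : Fin r → ℂ), ‖WithLp.toLp 2 (star w)‖ = ‖WithLp.toLp 2 w‖ := by
    intro r w
    simp [EuclideanSpace.norm_eq]
  rw [Matrix.sub_mulVec, Matrix.one_mulVec, dotProduct_sub, e1, e, e, e2, ← Complex.ofReal_sub,
    Complex.ofReal_re]
  have h1 := Matrix.l2_opNorm_mulVec Kᴴ (WithLp.toLp 2 (star v))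
  rw [Matrix.l2_opNorm_conjTranspose, e2] at h1
  change ‖WithLp.toLp 2 (Kᴴ *ᵥ star v)‖ ≤ _ at h1
  have h2 : 0 < ‖WithLp.toLp 2 v‖ := norm_pos_iff.2 (by simpa using hv)
  have h3 : ‖WithLp.toLp 2 (Kᴴ *ᵥ star v)‖ < ‖WithLp.toLp 2 v‖ := by nlinarith
  have h4 := norm_nonneg (WithLp.toLp 2 (Kᴴ *ᵥ star v))
  nlinarith

/-- A suitable positive multiple r of τ differs from σ by an element of V orthogonal to V, hence by
zero; the normalisation forces r = 1. -/
theorem IsTop.unique {V : Submodule ℂ BiLaurent} {e σ τ : BiLaurent} (hPD : PD L V)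
    (hσ : IsTop L V e σ) (hτ : IsTop L V e τ) : σ = τ := by
  obtain ⟨s, hs, hs'⟩ := hσ.lead
  obtain ⟨t, ht, ht'⟩ := hτ.lead
  have ht0 : t ≠ 0 := fun h => by simp [h] at ht
  have hst : s / t = ((s.re / t.re : ℝ) : ℂ) := by
    have e1 : s = (s.re : ℂ) := Complex.ext rfl (by simp [hs.2])
    have e2 : t = (t.re : ℂ) := Complex.ext rfl (by simp [ht.2])
    rw [e1, e2, Complex.ofReal_div]
    simp
  set r : ℝ := s.re / t.re with hr
  have hr0 : 0 < r := div_pos hs.1 ht.1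
  have hmem : σ - (r : ℂ) • τ ∈ V := by
    have := V.sub_mem hs' (V.smul_mem (r : ℂ) ht')
    have h2 : (r : ℂ) * t = s := by rw [← hst, div_mul_cancel₀ _ ht0]
    rw [smul_sub, smul_smul, h2] at this
    convert this using 1
    abel
  have h0 : σ - (r : ℂ) • τ = 0 := hPD.eq_zero hmem (by
    rw [sub_mul, map_sub, smul_mul_assoc, map_smul, hσ.perp _ hmem, hτ.perp _ hmem, smul_zero,
      sub_zero])
  rw [sub_eq_zero] at h0
  have h1 := hσ.norm
  rw [h0, dagger_smul, smul_mul_smul_comm, map_smul, hτ.norm, Complex.star_def,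
    Complex.conj_ofReal, smul_eq_mul, mul_one] at h1
  have h2 : r * r = 1 := by exact_mod_cast h1
  have h3 : r = 1 := by nlinarith
  rw [h0, h3, Complex.ofReal_one, one_smul]

section step

variable {p r : Fin (m + 1) → BiLaurent} {p' : Fin m → BiLaurent}
  {qt rt : Fin (n + 1) → BiLaurent} {pt : Fin (n + 2) → BiLaurent}
  {Tp B : Matrix (Fin (m + 1)) (Fin (m + 1)) ℂ} {Tp' : Matrix (Fin m) (Fin m) ℂ}
  {Tqt Trt : Matrix (Fin (n + 1)) (Fin (n + 1)) ℂ} {Tpt : Matrix (Fin (n + 2)) (Fin (n + 2)) ℂ}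

theorem gram_scale_psi (hL : Herm L) (hx : IsUni x) (hy : IsUni y)
    (hp : IsLex L x y (n + 1) (m + 1) p Tp) (hp' : IsLex L x y (n + 1) m p' Tp')
    (hqt : IsLex L y x (m + 1) (n + 1) qt Tqt) (hrt : IsLex L y x m (n + 1) rt Trt)
    (hpt : IsLex L y x m (n + 2) pt Tpt)
    (hB : UT B) (hK : 1 - gram L p qt * (gram L p qt)ᴴ = B * Bᴴ) :
    gram L (scale y p) (psi B (gram L p qt) p qt) =
      formulaG1U (gram L p pt) (gram L (rvv (x ^ (n + 1) * y ^ m) p) pt)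
        (gram L (scale y pt) (rvv (x ^ (n + 1) * y ^ m) pt)) (gram L p' p)
        (gram L (scale y p') p) (gram L (scale y rt) qt)
        (gram L (scale y rt) (rvv (x ^ n * y ^ m) rt)) (gram L p qt)
        (gram L (scale (x * y) p) (rvv (x ^ (n + 1) * y ^ (m + 1)) qt))
        (B * shiftU (m + 1)) := by
  have hψ := psi_comp hL hp hqt hB hK
  have h := formulaG1U_eq hL hx hy hp hp' hqt hrt hpt hψ (hp.inn.mono le_sup_right)
  rw [← gram_conjTranspose hL p (psi _ _ _ _), gram_p_psi hL hp hqt hB hK] at h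
  have hU : shiftU (m + 1) * (B * shiftU (m + 1))ᴴ = Bᴴ := by
    rw [Matrix.conjTranspose_mul, shiftU_conjTranspose, ← Matrix.mul_assoc, shiftU_mul_transpose,
      Matrix.one_mul]
  have hBH : IsUnit (Bᴴ).det := by
    rw [Matrix.det_conjTranspose]
    exact hB.isUnit_det.star
  rw [formulaG1U, hU, ← h, Matrix.mul_assoc, Matrix.mul_nonsing_inv _ hBH, Matrix.mul_one]

/-- A (1,1) entry of X Xᴴ depends only on the first row of X, and in the first row H2 + K1 H1 agrees
with the coefficients of y p along ψ. So H3 gives the squared length of the projection of the first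
entry of y p onto the sum of the two boxes. -/
theorem formulaH3_apply (hL : Herm L) (hx : IsUni x) (hy : IsUni y)
    (hp : IsLex L x y (n + 1) (m + 1) p Tp) (hp' : IsLex L x y (n + 1) m p' Tp')
    (hqt : IsLex L y x (m + 1) (n + 1) qt Tqt) (hrt : IsLex L y x m (n + 1) rt Trt)
    (hpt : IsLex L y x m (n + 2) pt Tpt)
    (hI0 : ∀ b, gram L p pt 0 b = if b = 0 then 1 else 0)
    (hI0' : ∀ a, gram L p pt a 0 = if a = 0 then 1 else 0)
    (hB : UT B) (hK : 1 - gram L p qt * (gram L p qt)ᴴ = B * Bᴴ) :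
    (gram L (scale y p) (psi B (gram L p qt) p qt) *
        (gram L (scale y p) (psi B (gram L p qt) p qt))ᴴ +
        gram L (scale y p) (rvv (x ^ n * y ^ (m + 1)) qt) *
          (gram L (scale y p) (rvv (x ^ n * y ^ (m + 1)) qt))ᴴ) 0 0 =
      (((formulaH3 (gram L p pt) (gram L (rvv (x ^ (n + 1) * y ^ m) p) pt)
        (gram L (scale y rt) qt) (gram L (scale y rt) (rvv (x ^ n * y ^ m) rt))
        (gram L rt pt) (gram L (scale x rt) pt) (gram L p qt)
        (gram L (scale (x * y) p) (rvv (x ^ (n + 1) * y ^ (m + 1)) qt))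
        (B * shiftU (m + 1)) 0 0).re : ℝ) : ℂ) := by
  have hE := stack_mul_E hL hy hx hqt hpt hrt hp
  rw [mul_comm y x, mul_comm (y ^ (m + 1)) (x ^ (n + 1)), mul_comm (y ^ m) (x ^ n),
    mul_comm (y ^ m) (x ^ (n + 1)), ← gram_conjTranspose hL p qt, ← gram_conjTranspose hL p pt,
    ← gram_rvv_transpose _ p pt, ← gram_scale_rvv_transpose _ _ p qt] at hE
  have hrow := formulaH_row (G1p := gram L (scale y p') p) (G := B * shiftU (m + 1))
    (hrt.stack_isUnit hL hx hpt) (E_transpose _ _ _) (E_transpose _ _ _) hE hI0 hI0'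
    (hp'.G_zero hL hp) (hrt.G_zero hL hpt)
  rw [← gram_scale_psi hL hx hy hp hp' hqt hrt hpt hB hK] at hrow
  rw [formulaH3, gram_scale_scale_rvv hx]
  rw [gram_scale_scale_rvv hx] at hrow
  have e1 : ∀ {a b : ℕ} {X Y : Matrix (Fin (a + 1)) (Fin b) ℂ}, (∀ c, X 0 c = Y 0 c) →
      (X * Xᴴ) 0 0 = (Y * Yᴴ) 0 0 := by
    intro a b X Y h
    simp [Matrix.mul_apply, h]
  have e2 : ∀ {a b : ℕ} (X : Matrix (Fin (a + 1)) (Fin b) ℂ), ((X * Xᴴ) 0 0).im = 0 := by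
    intro a b X
    rw [Matrix.mul_apply, Complex.im_sum]
    refine Finset.sum_eq_zero fun c _ => ?_
    rw [Matrix.conjTranspose_apply, Complex.star_def, Complex.mul_conj, Complex.ofReal_im]
  rw [Matrix.add_apply, Matrix.add_apply, e1 hrow]
  refine Complex.ext rfl ?_
  rw [Complex.add_im, e2, e2, Complex.ofReal_im, add_zero]

/-- On a level where the form is known to be positive definite, the Schur condition holds. -/
theorem schur_lt_one (hL : Herm L) (hx : IsUni x) (hy : IsUni y)
    (hp : IsLex L x y (n + 1) (m + 1) p Tp) (hqt : IsLex L y x (m + 1) (n + 1) qt Tqt)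
    {ψ : Fin l → BiLaurent} (hψ : Comp L ψ (box x y (n + 1) (m + 2))
      (box x y (n + 1) (m + 2) ⊔ box x y (n + 2) (m + 1)))
    (hPD : PD L (box x y (n + 2) (m + 2))) {τ : BiLaurent}
    (hτ : IsTop L (box x y (n + 1) (m + 2) ⊔ box x y (n + 2) (m + 1))
      (x ^ (n + 1) * y ^ (m + 1)) τ) {h : ℝ}
    (hh : (gram L (scale y p) ψ * (gram L (scale y p) ψ)ᴴ +
        gram L (scale y p) (rvv (x ^ n * y ^ (m + 1)) qt) *
          (gram L (scale y p) (rvv (x ^ n * y ^ (m + 1)) qt))ᴴ) 0 0 = h) : h < 1 := by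
  have hn := topVec_norm hL hx hy hp hqt hψ le_sup_left
  have hl := topVec_lead hL hx hy hp hqt hψ.inn 0
  set D := topVec L y p (rvv (x ^ n * y ^ (m + 1)) qt) ψ
  have hV : box x y (n + 1) (m + 2) ⊔ box x y (n + 2) (m + 1) ≤ box x y (n + 2) (m + 2) :=
    sup_le (box_mono (Nat.le_succ _) le_rfl) (box_mono le_rfl (Nat.le_succ _))
  have hD : D 0 ∈ box x y (n + 2) (m + 2) := by
    have := Submodule.add_mem _ (hV hl) (Submodule.smul_mem _ (Tp 0 0)
      (mem_box (x := x) (y := y) (N := n + 2) (M := m + 2) (i := n + 1) (j := m + 1)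
        (Nat.lt_succ_self _) (Nat.lt_succ_self _)))
    rwa [sub_add_cancel] at this
  -- Otherwise the corner monomial would lie in the sum of the two boxes, and so would τ, a unit
  -- vector orthogonal to that sum.
  have hD0 : D 0 ≠ 0 := by
    intro h0
    obtain ⟨t, _, ht⟩ := hτ.lead
    rw [h0, zero_sub, Submodule.neg_mem_iff] at hl
    have he := (Submodule.smul_mem_iff _ (hp.ut.diag_ne_zero 0)).1 hl
    have hτV := Submodule.add_mem _ ht (Submodule.smul_mem _ t he)
    rw [sub_add_cancel] at hτV
    have := hτ.norm
    rw [hτ.perp τ hτV] at this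
    exact zero_ne_one this
  have h1 := hPD _ hD hD0
  have h2 := congrFun (congrFun hn 0) 0
  rw [Matrix.sub_apply, hh, gram_apply, Matrix.one_apply_eq] at h2
  rw [h2, Complex.sub_re, Complex.one_re, Complex.ofReal_re] at h1
  linarith

end step

end Bicircle
end

noncomputable section
namespace Bicircle

variable {L : BiLaurent →ₗ[ℂ] ℂ} {k l j : ℕ} {n m N M : ℕ}

/-! ### The constructed levels agree with the functional -/

/-- The variable `z`. -/
def zz : BiLaurent := mono 1 0

/-- The variable `w`. -/
def ww : BiLaurent := mono 0 1

theorem isUni_zz : IsUni zz := isUni_mono 1 0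

theorem isUni_ww : IsUni ww := isUni_mono 0 1

theorem zz_pow_mul_ww_pow (i j : ℕ) : zz ^ i * ww ^ j = mono i j := by
  simp [zz, ww, mono_pow, mono_mul_mono]

theorem rev_eq (n m : ℕ) (V : Fin k → BiLaurent) : rev n m V = rvv (zz ^ n * ww ^ m) V := by
  rw [zz_pow_mul_ww_pow]
  rfl

theorem coeff_mono (i j : ℤ) (a : ℤ × ℤ) :
    (mono i j).coeff a = if (i, j) = a then 1 else 0 := by
  simp [mono, Finsupp.single_apply]

theorem coeff_box_eq_zero {p : BiLaurent} (hp : p ∈ box zz ww N M) {a : ℤ × ℤ}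
    (ha : (N : ℤ) ≤ a.1 ∨ (M : ℤ) ≤ a.2) : p.coeff a = 0 := by
  induction hp using Submodule.span_induction with
  | mem p hp =>
    obtain ⟨i, hi, j, hj, rfl⟩ := hp
    rw [zz_pow_mul_ww_pow, coeff_mono, if_neg]
    rintro rfl
    simp only at ha
    omega
  | zero => simp
  | add p q _ _ hp hq => simp [hp, hq]
  | smul c p _ hp => simp [hp]

theorem IsLex.coeff_eq {Φ : Fin (m + 1) → BiLaurent} {T : Matrix (Fin (m + 1)) (Fin (m + 1)) ℂ}
    (h : IsLex L zz ww n (m + 1) Φ T) (i j : Fin (m + 1)) :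
    (Φ i).coeff ((n : ℤ), (m : ℤ) - (j : ℕ)) = T i j := by
  have h1 := coeff_box_eq_zero (h.lead i) (a := ((n : ℤ), (m : ℤ) - (j : ℕ))) (Or.inl le_rfl)
  rw [Pi.sub_apply, AddMonoidAlgebra.coeff_sub, Finsupp.sub_apply, sub_eq_zero] at h1
  rw [h1, act_apply, AddMonoidAlgebra.coeff_sum, Finsupp.finsetSum_apply,
    Finset.sum_eq_single j]
  · have : ((m : ℤ) - (j : ℕ)) = ((j.rev : ℕ) : ℤ) := by
      rw [Fin.val_rev]
      omega
    simp [monoVec, zz_pow_mul_ww_pow, coeff_mono, this]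
  · intro b _ hb
    have h2 := Fin.val_ne_of_ne hb
    simp [monoVec, zz_pow_mul_ww_pow, coeff_mono]
    omega
  · simp

theorem IsLex.coeff_eq_t {Φ : Fin (n + 1) → BiLaurent} {T : Matrix (Fin (n + 1)) (Fin (n + 1)) ℂ}
    (h : IsLex L ww zz m (n + 1) Φ T) (i j : Fin (n + 1)) :
    (Φ i).coeff ((n : ℤ) - (j : ℕ), (m : ℤ)) = T i j := by
  have h0 := h.lead i
  rw [box_swap] at h0
  have h1 := coeff_box_eq_zero h0 (a := ((n : ℤ) - (j : ℕ), (m : ℤ))) (Or.inr le_rfl)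
  rw [Pi.sub_apply, AddMonoidAlgebra.coeff_sub, Finsupp.sub_apply, sub_eq_zero] at h1
  rw [h1, act_apply, AddMonoidAlgebra.coeff_sum, Finsupp.finsetSum_apply,
    Finset.sum_eq_single j]
  · have : ((n : ℤ) - (j : ℕ)) = ((j.rev : ℕ) : ℤ) := by
      rw [Fin.val_rev]
      omega
    simp [monoVec, mul_comm (ww ^ _), zz_pow_mul_ww_pow, coeff_mono, this]
  · intro b _ hb
    have h2 := Fin.val_ne_of_ne hb
    simp [monoVec, mul_comm (ww ^ _), zz_pow_mul_ww_pow, coeff_mono]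
    omega
  · simp

theorem IsLex.lead_eq {l : Level n m} {T : Matrix (Fin (m + 1)) (Fin (m + 1)) ℂ}
    (h : IsLex L zz ww n (m + 1) l.Φ T) : IsLex L zz ww n (m + 1) l.Φ l.lead := by
  have : l.lead = T := Matrix.ext fun i j => h.coeff_eq i j
  rwa [this]

theorem IsLex.leadt_eq {l : Level n m} {T : Matrix (Fin (n + 1)) (Fin (n + 1)) ℂ}
    (h : IsLex L ww zz m (n + 1) l.Φt T) : IsLex L ww zz m (n + 1) l.Φt l.leadt := by
  have : l.leadt = T := Matrix.ext fun i j => h.coeff_eq_t i j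
  rwa [this]

/-- The vector of the last `M` polynomials in the box `(n + 1) × M`. -/
def fs (u : ℤ → ℤ → ℂ) (n : ℕ) : (M : ℕ) → Fin M → BiLaurent
  | 0 => Fin.elim0
  | m + 1 => (level u n m).Φ

/-- The vector of the last `N` polynomials in the box `N × (m + 1)`. -/
def fts (u : ℤ → ℤ → ℂ) (m : ℕ) : (N : ℕ) → Fin N → BiLaurent
  | 0 => Fin.elim0
  | n + 1 => (level u n m).Φt

/-- The constructed data on the level `(n, m)` are the ones that belong to `L`. -/
structure Good (u : ℤ → ℤ → ℂ) (L : BiLaurent →ₗ[ℂ] ℂ) (n m : ℕ) : Prop where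
  lex : IsLex L zz ww n (m + 1) (level u n m).Φ (level u n m).lead
  lext : IsLex L ww zz m (n + 1) (level u n m).Φt (level u n m).leadt
  pd : PD L (box zz ww (n + 1) (m + 1))
  E : ∀ k, n = k + 1 → (level u n m).E =
    gram L (scale zz (fs u k (m + 1))) (rvv (zz ^ k * ww ^ m) (fs u k (m + 1)))
  A : ∀ k, n = k + 1 → (level u n m).A = gram L (scale zz (fs u k (m + 1))) (level u n m).Φ
  Et : ∀ k, m = k + 1 → (level u n m).Et =
    gram L (scale ww (fts u k (n + 1))) (rvv (zz ^ n * ww ^ k) (fts u k (n + 1)))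
  At : ∀ k, m = k + 1 → (level u n m).At = gram L (scale ww (fts u k (n + 1))) (level u n m).Φt
  K : (level u n m).K = gram L (fs u n m) (fts u m n)
  K1 : (level u n m).K1 =
    gram L (scale (zz * ww) (fs u n m)) (rvv (zz ^ n * ww ^ m) (fts u m n))
  G : (level u n m).G = gram L (fs u n m) (level u n m).Φ
  G1 : (level u n m).G1 = gram L (scale ww (fs u n m)) (level u n m).Φ
  Gt : (level u n m).Gt = gram L (fts u m n) (level u n m).Φt
  Gt1 : (level u n m).Gt1 = gram L (scale zz (fts u m n)) (level u n m).Φt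
  I : (level u n m).I = gram L (level u n m).Φ (level u n m).Φt
  I1 : (level u n m).I1 = gram L (rvv (zz ^ n * ww ^ m) (level u n m).Φ) (level u n m).Φt
  I_row : ∀ b, (level u n m).I 0 b = if b = 0 then 1 else 0
  I_col : ∀ a, (level u n m).I a 0 = if a = 0 then 1 else 0

variable {u : ℤ → ℤ → ℂ}

theorem fs_lex (h : ∀ m < M, Good u L n m) : ∃ T, IsLex L zz ww n M (fs u n M) T := by
  obtain _ | m := M
  · exact ⟨0, isLex_empty _ _⟩
  · exact ⟨_, (h m (Nat.lt_succ_self m)).lex⟩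

theorem fts_lex (h : ∀ n < N, Good u L n m) : ∃ T, IsLex L ww zz m N (fts u m N) T := by
  obtain _ | n := N
  · exact ⟨0, isLex_empty _ _⟩
  · exact ⟨_, (h n (Nat.lt_succ_self n)).lext⟩

namespace Good

theorem E_succ (h : Good u L (n + 1) m) : (level u (n + 1) m).E =
    gram L (scale zz (level u n m).Φ) (rvv (zz ^ n * ww ^ m) (level u n m).Φ) := h.E n rfl

theorem A_succ (h : Good u L (n + 1) m) : (level u (n + 1) m).A =
    gram L (scale zz (level u n m).Φ) (level u (n + 1) m).Φ := h.A n rfl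

theorem Et_succ (h : Good u L n (m + 1)) : (level u n (m + 1)).Et =
    gram L (scale ww (level u n m).Φt) (rvv (zz ^ n * ww ^ m) (level u n m).Φt) := h.Et m rfl

theorem At_succ (h : Good u L n (m + 1)) : (level u n (m + 1)).At =
    gram L (scale ww (level u n m).Φt) (level u n (m + 1)).Φt := h.At m rfl

theorem K_right (h : Good u L (n + 1) m) : (level u (n + 1) m).K =
    gram L (fs u (n + 1) m) (level u n m).Φt := h.K

theorem K1_right (h : Good u L (n + 1) m) : (level u (n + 1) m).K1 =
    gram L (scale (zz * ww) (fs u (n + 1) m)) (rvv (zz ^ (n + 1) * ww ^ m) (level u n m).Φt) := h.K1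

theorem K_up (h : Good u L n (m + 1)) : (level u n (m + 1)).K =
    gram L (level u n m).Φ (fts u (m + 1) n) := h.K

theorem K1_up (h : Good u L n (m + 1)) : (level u n (m + 1)).K1 =
    gram L (scale (zz * ww) (level u n m).Φ) (rvv (zz ^ n * ww ^ (m + 1)) (fts u (m + 1) n)) := h.K1

theorem G_up (h : Good u L n (m + 1)) : (level u n (m + 1)).G =
    gram L (level u n m).Φ (level u n (m + 1)).Φ := h.G

theorem G1_up (h : Good u L n (m + 1)) : (level u n (m + 1)).G1 =
    gram L (scale ww (level u n m).Φ) (level u n (m + 1)).Φ := h.G1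

theorem Gt_right (h : Good u L (n + 1) m) : (level u (n + 1) m).Gt =
    gram L (level u n m).Φt (level u (n + 1) m).Φt := h.Gt

theorem Gt1_right (h : Good u L (n + 1) m) : (level u (n + 1) m).Gt1 =
    gram L (scale zz (level u n m).Φt) (level u (n + 1) m).Φt := h.Gt1

end Good

/-- `K_rows` and `K_cols` determine the normalised matrix X except for its corner, and the
hypothesis on the functional supplies the corner. The inverses in the construction make sense
because Γ1 and Γt1 carry the leading matrices to those of the neighbouring levels. -/
theorem stepK_eq (hL : Herm L) (hP : Good u L (n + 1) m) (hQ : Good u L n (m + 1))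
    (hR : Good u L n m) (hp' : ∃ T, IsLex L zz ww (n + 1) m (fs u (n + 1) m) T)
    (hq't : ∃ T, IsLex L ww zz (m + 1) n (fts u (m + 1) n) T)
    (hlast : L ((level u (n + 1) m).Φ (Fin.last m) *
        dagger ((level u n (m + 1)).Φt (Fin.last n))) =
      stepK u n m (level u (n + 1) m) (level u n (m + 1)) (Fin.last m) (Fin.last n)) :
    stepK u n m (level u (n + 1) m) (level u n (m + 1)) =
      gram L (level u (n + 1) m).Φ (level u n (m + 1)).Φt := by
  -- On level (1, 1) the parameter is the scalar K itself, not its normalisation; here the corner is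
  -- the whole matrix.
  by_cases h0 : n = 0 ∧ m = 0
  · obtain ⟨rfl, rfl⟩ := h0
    ext a b
    obtain rfl : a = Fin.last 0 := Fin.ext (by omega)
    obtain rfl : b = Fin.last 0 := Fin.ext (by omega)
    exact hlast.symm
  obtain ⟨Tp', hp'⟩ := hp'
  obtain ⟨Tq't, hq't⟩ := hq't
  have hr := K_rows hL isUni_zz isUni_ww hP.lex hp' hQ.lext hR.lext
  have hc := K_cols hL isUni_zz isUni_ww hP.lex hR.lex hQ.lext hq't
  rw [← hP.G1, ← hP.K_right, ← hQ.At_succ, ← hQ.Et_succ, ← hP.K1_right] at hr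
  rw [← hQ.Gt1, ← hQ.K_up, ← hP.A_succ, ← hP.E_succ, ← hQ.K1_up] at hc
  have hG1 := hp'.G1_mul_lead hL isUni_ww hP.lex
  have hG1' := hp'.G1_lead_U1 hL isUni_ww hP.lex
  have hGt1 := hq't.G1_mul_lead hL isUni_zz hQ.lext
  have hGt1' := hq't.G1_lead_U1 hL isUni_zz hQ.lext
  rw [← hP.G1] at hG1 hG1'
  rw [← hQ.Gt1] at hGt1 hGt1'
  rw [stepK, if_neg h0] at hlast ⊢
  have hA := hP.lex.ut
  have hB := hQ.lext.ut
  have hBH : IsUnit ((level u n (m + 1)).leadtᴴ).det := by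
    rw [Matrix.det_conjTranspose]
    exact hB.isUnit_det.star
  have hTH : IsUnit (Tq'tᴴ).det := by
    rw [Matrix.det_conjTranspose]
    exact hq't.ut.isUnit_det.star
  symm
  refine K_eq_of_last hA hB hlast ?_ fun b => ?_
  · rw [Matrix.mul_add, Matrix.mul_add, ← Matrix.mul_assoc (shiftU1 m) (shiftU1 m)ᵀ,
      shiftU1_mul_transpose, Matrix.one_mul]
    have e1 : ∀ {q : ℕ} (c : Fin q) (s : ℂ), shiftU1 m * Matrix.single (Fin.last m) c s = 0 := by
      intro q c s
      ext a b
      rw [shiftU1_mul, Matrix.of_apply, Matrix.single_apply_of_row_ne (Fin.castSucc_lt_last a).ne']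
      rfl
    have e3 : ∀ Z : Matrix (Fin (m + 1)) (Fin n) ℂ,
        shiftU1 m * (Matrix.single (Fin.last m) (Fin.last m) (1 : ℂ) * Z * shiftU1 n) = 0 :=
      fun Z => by
        rw [← Matrix.mul_assoc, ← Matrix.mul_assoc, e1, Matrix.zero_mul, Matrix.zero_mul]
    rw [e1, e3, zero_add, add_zero, ← hr, hG1', ← Matrix.mul_assoc, ← Matrix.mul_assoc]
    congr 1
    have e2 : (level u (n + 1) m).G1 = Tp' * (shiftU1 m * (level u (n + 1) m).lead⁻¹) := by
      rw [← Matrix.mul_assoc, ← hG1, Matrix.mul_assoc, hA.mul_inv_self, Matrix.mul_one]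
    rw [e2, ← Matrix.mul_assoc Tp'⁻¹, ← Matrix.mul_assoc Tp'⁻¹, hp'.ut.inv_mul_self,
      Matrix.one_mul]
  · have e0 : ∀ Z : Matrix (Fin (m + 1)) (Fin (n + 1)) ℂ, Z (Fin.last m) b.castSucc =
        (Z * (shiftU1 n)ᵀ) (Fin.last m) b := fun Z => by
      rw [mul_shiftU1_transpose]
      rfl
    have e1 : (level u n (m + 1)).Gt1ᴴ =
        (level u n (m + 1)).leadtᴴ⁻¹ * (shiftU1 n)ᵀ * Tq'tᴴ := by
      have := congrArg Matrix.conjTranspose hGt1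
      have e3 : (shiftU1 n)ᴴ = (shiftU1 n)ᵀ := by
        ext a b
        simp [shiftU1, apply_ite]
      rw [Matrix.conjTranspose_mul, Matrix.conjTranspose_mul, e3] at this
      rw [Matrix.mul_assoc, ← this, ← Matrix.mul_assoc, Matrix.nonsing_inv_mul _ hBH,
        Matrix.one_mul]
    have e2 : gram L (level u (n + 1) m).Φ (level u n (m + 1)).Φt *
        (level u n (m + 1)).leadtᴴ⁻¹ * (shiftU1 n)ᵀ =
        ((level u (n + 1) m).A⁻¹ * (level u n (m + 1)).K -
          (level u (n + 1) m).A⁻¹ * (level u (n + 1) m).E * cj (level u n (m + 1)).K1) *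
          (Tq'tᴴ)⁻¹ := by
      rw [← hc, e1, Matrix.mul_assoc _ _ (_⁻¹), Matrix.mul_assoc _ _ (_⁻¹),
        Matrix.mul_nonsing_inv _ hTH, Matrix.mul_one, ← Matrix.mul_assoc]
    refine (e0 _).trans ?_
    rw [Matrix.mul_assoc, Matrix.mul_assoc, ← Matrix.mul_assoc (gram L _ _), e2, hGt1',
      Matrix.add_apply, Matrix.add_apply, Matrix.single_apply_of_col_ne _ _
        (Fin.castSucc_lt_last b).ne', zero_add]
    have e5 : ∀ {r : ℕ} (Z : Matrix (Fin m) (Fin r) ℂ) (c : Fin r),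
        ((shiftU1 m)ᵀ * Z) (Fin.last m) c = 0 := by
      intro r Z c
      rw [Matrix.mul_apply]
      refine Finset.sum_eq_zero fun d _ => ?_
      simp [shiftU1, (Fin.castSucc_lt_last d).ne']
    rw [e5, zero_add, mul_shiftU1_castSucc, Matrix.single_mul_apply_same, one_mul]
    simp only [Matrix.mul_assoc]

/-- `K1_rows` gives the rows below the first and `K1_cols` the rest of the first row; no leading
matrices enter, so the remaining (1,1) entry is prescribed directly. -/
theorem stepK1_eq (hL : Herm L) (hP : Good u L (n + 1) m) (hQ : Good u L n (m + 1))
    (hR : Good u L n m) (hp' : ∃ T, IsLex L zz ww (n + 1) m (fs u (n + 1) m) T)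
    (hq't : ∃ T, IsLex L ww zz (m + 1) n (fts u (m + 1) n) T)
    (hfirst : L ((scale (zz * ww) (level u (n + 1) m).Φ) 0 *
        dagger ((rvv (zz ^ (n + 1) * ww ^ (m + 1)) (level u n (m + 1)).Φt) 0)) =
      stepK1 u n m (level u (n + 1) m) (level u n (m + 1)) 0 0) :
    stepK1 u n m (level u (n + 1) m) (level u n (m + 1)) =
      gram L (scale (zz * ww) (level u (n + 1) m).Φ)
        (rvv (zz ^ (n + 1) * ww ^ (m + 1)) (level u n (m + 1)).Φt) := by
  obtain ⟨Tp', hp'⟩ := hp'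
  obtain ⟨Tq't, hq't⟩ := hq't
  have hr := K1_rows hL isUni_zz isUni_ww hP.lex hp' hQ.lext hR.lext
  have hc := K1_cols hL isUni_zz isUni_ww hP.lex hR.lex hQ.lext hq't
  rw [← hP.G, ← hP.K_right, ← hQ.At_succ, ← hQ.Et_succ, ← hP.K1_right] at hr
  rw [← hQ.Gt, ← hQ.K_up, ← hP.A_succ, ← hP.E_succ, ← hQ.K1_up] at hc
  ext a b
  refine Fin.cases ?_ (fun a => ?_) a
  · refine Fin.cases hfirst.symm (fun b => ?_) b
    have h1 := congrFun (congrFun hc 0) b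
    rw [mul_shiftU_transpose, Matrix.of_apply] at h1
    rw [h1, stepK1, Matrix.add_apply, Matrix.add_apply,
      Matrix.single_apply_of_col_ne _ _ (Fin.succ_ne_zero b).symm, zero_add, mul_shiftU_succ, corner,
      Matrix.single_mul_apply_same, one_mul, Matrix.mul_apply,
      Finset.sum_eq_zero fun d _ => by simp [shiftU, (Fin.succ_ne_zero d).symm], zero_add]
  · have h1 := congrFun (congrFun hr a) b
    rw [shiftU_mul, Matrix.of_apply] at h1
    rw [h1, stepK1, Matrix.add_apply, Matrix.add_apply,
      Matrix.single_apply_of_row_ne (Fin.succ_ne_zero a).symm, zero_add, Matrix.mul_assoc (corner _ _),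
      corner, Matrix.single_mul_apply_of_ne _ _ _ _ _ (Fin.succ_ne_zero a), add_zero,
      Matrix.mul_apply, Finset.sum_eq_single a]
    · simp [shiftU]
    · intro d _ hd
      simp [shiftU, hd.symm]
    · simp

end Bicircle
end

/-! ### The induction step off the axes -/

noncomputable section
namespace Bicircle

variable {L : BiLaurent →ₗ[ℂ] ℂ} {x y : BiLaurent} {n m : ℕ}

theorem IsTop.swap {τ : BiLaurent}
    (h : IsTop L (box x y (n + 1) (m + 2) ⊔ box x y (n + 2) (m + 1))
      (x ^ (n + 1) * y ^ (m + 1)) τ) :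
    IsTop L (box y x (m + 1) (n + 2) ⊔ box y x (m + 2) (n + 1))
      (y ^ (m + 1) * x ^ (n + 1)) τ := by
  rwa [box_swap y x, box_swap y x, sup_comm, mul_comm]

section next

variable {p : Fin (m + 1) → BiLaurent} {p' : Fin m → BiLaurent}
  {qt rt : Fin (n + 1) → BiLaurent} {pt : Fin (n + 2) → BiLaurent}
  {Tp B : Matrix (Fin (m + 1)) (Fin (m + 1)) ℂ} {Tp' : Matrix (Fin m) (Fin m) ℂ}
  {Tqt Trt : Matrix (Fin (n + 1)) (Fin (n + 1)) ℂ} {Tpt : Matrix (Fin (n + 2)) (Fin (n + 2)) ℂ}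
  {τ : BiLaurent}

theorem next_lex (hL : Herm L) (hp : IsLex L x y (n + 1) (m + 1) p Tp)
    (hqt : IsLex L y x (m + 1) (n + 1) qt Tqt)
    (hB : UT B) (hK : 1 - gram L p qt * (gram L p qt)ᴴ = B * Bᴴ)
    (hτ : IsTop L (box x y (n + 1) (m + 2) ⊔ box x y (n + 2) (m + 1))
      (x ^ (n + 1) * y ^ (m + 1)) τ) :
    ∃ T, IsLex L x y (n + 1) (m + 2)
      (Fin.cons τ (psi B (gram L p qt) p qt) : Fin (m + 2) → BiLaurent) T := by
  have hψ := psi_comp hL hp hqt hB hK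
  exact IsLex.cons hL (hB.inv.mul hp.ut) (psi_lead hp hqt _) hψ.perp hψ.norm hψ.inn hτ

theorem next_G (hL : Herm L) (hp : IsLex L x y (n + 1) (m + 1) p Tp)
    (hqt : IsLex L y x (m + 1) (n + 1) qt Tqt)
    (hB : UT B) (hK : 1 - gram L p qt * (gram L p qt)ᴴ = B * Bᴴ)
    (hτ : IsTop L (box x y (n + 1) (m + 2) ⊔ box x y (n + 2) (m + 1))
      (x ^ (n + 1) * y ^ (m + 1)) τ) :
    gram L p (Fin.cons τ (psi B (gram L p qt) p qt) : Fin (m + 2) → BiLaurent) =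
      B * shiftU (m + 1) := by
  rw [gram_cons_eq_zero _ _ _ fun a => hτ.gram_eq_zero hL (Submodule.mem_sup_right (hp.inn a)),
    gram_p_psi hL hp hqt hB hK]

theorem next_G1 (hL : Herm L) (hx : IsUni x) (hy : IsUni y)
    (hp : IsLex L x y (n + 1) (m + 1) p Tp) (hp' : IsLex L x y (n + 1) m p' Tp')
    (hqt : IsLex L y x (m + 1) (n + 1) qt Tqt) (hrt : IsLex L y x m (n + 1) rt Trt)
    (hpt : IsLex L y x m (n + 2) pt Tpt)
    (hB : UT B) (hK : 1 - gram L p qt * (gram L p qt)ᴴ = B * Bᴴ) {h : ℝ}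
    (hτ : ∀ a, L (scale y p a * dagger τ) = if a = 0 then ((Real.sqrt (1 - h) : ℝ) : ℂ) else 0) :
    gram L (scale y p) (Fin.cons τ (psi B (gram L p qt) p qt) : Fin (m + 2) → BiLaurent) =
      formulaG1 h (formulaG1U (gram L p pt) (gram L (rvv (x ^ (n + 1) * y ^ m) p) pt)
        (gram L (scale y pt) (rvv (x ^ (n + 1) * y ^ m) pt)) (gram L p' p)
        (gram L (scale y p') p) (gram L (scale y rt) qt)
        (gram L (scale y rt) (rvv (x ^ n * y ^ m) rt)) (gram L p qt)
        (gram L (scale (x * y) p) (rvv (x ^ (n + 1) * y ^ (m + 1)) qt))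
        (B * shiftU (m + 1))) := by
  rw [gram_cons_eq _ _ _ _ hτ, gram_scale_psi hL hx hy hp hp' hqt hrt hpt hB hK, formulaG1]

end next

section step

variable {u : ℤ → ℤ → ℂ}

open scoped Matrix.Norms.L2Operator in
-- Orthonormal systems φ and φt on the new level are built from the functional, as a common top
-- polynomial above normalised remainders of p and qt. Each constructed matrix is then shown to be
-- the corresponding inner product, and finally the recurrences reproduce φ and φt.
theorem good_step (hu : Admissible u) (hL : Herm L) (hP : Good u L (n + 1) m)
    (hQ : Good u L n (m + 1)) (hR : Good u L n m)
    (hp' : ∃ T, IsLex L zz ww (n + 1) m (fs u (n + 1) m) T)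
    (hq't : ∃ T, IsLex L ww zz (m + 1) n (fts u (m + 1) n) T)
    (hlast : L ((level u (n + 1) m).Φ (Fin.last m) *
        dagger ((level u n (m + 1)).Φt (Fin.last n))) =
      stepK u n m (level u (n + 1) m) (level u n (m + 1)) (Fin.last m) (Fin.last n))
    (hfirst : L ((scale (zz * ww) (level u (n + 1) m).Φ) 0 *
        dagger ((rvv (zz ^ (n + 1) * ww ^ (m + 1)) (level u n (m + 1)).Φt) 0)) =
      stepK1 u n m (level u (n + 1) m) (level u n (m + 1)) 0 0) :
    Good u L (n + 1) (m + 1) := by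
  have eK := stepK_eq hL hP hQ hR hp' hq't hlast
  have eK1 := stepK1_eq hL hP hQ hR hp' hq't hfirst
  obtain ⟨Tp', hp'⟩ := hp'
  obtain ⟨Tq't, hq't⟩ := hq't
  have hx := isUni_zz
  have hy := isUni_ww
  have hp := hP.lex
  have hpt := hP.lext
  have hq := hQ.lex
  have hqt := hQ.lext
  have hr := hR.lex
  have hrt := hR.lext
  have hcon := hu.contraction n m
  have hsch := hu.schur n m
  set l := level u (n + 1) (m + 1) with hl
  have hl' : l = levelStep u n m (level u (n + 1) m) (level u n (m + 1)) := rfl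
  have lK : l.K = gram L (level u (n + 1) m).Φ (level u n (m + 1)).Φt := eK
  have lK1 : l.K1 = gram L (scale (zz * ww) (level u (n + 1) m).Φ)
    (rvv (zz ^ (n + 1) * ww ^ (m + 1)) (level u n (m + 1)).Φt) := eK1
  have lKH : l.Kᴴ = gram L (level u n (m + 1)).Φt (level u (n + 1) m).Φ := by
    rw [lK, gram_conjTranspose hL]
  have lK1T : l.K1ᵀ = gram L (scale (ww * zz) (level u n (m + 1)).Φt)
      (rvv (ww ^ (m + 1) * zz ^ (n + 1)) (level u (n + 1) m).Φ) := by
    rw [lK1, gram_scale_rvv_transpose, mul_comm zz, mul_comm (zz ^ _)]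
  obtain ⟨B, hB, hK⟩ := exists_cholesky_of_norm_lt_one hcon
  obtain ⟨Bt, hBt, hKt⟩ := exists_cholesky_of_norm_lt_one (K := l.Kᴴ) (by
    rwa [Matrix.l2_opNorm_conjTranspose])
  have lG : l.G = B * shiftU (m + 1) := by
    have : l.G = upperCholesky (1 - l.K * l.Kᴴ) * shiftU (m + 1) := rfl
    rw [this, upperCholesky_eq hB hK]
  have lGt : l.Gt = Bt * shiftU (n + 1) := by
    have : l.Gt = upperCholesky (1 - l.Kᴴ * l.K) * shiftU (n + 1) := rfl
    rw [Matrix.conjTranspose_conjTranspose] at hKt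
    rw [this, upperCholesky_eq hBt hKt]
  rw [lK] at hK
  rw [lKH] at hKt
  have lI : (level u (n + 1) m).Iᴴ =
      gram L (level u (n + 1) m).Φt (level u (n + 1) m).Φ := by
    rw [hP.I, gram_conjTranspose hL]
  have lI1 : (level u (n + 1) m).I1ᵀ = gram L (rvv (ww ^ m * zz ^ (n + 1)) (level u (n + 1) m).Φt)
      (level u (n + 1) m).Φ := by
    rw [hP.I1, gram_rvv_transpose, mul_comm]
  have lE : l.E = gram L (scale zz (level u n (m + 1)).Φ)
      (rvv (zz ^ n * ww ^ (m + 1)) (level u n (m + 1)).Φ) := by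
    have : l.E = formulaE (level u (n + 1) m).A (level u (n + 1) m).E l.K l.K1
      (level u n (m + 1)).I (level u n (m + 1)).I1 (level u n (m + 1)).G
      (level u n (m + 1)).G1 := rfl
    rw [this, hP.A_succ, hP.E_succ, lK, lK1, hQ.I, hQ.I1, hQ.G_up, hQ.G1_up]
    exact formulaE_eq hL hx hy hp hq hr hqt
  have lEt : l.Et = gram L (scale ww (level u (n + 1) m).Φt)
      (rvv (ww ^ m * zz ^ (n + 1)) (level u (n + 1) m).Φt) := by
    have : l.Et = formulaE (level u n (m + 1)).At (level u n (m + 1)).Et l.Kᴴ l.K1ᵀ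
      (level u (n + 1) m).Iᴴ (level u (n + 1) m).I1ᵀ (level u (n + 1) m).Gt
      (level u (n + 1) m).Gt1 := rfl
    rw [this, hQ.At_succ, hQ.Et_succ, lKH, lK1T, lI, lI1, hP.Gt_right, hP.Gt1_right,
      mul_comm (zz ^ n)]
    exact formulaE_eq hL hy hx hqt hpt hrt hp
  have lH := formulaH3_apply hL hx hy hp hp' hqt hrt hpt (fun b => by rw [← hP.I]; exact hP.I_row b)
    (fun a => by rw [← hP.I]; exact hP.I_col a) hB hK
  have lH3 : l.H3 = formulaH3 (level u (n + 1) m).I (level u (n + 1) m).I1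
    (level u n (m + 1)).At (level u n (m + 1)).Et (level u (n + 1) m).Gt (level u (n + 1) m).Gt1
    l.K l.K1 l.G := rfl
  rw [hP.I, hP.I1, hQ.At_succ, hQ.Et_succ, hP.Gt_right, hP.Gt1_right, lK, lK1, lG] at lH3
  rw [← lH3] at lH
  have hψ := psi_comp hL hp hqt hB hK
  have hψt := psi_comp hL hqt hp hBt hKt
  -- The Schur condition enters here: it makes the distance of the new direction from the sum of the
  -- smaller boxes positive.
  obtain ⟨τ, hτ, hτg⟩ := exists_top hL hx hy hp hqt hψ hsch lH
  obtain ⟨T, hφ⟩ := next_lex hL hp hqt hB hK hτ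
  obtain ⟨Tt, hφt⟩ := next_lex hL hqt hp hBt hKt hτ.swap
  have gG := next_G hL hp hqt hB hK hτ
  have gGt := next_G hL hqt hp hBt hKt hτ.swap
  have gG1 := next_G1 hL hx hy hp hp' hqt hrt hpt hB hK hτg
  -- Adjoining φ to the box of level (n, m+1), where the form is positive definite, fills the new
  -- box.
  have hPD : PD L (box zz ww (n + 2) (m + 2)) := hφ.comp.pd hL hQ.pd
  have hQI : ∀ a b, gram L (level u n (m + 1)).Φt (level u n (m + 1)).Φ a b =
      star ((level u n (m + 1)).I b a) := fun a b => by
    rw [hQ.I, ← gram_conjTranspose hL]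
    rfl
  have lHt := formulaH3_apply hL hy hx hqt hq't hp hr hq
    (fun b => by rw [hQI, hQ.I_col, apply_ite star, star_one, star_zero])
    (fun a => by rw [hQI, hQ.I_row, apply_ite star, star_one, star_zero]) hBt hKt
  have hPDt := hPD
  rw [box_swap] at hPDt
  -- The tilde version of the Schur condition is no assumption; it follows from positive
  -- definiteness on the new box.
  have hscht := schur_lt_one hL hy hx hqt hp hψt hPDt hτ.swap lHt
  obtain ⟨σ, hσ, hσg⟩ := exists_top hL hy hx hqt hp hψt hscht lHt
  -- The top polynomials of the two orderings coincide, being unit vectors orthogonal to the same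
  -- space with positive corner coefficient. Therefore I has the first row and column of the
  -- identity.
  obtain rfl : σ = τ := IsTop.unique (hPDt.mono (sup_le
    (box_mono (Nat.le_succ _) le_rfl) (box_mono le_rfl (Nat.le_succ _)))) hσ hτ.swap
  have gGt1 := next_G1 hL hy hx hqt hq't hp hr hq hBt hKt hσg
  have gI := hτ.gram_cons_cons hL hψ.inn (χ := psi Bt (gram L (level u n (m + 1)).Φt
    (level u (n + 1) m).Φ) (level u n (m + 1)).Φt (level u (n + 1) m).Φ) (by
      have := hψt.inn
      rwa [box_swap ww zz, box_swap ww zz, sup_comm] at this)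
  set φ : Fin (m + 2) → BiLaurent := Fin.cons σ (psi B (gram L (level u (n + 1) m).Φ
    (level u n (m + 1)).Φt) (level u (n + 1) m).Φ (level u n (m + 1)).Φt) with hφ_def
  set φt : Fin (n + 2) → BiLaurent := Fin.cons σ (psi Bt (gram L (level u n (m + 1)).Φt
    (level u (n + 1) m).Φ) (level u n (m + 1)).Φt (level u (n + 1) m).Φ) with hφt_def
  have lA : l.A = gram L (scale zz (level u n (m + 1)).Φ) φ := by
    have : l.A = upperCholesky (1 - l.E * l.Eᴴ) := rfl
    rw [this, lE]
    exact A_eq_upperCholesky hL hx hy hq hφ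
  have lAt : l.At = gram L (scale ww (level u (n + 1) m).Φt) φt := by
    have : l.At = upperCholesky (1 - l.Et * l.Etᴴ) := rfl
    rw [this, lEt]
    exact A_eq_upperCholesky hL hy hx hpt hφt
  have lΦ : l.Φ = φ := by
    have : l.Φ = act l.A⁻¹ (scale zz (level u n (m + 1)).Φ -
      act l.E (rev n (m + 1) (level u n (m + 1)).Φ)) := rfl
    rw [this, rev_eq, lA, lE]
    exact formulaΦ_eq hL hx hy hq hφ hQ.pd
  have lΦt : l.Φt = φt := by
    have : l.Φt = act l.At⁻¹ (scale ww (level u (n + 1) m).Φt -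
      act l.Et (rev (n + 1) m (level u (n + 1) m).Φt)) := rfl
    rw [this, rev_eq, lAt, lEt, mul_comm (zz ^ _)]
    exact formulaΦ_eq hL hy hx hpt hφt (box_swap zz ww _ _ ▸ hP.pd)
  have lI' : l.I = gram L φ φt := by
    have : l.I = formulaI l.K l.G l.Gt := rfl
    rw [this, lK, lG, lGt, ← gG, ← gGt]
    exact formulaI_eq gI.2 (hqt.G_zero hL hφt) (hqt.GU_isUnit hL hφt)
      (I_mul_Gt hL hφ hφt hp hqt)
  refine
    { lex := (show IsLex L zz ww (n + 1) (m + 2) l.Φ T from lΦ ▸ hφ).lead_eq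
      lext := (show IsLex L ww zz (m + 1) (n + 2) l.Φt Tt from lΦt ▸ hφt).leadt_eq
      pd := hPD
      E := ?_
      A := ?_
      Et := ?_
      At := ?_
      K := lK
      K1 := lK1
      G := ?_
      G1 := ?_
      Gt := ?_
      Gt1 := ?_
      I := ?_
      I1 := ?_
      I_row := ?_
      I_col := ?_ }
  · rintro k hk
    obtain rfl := Nat.succ_injective hk
    exact lE
  · rintro k hk
    obtain rfl := Nat.succ_injective hk
    exact lA.trans (by rw [← lΦ]; rfl)
  · rintro k hk
    obtain rfl := Nat.succ_injective hk
    rw [mul_comm (zz ^ _)]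
    exact lEt
  · rintro k hk
    obtain rfl := Nat.succ_injective hk
    exact lAt.trans (by rw [← lΦt]; rfl)
  · rw [← hl, lG, ← gG, lΦ]
    rfl
  · have : l.G1 = formulaG1 (l.H3 0 0).re (formulaG1U (level u (n + 1) m).I (level u (n + 1) m).I1
      l.Et (level u (n + 1) m).G (level u (n + 1) m).G1 (level u n (m + 1)).At
      (level u n (m + 1)).Et l.K l.K1 l.G) := rfl
    rw [← hl, this, hP.I, hP.I1, lEt, hP.G, hP.G1, hQ.At_succ, hQ.Et_succ, lK, lK1, lG, lΦ,
      mul_comm (ww ^ m)]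
    exact gG1.symm
  · rw [← hl, lGt, ← gGt, lΦt]
    rfl
  · have : l.Gt1 = formulaG1 ((formulaH3 (level u n (m + 1)).Iᴴ (level u n (m + 1)).I1ᵀ
      (level u (n + 1) m).A (level u (n + 1) m).E (level u n (m + 1)).G (level u n (m + 1)).G1
      l.Kᴴ l.K1ᵀ l.Gt) 0 0).re (formulaG1U (level u n (m + 1)).Iᴴ (level u n (m + 1)).I1ᵀ
      l.E (level u n (m + 1)).Gt (level u n (m + 1)).Gt1 (level u (n + 1) m).A
      (level u (n + 1) m).E l.Kᴴ l.K1ᵀ l.Gt) := rfl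
    rw [← hl, this, hQ.I, hQ.I1, lE, hQ.Gt, hQ.Gt1, hP.A_succ, hP.E_succ, lKH, lK1T, lGt, lΦt,
      hQ.G_up, hQ.G1_up, gram_conjTranspose hL, gram_rvv_transpose, mul_comm (zz ^ n),
      mul_comm (zz ^ n)]
    exact gGt1.symm
  · rw [← hl, lΦ, lΦt]
    exact lI'
  · have : l.I1 = formulaI1 l.A l.E l.I (level u n (m + 1)).I1 l.Gt := rfl
    rw [← hl, this, lA, lE, lI', hQ.I1, lGt, ← gGt, lΦ, lΦt]
    exact (formulaI1_eq hL hx hy hq hqt hφ hφt).symm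
  · rw [← hl, lI']
    exact gI.1
  · rw [← hl, lI']
    exact gI.2

end step

end Bicircle
end

/-! ### The origin and the induction along the axes -/

noncomputable section
namespace Bicircle

variable {L : BiLaurent →ₗ[ℂ] ℂ} {x y : BiLaurent} {n m : ℕ} {u : ℤ → ℤ → ℂ}

theorem corner_act (q : ℕ) (φ : Fin 1 → BiLaurent) (qt : Fin q → BiLaurent) :
    act (corner 0 q)ᴴ φ + act (shiftU q)ᴴ qt = (Fin.cons (φ 0) qt : Fin (q + 1) → BiLaurent) := by
  funext b
  refine Fin.cases ?_ (fun b => ?_) b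
  · rw [Pi.add_apply, act_apply, act_apply, Finset.sum_eq_zero (s := Finset.univ (α := Fin q))]
    · simp [corner]
    · intro c _
      simp [shiftU, (Fin.succ_ne_zero c).symm]
  · rw [Pi.add_apply, act_apply, act_apply, Finset.sum_eq_single b (s := Finset.univ (α := Fin q))]
    · simp [corner, shiftU, (Fin.succ_ne_zero b).symm]
    · intro c _ hc
      simp [shiftU, hc.symm]
    · simp

theorem corner_row (q : ℕ) (b : Fin (q + 1)) : corner 0 q 0 b = if b = 0 then 1 else 0 := by
  simp [corner, Matrix.single_apply, eq_comm]

theorem corner_col (q : ℕ) (a : Fin 1) : corner 0 q a 0 = if a = 0 then 1 else 0 := by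
  obtain rfl : a = 0 := Subsingleton.elim _ _
  simp [corner]

theorem corner_conjTranspose (p q : ℕ) : (corner p q)ᴴ = corner q p := by
  rw [corner, Matrix.conjTranspose_single, star_one, corner]

theorem single_zero_eq (c : ℂ) : (AddMonoidAlgebra.single 0 c : BiLaurent) = c • 1 := by
  rw [AddMonoidAlgebra.one_def, AddMonoidAlgebra.smul_single, smul_eq_mul, mul_one]

theorem origin_lex {r : ℝ} (hr : 0 < r) (h1 : L 1 = (r : ℂ)) :
    IsLex L x y 0 1 (fun _ => AddMonoidAlgebra.single 0 ((1 / Real.sqrt r : ℝ) : ℂ))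
      (Matrix.of fun _ _ => ((1 / Real.sqrt r : ℝ) : ℂ)) where
  ut := by
    refine ⟨fun i j hij => ?_, fun i => ?_⟩
    · rw [Subsingleton.elim i j] at hij
      exact absurd hij (lt_irrefl _)
    · rw [Matrix.of_apply, Complex.ofReal_re, Complex.ofReal_im]
      exact ⟨by positivity, rfl⟩
  lead i := by
    rw [Pi.sub_apply, act_apply, single_zero_eq]
    simp [monoVec]
  perp i s hs := by
    rw [box_zero_left, Submodule.mem_bot] at hs
    rw [hs, dagger_zero, mul_zero, map_zero]
  norm := by
    ext i j
    rw [Subsingleton.elim j i, Matrix.one_apply_eq, gram_apply, single_zero_eq, dagger_smul,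
      dagger_one, smul_mul_smul_comm, map_smul, mul_one, h1, Complex.star_def, Complex.conj_ofReal,
      smul_eq_mul, ← Complex.ofReal_mul, ← Complex.ofReal_mul, ← Complex.ofReal_one]
    congr 1
    have := Real.sqrt_pos.2 hr
    field_simp
    exact (Real.sq_sqrt hr.le).symm

theorem good_origin (hL : Herm L) (h0 : 0 < (u 0 0).re ∧ (u 0 0).im = 0) (h1 : L 1 = u 0 0) :
    Good u L 0 0 := by
  have h1' : L 1 = ((u 0 0).re : ℂ) := by
    rw [h1]
    exact Complex.ext rfl h0.2
  have hφ := origin_lex (x := zz) (y := ww) h0.1 h1'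
  have hφt := origin_lex (x := ww) (y := zz) h0.1 h1'
  have e : gram L (level u 0 0).Φ (level u 0 0).Φt = 1 := hφ.norm
  refine
    { lex := IsLex.lead_eq (l := level u 0 0) hφ
      lext := IsLex.leadt_eq (l := level u 0 0) hφt
      pd := hφ.comp.pd hL ?_
      E := fun k hk => absurd hk (Nat.succ_ne_zero k).symm
      A := fun k hk => absurd hk (Nat.succ_ne_zero k).symm
      Et := fun k hk => absurd hk (Nat.succ_ne_zero k).symm
      At := fun k hk => absurd hk (Nat.succ_ne_zero k).symm
      K := Matrix.ext fun i => i.elim0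
      K1 := Matrix.ext fun i => i.elim0
      G := Matrix.ext fun i => i.elim0
      G1 := Matrix.ext fun i => i.elim0
      Gt := Matrix.ext fun i => i.elim0
      Gt1 := Matrix.ext fun i => i.elim0
      I := e.symm
      I1 := ?_
      I_row := fun b => ?_
      I_col := fun b => ?_ }
  · intro p hp hp0
    rw [box_zero_left, Submodule.mem_bot] at hp
    exact absurd hp hp0
  · have : rvv (zz ^ 0 * ww ^ 0) (level u 0 0).Φ = (level u 0 0).Φ := by
      funext a
      change (zz ^ 0 * ww ^ 0) * dagger (AddMonoidAlgebra.single 0 _) =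
        AddMonoidAlgebra.single 0 _
      rw [dagger_single, pow_zero, pow_zero, one_mul, one_mul, neg_zero, Complex.star_def,
        Complex.conj_ofReal]
    rw [this, e]
    rfl
  · obtain rfl : b = 0 := Subsingleton.elim (α := Fin 1) _ _
    rfl
  · obtain rfl : b = 0 := Subsingleton.elim (α := Fin 1) _ _
    rfl

/-- The prescribed value of the functional is exactly the reflection coefficient E, so this is the
one-variable Szegő recursion, with the data of the second ordering carried along. -/
theorem good_right (hu : Admissible u) (hL : Herm L) (hG : Good u L n 0)
    (hq : ∃ T, IsLex L ww zz 0 n (fts u 0 n) T)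
    (hval : L (scale zz (level u n 0).Φ 0 * dagger (rvv (zz ^ n * ww ^ 0) (level u n 0).Φ 0)) =
      u (n + 1) 0) : Good u L (n + 1) 0 := by
  obtain ⟨Tq, hq⟩ := hq
  have hx := isUni_zz
  have hy := isUni_ww
  set l := level u (n + 1) 0 with hl
  have he : ‖u (n + 1) 0‖ < 1 := hu.right n
  obtain ⟨hA, hAE⟩ := axis_cholesky he
  have lE : l.E = gram L (scale zz (level u n 0).Φ) (rvv (zz ^ n * ww ^ 0) (level u n 0).Φ) := by
    ext a b
    rw [Subsingleton.elim (α := Fin 1) a 0, Subsingleton.elim (α := Fin 1) b 0]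
    exact hval.symm
  have hE : (Matrix.of fun _ _ => u (n + 1) 0 : Matrix (Fin 1) (Fin 1) ℂ) = l.E := rfl
  rw [hE, lE] at hAE
  have hφ := hG.lex.step hL hx hy hA hAE
  have lA := hG.lex.step_A hx hA hAE
  have lΦ : l.Φ = act l.A⁻¹ (scale zz (level u n 0).Φ -
      act l.E (rev n 0 (level u n 0).Φ)) := rfl
  rw [rev_eq, lE] at lΦ
  replace lA : l.A = gram L (scale zz (level u n 0).Φ) l.Φ := by
    rw [lΦ]
    exact lA.symm
  replace hφ : IsLex L zz ww (n + 1) 1 l.Φ _ := lΦ ▸ hφ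
  have lΦt : l.Φt = Fin.cons (l.Φ 0) (level u n 0).Φt := corner_act _ _ _
  obtain ⟨Tt, hφt⟩ := axis_lex hL hφ hG.lext
  rw [← lΦt] at hφt
  have lI : l.I = gram L l.Φ l.Φt := by
    rw [lΦt, axis_I hL hφ hG.lext]
    rfl
  have lGt : l.Gt = gram L (level u n 0).Φt l.Φt := by
    rw [lΦt, axis_G hL hφ hG.lext]
    rfl
  -- The matrix on the left, which gives all columns of the new Γt1 but the first, is the matrix of
  -- multiplication by z on the old Φt.
  have lB : (level u n 0).Iᴴ * l.E * (level u n 0).I1 + (level u n 0).Gtᴴ * (level u n 0).Gt1 =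
      gram L (scale zz (level u n 0).Φt) (level u n 0).Φt := by
    rw [gram_scale_self hL hy hx hG.lext hq hG.lex, hG.I, hG.I1, lE, hG.Gt, hG.Gt1,
      gram_conjTranspose hL, gram_rvv_transpose, mul_comm (ww ^ 0)]
  refine
    { lex := hφ.lead_eq
      lext := hφt.leadt_eq
      pd := hφ.comp.pd hL hG.pd
      E := ?_
      A := ?_
      Et := fun k hk => absurd hk (Nat.succ_ne_zero k).symm
      At := fun k hk => absurd hk (Nat.succ_ne_zero k).symm
      K := Matrix.ext fun i => i.elim0
      K1 := Matrix.ext fun i => i.elim0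
      G := Matrix.ext fun i => i.elim0
      G1 := Matrix.ext fun i => i.elim0
      Gt := lGt
      Gt1 := ?_
      I := lI
      I1 := ?_
      I_row := corner_row _
      I_col := corner_col _ }
  · rintro k hk
    obtain rfl := Nat.succ_injective hk
    exact lE
  · rintro k hk
    obtain rfl := Nat.succ_injective hk
    exact lA
  · have := axis_G1 hL hx hφ hG.lext
    rw [← lB, ← lΦt] at this
    exact this.symm
  · have : l.I1 = formulaI1 l.A l.E l.I (level u n 0).I1 l.Gt := rfl
    rw [← hl, this, lA, lE, lI, hG.I1, lGt]
    exact (formulaI1_eq hL hx hy hG.lex hG.lext hφ hφt).symm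

theorem good_up (hu : Admissible u) (hL : Herm L) (hG : Good u L 0 m)
    (hq : ∃ T, IsLex L zz ww 0 m (fs u 0 m) T)
    (hval : L (scale ww (level u 0 m).Φt 0 * dagger (rvv (zz ^ 0 * ww ^ m) (level u 0 m).Φt 0)) =
      u 0 (m + 1)) : Good u L 0 (m + 1) := by
  obtain ⟨Tq, hq⟩ := hq
  have hx := isUni_zz
  have hy := isUni_ww
  rw [mul_comm (zz ^ 0)] at hval
  set l := level u 0 (m + 1) with hl
  have he : ‖u 0 (m + 1)‖ < 1 := hu.up m
  obtain ⟨hA, hAE⟩ := axis_cholesky he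
  have lE : l.Et = gram L (scale ww (level u 0 m).Φt) (rvv (ww ^ m * zz ^ 0) (level u 0 m).Φt) := by
    ext a b
    rw [Subsingleton.elim (α := Fin 1) a 0, Subsingleton.elim (α := Fin 1) b 0]
    exact hval.symm
  have hE : (Matrix.of fun _ _ => u 0 (m + 1) : Matrix (Fin 1) (Fin 1) ℂ) = l.Et := rfl
  rw [hE, lE] at hAE
  have hφt := hG.lext.step hL hy hx hA hAE
  have lA := hG.lext.step_A hy hA hAE
  have lΦt : l.Φt = act l.At⁻¹ (scale ww (level u 0 m).Φt -
      act l.Et (rev 0 m (level u 0 m).Φt)) := rfl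
  rw [rev_eq, lE, mul_comm (zz ^ 0)] at lΦt
  replace lA : l.At = gram L (scale ww (level u 0 m).Φt) l.Φt := by
    rw [lΦt]
    exact lA.symm
  replace hφt : IsLex L ww zz (m + 1) 1 l.Φt _ := lΦt ▸ hφt
  have lΦ : l.Φ = Fin.cons (l.Φt 0) (level u 0 m).Φ := by
    rw [← corner_act, corner_conjTranspose]
    rfl
  obtain ⟨T, hφ⟩ := axis_lex hL hφt hG.lex
  rw [← lΦ] at hφ
  have lI : l.I = gram L l.Φ l.Φt := by
    rw [← gram_conjTranspose hL, lΦ, axis_I hL hφt hG.lex, corner_conjTranspose]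
    rfl
  have lG : l.G = gram L (level u 0 m).Φ l.Φ := by
    rw [lΦ, axis_G hL hφt hG.lex]
    rfl
  have lB : (level u 0 m).I * l.Et * (level u 0 m).I1ᵀ + (level u 0 m).Gᴴ * (level u 0 m).G1 =
      gram L (scale ww (level u 0 m).Φ) (level u 0 m).Φ := by
    rw [gram_scale_self hL hx hy hG.lex hq hG.lext, hG.I, hG.I1, lE, hG.G, hG.G1,
      mul_comm (ww ^ m)]
  have hPD := hφt.comp.pd hL (box_swap zz ww _ _ ▸ hG.pd)
  rw [box_swap] at hPD
  refine
    { lex := hφ.lead_eq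
      lext := hφt.leadt_eq
      pd := hPD
      E := fun k hk => absurd hk (Nat.succ_ne_zero k).symm
      A := fun k hk => absurd hk (Nat.succ_ne_zero k).symm
      Et := ?_
      At := ?_
      K := Matrix.ext fun _ i => i.elim0
      K1 := Matrix.ext fun _ i => i.elim0
      G := lG
      G1 := ?_
      Gt := Matrix.ext fun i => i.elim0
      Gt1 := Matrix.ext fun i => i.elim0
      I := lI
      I1 := ?_
      I_row := fun b => ?_
      I_col := fun a => ?_ }
  · rintro k hk
    obtain rfl := Nat.succ_injective hk
    rw [mul_comm (zz ^ 0)]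
    exact lE
  · rintro k hk
    obtain rfl := Nat.succ_injective hk
    exact lA
  · have := axis_G1 hL hy hφt hG.lex
    rw [← lB, ← lΦ] at this
    exact this.symm
  · have : l.I1 = (formulaI1 l.At l.Et l.Iᴴ (level u 0 m).I1ᵀ l.G)ᵀ := rfl
    rw [← hl, this, lA, lE, lI, hG.I1, lG, gram_rvv_transpose, mul_comm (zz ^ 0),
      gram_conjTranspose hL, ← formulaI1_eq hL hy hx hG.lext hG.lex hφt hφ, gram_rvv_transpose,
      mul_comm (zz ^ 0)]
  · have : l.I = (corner 0 (m + 1))ᵀ := (corner_transpose _ _).symm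
    rw [← hl, this, Matrix.transpose_apply, corner_col]
  · have : l.I = (corner 0 (m + 1))ᵀ := (corner_transpose _ _).symm
    rw [← hl, this, Matrix.transpose_apply, corner_row]

end Bicircle
end

noncomputable section
namespace Bicircle

/-! ### A functional with prescribed values -/

/-- The span of the monomials with exponents in `A`. -/
def monoSpan (A : Set (ℤ × ℤ)) : Submodule ℂ BiLaurent :=
  Submodule.span ℂ ((fun a : ℤ × ℤ => mono a.1 a.2) '' A)

theorem mono_mem_monoSpan {A : Set (ℤ × ℤ)} {i j : ℤ} (h : (i, j) ∈ A) : mono i j ∈ monoSpan A :=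
  Submodule.subset_span ⟨(i, j), h, rfl⟩

theorem monoSpan_le {A : Set (ℤ × ℤ)} {S : Submodule ℂ BiLaurent}
    (h : ∀ i j, (i, j) ∈ A → mono i j ∈ S) : monoSpan A ≤ S := by
  refine Submodule.span_le.2 ?_
  rintro _ ⟨⟨i, j⟩, ha, rfl⟩
  exact h i j ha

theorem mul_mem_monoSpan {A B C : Set (ℤ × ℤ)} (h : ∀ a ∈ A, ∀ b ∈ B, a + b ∈ C)
    {p q : BiLaurent} (hp : p ∈ monoSpan A) (hq : q ∈ monoSpan B) : p * q ∈ monoSpan C := by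
  have h1 : ∀ i j, (i, j) ∈ A → mono i j * q ∈ monoSpan C := fun i j ha => by
    have : monoSpan B ≤ (monoSpan C).comap (LinearMap.mulLeft ℂ (mono i j)) :=
      monoSpan_le fun k l hb => by
        rw [Submodule.mem_comap, LinearMap.mulLeft_apply, mono_mul_mono]
        exact mono_mem_monoSpan (h _ ha _ hb)
    exact this hq
  have : monoSpan A ≤ (monoSpan C).comap (LinearMap.mulRight ℂ q) :=
    monoSpan_le fun i j ha => h1 i j ha
  exact this hp

theorem dagger_mem_monoSpan {A C : Set (ℤ × ℤ)} (h : ∀ a ∈ A, -a ∈ C)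
    {p : BiLaurent} (hp : p ∈ monoSpan A) : dagger p ∈ monoSpan C := by
  induction hp using Submodule.span_induction with
  | mem p hp =>
    obtain ⟨⟨i, j⟩, ha, rfl⟩ := hp
    rw [dagger_mono]
    exact mono_mem_monoSpan (h _ ha)
  | zero => rw [dagger_zero]; exact Submodule.zero_mem _
  | add p q _ _ hp hq => rw [dagger_add]; exact Submodule.add_mem _ hp hq
  | smul c p _ hp => rw [dagger_smul]; exact Submodule.smul_mem _ _ hp

theorem coeff_eq_zero_of_mem_monoSpan {A : Set (ℤ × ℤ)} {p : BiLaurent} (hp : p ∈ monoSpan A)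
    {a : ℤ × ℤ} (ha : a ∉ A) : p.coeff a = 0 := by
  induction hp using Submodule.span_induction with
  | mem p hp =>
    obtain ⟨⟨i, j⟩, hb, rfl⟩ := hp
    rw [coeff_mono, if_neg]
    rintro rfl
    exact ha hb
  | zero => simp
  | add p q _ _ hp hq => simp [hp, hq]
  | smul c p _ hp => simp [hp]

/-- Up to a nonzero factor, `p` is the sum of the monomial `a` and of a combination of monomials
in `A`. -/
def HasLead (a : ℤ × ℤ) (A : Set (ℤ × ℤ)) (p : BiLaurent) : Prop :=
  ∃ t : ℂ, t ≠ 0 ∧ p - t • mono a.1 a.2 ∈ monoSpan A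

theorem HasLead.mul {a b : ℤ × ℤ} {A B C : Set (ℤ × ℤ)} {p q : BiLaurent} (hp : HasLead a A p)
    (hq : HasLead b B q) (h1 : ∀ x ∈ A, x + b ∈ C) (h2 : ∀ y ∈ B, a + y ∈ C)
    (h3 : ∀ x ∈ A, ∀ y ∈ B, x + y ∈ C) : HasLead (a + b) C (p * q) := by
  obtain ⟨t, ht, hp⟩ := hp
  obtain ⟨s, hs, hq⟩ := hq
  refine ⟨t * s, mul_ne_zero ht hs, ?_⟩
  have e : p * q - (t * s) • mono (a + b).1 (a + b).2 =
      (p - t • mono a.1 a.2) * (q - s • mono b.1 b.2) +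
        (s • ((p - t • mono a.1 a.2) * mono b.1 b.2) +
          t • (mono a.1 a.2 * (q - s • mono b.1 b.2))) := by
    have : mono (a + b).1 (a + b).2 = mono a.1 a.2 * mono b.1 b.2 := (mono_mul_mono _ _ _ _).symm
    rw [this]
    simp only [Algebra.smul_def, map_mul]
    ring
  rw [e]
  refine Submodule.add_mem _ (mul_mem_monoSpan h3 hp hq) (Submodule.add_mem _
    (Submodule.smul_mem _ _ (mul_mem_monoSpan (B := {b}) ?_ hp (mono_mem_monoSpan rfl)))
    (Submodule.smul_mem _ _ (mul_mem_monoSpan (A := {a}) ?_ (mono_mem_monoSpan rfl) hq)))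
  · rintro x hx _ rfl
    exact h1 x hx
  · rintro _ rfl y hy
    exact h2 y hy

theorem HasLead.dagger {a : ℤ × ℤ} {A C : Set (ℤ × ℤ)} {p : BiLaurent} (hp : HasLead a A p)
    (h : ∀ x ∈ A, -x ∈ C) : HasLead (-a) C (dagger p) := by
  obtain ⟨t, ht, hp⟩ := hp
  refine ⟨star t, star_ne_zero.2 ht, ?_⟩
  have := dagger_mem_monoSpan h hp
  rwa [dagger_sub, dagger_smul, dagger_mono] at this

theorem HasLead.mono_mul (i j : ℤ) {a : ℤ × ℤ} {A C : Set (ℤ × ℤ)} {p : BiLaurent}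
    (hp : HasLead a A p) (h : ∀ x ∈ A, (i, j) + x ∈ C) :
    HasLead ((i, j) + a) C (mono i j * p) := by
  obtain ⟨t, ht, hp⟩ := hp
  refine ⟨t, ht, ?_⟩
  have := mul_mem_monoSpan (A := {(i, j)}) (C := C) (by rintro _ rfl; exact h)
    (mono_mem_monoSpan rfl) hp
  rwa [mul_sub, mul_smul_comm, mono_mul_mono] at this

/-- The size of an exponent. -/
def rank (a : ℤ × ℤ) : ℕ := a.1.natAbs + a.2.natAbs

theorem rank_neg (a : ℤ × ℤ) : rank (-a) = rank a := by simp [rank]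

/-- The functional with given values on the monomials. -/
def functionalOf (f : ℤ × ℤ → ℂ) : BiLaurent →ₗ[ℂ] ℂ where
  toFun p := p.coeff.sum fun a c => c * f a
  map_add' p q := by
    rw [AddMonoidAlgebra.coeff_add]
    exact Finsupp.sum_add_index' (by simp) (fun _ _ _ => add_mul _ _ _)
  map_smul' c p := by
    rw [AddMonoidAlgebra.coeff_smul, Finsupp.sum_smul_index' (by simp), RingHom.id_apply,
      Finsupp.smul_sum]
    simp only [smul_eq_mul, mul_assoc]

theorem functionalOf_mono (f : ℤ × ℤ → ℂ) (i j : ℤ) : functionalOf f (mono i j) = f (i, j) := by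
  simp [functionalOf, mono]

theorem functionalOf_congr {f g : ℤ × ℤ → ℂ} {A : Set (ℤ × ℤ)} (h : ∀ a ∈ A, f a = g a)
    {p : BiLaurent} (hp : p ∈ monoSpan A) : functionalOf f p = functionalOf g p := by
  induction hp using Submodule.span_induction with
  | mem p hp =>
    obtain ⟨⟨i, j⟩, hb, rfl⟩ := hp
    rw [functionalOf_mono, functionalOf_mono, h _ hb]
  | zero => rw [map_zero, map_zero]
  | add p q _ _ hp hq => rw [map_add, map_add, hp, hq]
  | smul c p _ hp => rw [map_smul, map_smul, hp]

/-- The values on the monomials of the functional that takes the value `v a` at `p a`. -/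
def solveMono (p : ℤ × ℤ → BiLaurent) (v : ℤ × ℤ → ℂ) (a : ℤ × ℤ) : ℂ :=
  -- The condition on the rank serves termination only; it holds for every exponent of `p a` below a
  -- true leading term. Without such a term the quotient is a harmless default value, possibly a
  -- division by zero.
  (v a - functionalOf (fun b => if _h : rank b < rank a then solveMono p v b else 0) (p a)) /
    (p a).coeff a
  termination_by rank a

theorem solveMono_eq (p : ℤ × ℤ → BiLaurent) (v : ℤ × ℤ → ℂ) (a : ℤ × ℤ) : solveMono p v a =
    (v a - functionalOf (fun b => if rank b < rank a then solveMono p v b else 0) (p a)) /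
    (p a).coeff a := by
  rw [solveMono]
  rfl

/-- The value on the leading monomial was chosen as the solution of this one linear equation, after
the values on all monomials of smaller rank. -/
theorem functionalOf_solveMono {p : ℤ × ℤ → BiLaurent} (v : ℤ × ℤ → ℂ) {a : ℤ × ℤ}
    (h : HasLead a {b | rank b < rank a} (p a)) : functionalOf (solveMono p v) (p a) = v a := by
  obtain ⟨t, ht, hi⟩ := h
  have hm : (p a).coeff a = t := by
    have := coeff_eq_zero_of_mem_monoSpan hi (a := a) (lt_irrefl (rank a))
    rw [AddMonoidAlgebra.coeff_sub, Finsupp.sub_apply, AddMonoidAlgebra.coeff_smul,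
      Finsupp.smul_apply, coeff_mono, if_pos rfl, smul_eq_mul, mul_one] at this
    exact sub_eq_zero.1 this
  have key : ∀ f, functionalOf f (p a) =
      t * f a + functionalOf f (p a - t • mono a.1 a.2) := fun f => by
    rw [map_sub, map_smul, functionalOf_mono, smul_eq_mul, add_sub_cancel]
  have h3 := solveMono_eq p v a
  have h4 : functionalOf (fun b => if rank b < rank a then solveMono p v b else 0)
      (p a - t • mono a.1 a.2) = functionalOf (solveMono p v) (p a - t • mono a.1 a.2) :=
    functionalOf_congr (fun b hb => if_pos hb) hi
  rw [hm, key, if_neg (lt_irrefl _), mul_zero, zero_add, h4, eq_div_iff ht] at h3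
  rw [key, mul_comm, h3, sub_add_cancel]

/-- The leading-term hypothesis stands inside the conclusion, for each index separately: the
functional can be fixed first, and the leading terms of the p's may be established later, with its
help. -/
theorem exists_functional {ι : Type*} {d : ι → ℤ × ℤ} (hd : Function.Injective d)
    (p : ι → BiLaurent) (v : ι → ℂ) : ∃ L : BiLaurent →ₗ[ℂ] ℂ,
      ∀ i, HasLead (d i) {b | rank b < rank (d i)} (p i) → L (p i) = v i := by
  refine ⟨functionalOf (solveMono (Function.extend d p 0) (Function.extend d v 0)),
    fun i h => ?_⟩
  have e1 : Function.extend d p 0 (d i) = p i := hd.extend_apply _ _ _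
  have e2 : Function.extend d v 0 (d i) = v i := hd.extend_apply _ _ _
  rw [← e1] at h
  rw [← e1, ← e2]
  exact functionalOf_solveMono _ h

/-- Since the exponents d and -d never collide, the conjugate values can be prescribed at the p†'s
as well. Averaging with the conjugate functional then makes the solution hermitian and preserves all
prescribed values. -/
theorem exists_herm_functional {ι : Type*} {d : ι → ℤ × ℤ} (hd : Function.Injective d)
    (hd' : ∀ i j, d i ≠ -d j) (p : ι → BiLaurent) (v : ι → ℂ) {c : ℂ} (hc : star c = c) :
    ∃ L : BiLaurent →ₗ[ℂ] ℂ, Herm L ∧ L 1 = c ∧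
      ∀ i, HasLead (d i) {b | rank b < rank (d i)} (p i) → L (p i) = v i := by
  have h0 : ∀ i, d i ≠ 0 := fun i hi => hd' i i (by rw [hi, neg_zero])
  have hinj : Function.Injective
      fun o : Option (ι ⊕ ι) => o.elim 0 (Sum.elim d fun i => -d i) := by
    rintro (_ | i | i) (_ | j | j) h
    · rfl
    · exact absurd h.symm (h0 j)
    · exact absurd (neg_eq_zero.1 h.symm) (h0 j)
    · exact absurd h (h0 i)
    · rw [hd h]
    · exact absurd h (hd' i j)
    · exact absurd (neg_eq_zero.1 h) (h0 i)
    · exact absurd h.symm (hd' j i)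
    · rw [hd (neg_injective h)]
  obtain ⟨L, hL⟩ := exists_functional hinj
    (fun o => o.elim 1 (Sum.elim p fun i => dagger (p i)))
    (fun o => o.elim c (Sum.elim v fun i => star (v i)))
  have hL1 : L 1 = c := hL none ⟨1, one_ne_zero, by
    change 1 - (1 : ℂ) • mono 0 0 ∈ _
    simp [mono_zero]⟩
  let M : BiLaurent →ₗ[ℂ] ℂ :=
    { toFun := fun q => (L q + star (L (dagger q))) / 2
      map_add' := fun q r => by
        rw [dagger_add, map_add, map_add, star_add]
        ring
      map_smul' := fun s q => by
        rw [dagger_smul, map_smul, map_smul, smul_eq_mul, smul_eq_mul, star_mul', star_star,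
          RingHom.id_apply, smul_eq_mul]
        ring }
  have hM : ∀ q, M q = (L q + star (L (dagger q))) / 2 := fun _ => rfl
  refine ⟨M, fun q => ?_, ?_, fun i hi => ?_⟩
  · rw [hM, hM, dagger_dagger, star_div₀, star_add, star_star, add_comm]
    simp
  · rw [hM, dagger_one, hL1, hc]
    ring
  · have h1 : L (p i) = v i := hL (some (Sum.inl i)) hi
    have h2 : L (dagger (p i)) = star (v i) :=
      hL (some (Sum.inr i)) (hi.dagger fun x hx => by
        change rank (-x) < rank (-d i)
        rwa [rank_neg, rank_neg])
    rw [hM, h1, h2, star_star]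
    ring

end Bicircle
end

/-! ### The pivots, and the existence of the functional -/

noncomputable section
namespace Bicircle

variable {L : BiLaurent →ₗ[ℂ] ℂ} {x y : BiLaurent} {n m : ℕ} {u : ℤ → ℤ → ℂ}

theorem IsLex.sub_first_mem {Φ : Fin (m + 1) → BiLaurent}
    {T : Matrix (Fin (m + 1)) (Fin (m + 1)) ℂ} (h : IsLex L x y n (m + 1) Φ T)
    {S : Submodule ℂ BiLaurent}
    (hS : ∀ i j, i ≤ n → j ≤ m → ¬ (i = n ∧ j = m) → x ^ i * y ^ j ∈ S) :
    Φ 0 - T 0 0 • (x ^ n * y ^ m) ∈ S := by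
  have h1 : box x y n (m + 1) ≤ S :=
    box_le fun i hi j hj => hS i j (by omega) (by omega) (by omega)
  have h2 : Φ 0 - T 0 0 • (x ^ n * y ^ m) = (Φ - act T (monoVec x y n (m + 1))) 0 +
      ∑ b : Fin m, T 0 b.succ • monoVec x y n (m + 1) b.succ := by
    rw [Pi.sub_apply, act_apply, Fin.sum_univ_succ]
    simp only [monoVec, Fin.rev_zero, Fin.val_last]
    abel
  rw [h2]
  refine Submodule.add_mem _ (h1 (h.lead 0)) (Submodule.sum_mem _ fun b _ =>
    Submodule.smul_mem _ _ (hS _ _ le_rfl ?_ ?_))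
  · omega
  · rw [Fin.val_rev, Fin.val_succ]
    omega

/-- The last row of an upper triangular matrix has a single entry, so the last polynomial has just
one monomial of top degree in x. -/
theorem IsLex.sub_last_mem {Φ : Fin (m + 1) → BiLaurent}
    {T : Matrix (Fin (m + 1)) (Fin (m + 1)) ℂ} (h : IsLex L x y n (m + 1) Φ T) :
    Φ (Fin.last m) - T (Fin.last m) (Fin.last m) • (x ^ n * y ^ 0) ∈ box x y n (m + 1) := by
  have := h.lead (Fin.last m)
  rw [Pi.sub_apply, act_apply, Finset.sum_eq_single (Fin.last m)] at this
  · simpa [monoVec] using this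
  · intro b _ hb
    rw [h.ut.1 (show id b < id (Fin.last m) from Fin.lt_last_iff_ne_last.2 hb), zero_smul]
  · simp

/-- The exponents in the rectangle `[0, n] × [0, m]`, except for the corner `(n, m)`. -/
def rectCorner (n m : ℕ) : Set (ℤ × ℤ) :=
  {a | 0 ≤ a.1 ∧ a.1 ≤ n ∧ 0 ≤ a.2 ∧ a.2 ≤ m ∧ a.1 + a.2 < n + m}

/-- The exponents of a box. -/
def rect (n m : ℕ) : Set (ℤ × ℤ) := {a | 0 ≤ a.1 ∧ a.1 < n ∧ 0 ≤ a.2 ∧ a.2 < m}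

theorem box_le_monoSpan (n m : ℕ) : box zz ww n m ≤ monoSpan (rect n m) :=
  box_le fun i hi j hj => by
    rw [zz_pow_mul_ww_pow]
    exact mono_mem_monoSpan ⟨by simp, by simpa using hi, by simp, by simpa using hj⟩

namespace Good

theorem lead_first (h : Good u L n m) :
    HasLead (n, m) (rectCorner n m) ((level u n m).Φ 0) := by
  refine ⟨_, h.lex.ut.diag_ne_zero 0, ?_⟩
  rw [← zz_pow_mul_ww_pow]
  refine h.lex.sub_first_mem fun i j hi hj hij => ?_
  rw [zz_pow_mul_ww_pow]
  exact mono_mem_monoSpan ⟨by simp, by simpa using hi, by simp, by simpa using hj, by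
    simp only
    omega⟩

theorem leadt_first (h : Good u L n m) :
    HasLead (n, m) (rectCorner n m) ((level u n m).Φt 0) := by
  refine ⟨_, h.lext.ut.diag_ne_zero 0, ?_⟩
  rw [← zz_pow_mul_ww_pow, mul_comm (zz ^ n)]
  refine h.lext.sub_first_mem fun i j hi hj hij => ?_
  rw [mul_comm, zz_pow_mul_ww_pow]
  exact mono_mem_monoSpan ⟨by simp, by simpa using hj, by simp, by simpa using hi, by
    simp only
    omega⟩

theorem lead_last (h : Good u L n m) :
    HasLead (n, 0) (rect n (m + 1)) ((level u n m).Φ (Fin.last m)) := by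
  refine ⟨_, h.lex.ut.diag_ne_zero (Fin.last m), ?_⟩
  have := box_le_monoSpan _ _ h.lex.sub_last_mem
  rwa [zz_pow_mul_ww_pow] at this

theorem leadt_last (h : Good u L n m) :
    HasLead (0, m) (rect (n + 1) m) ((level u n m).Φt (Fin.last n)) := by
  refine ⟨_, h.lext.ut.diag_ne_zero (Fin.last n), ?_⟩
  have := h.lext.sub_last_mem
  rw [box_swap, mul_comm (ww ^ m)] at this
  have := box_le_monoSpan _ _ this
  rwa [zz_pow_mul_ww_pow] at this

end Good

/-- The index set of the prescribed values: the values on the axes, and two values on each level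
off the axes. -/
inductive Pivot : Type
  | right (n : ℕ)
  | up (m : ℕ)
  | last (n m : ℕ)
  | first (n m : ℕ)

namespace Pivot

/-- The leading exponent of a pivot. -/
def deg : Pivot → ℤ × ℤ
  | right n => (n + 1, 0)
  | up m => (0, m + 1)
  | last n m => (n + 1, -(m + 1))
  | first n m => (n + 1, m + 1)

/-- The polynomials at which the functional is prescribed. -/
def poly (u : ℤ → ℤ → ℂ) : Pivot → BiLaurent
  | right n => scale zz (level u n 0).Φ 0 * dagger (rvv (zz ^ n * ww ^ 0) (level u n 0).Φ 0)
  | up m => scale ww (level u 0 m).Φt 0 * dagger (rvv (zz ^ 0 * ww ^ m) (level u 0 m).Φt 0)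
  | last n m => (level u (n + 1) m).Φ (Fin.last m) *
      dagger ((level u n (m + 1)).Φt (Fin.last n))
  | first n m => (scale (zz * ww) (level u (n + 1) m).Φ) 0 *
        dagger ((rvv (zz ^ (n + 1) * ww ^ (m + 1)) (level u n (m + 1)).Φt) 0)

/-- The prescribed values. -/
def val (u : ℤ → ℤ → ℂ) : Pivot → ℂ
  | right n => u (n + 1) 0
  | up m => u 0 (m + 1)
  | last n m => stepK u n m (level u (n + 1) m) (level u n (m + 1)) (Fin.last m) (Fin.last n)
  | first n m => stepK1 u n m (level u (n + 1) m) (level u n (m + 1)) 0 0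

theorem deg_injective : Function.Injective deg := by
  rintro (n | m | ⟨n, m⟩ | ⟨n, m⟩) (n' | m' | ⟨n', m'⟩ | ⟨n', m'⟩) h <;>
    simp only [deg, Prod.mk.injEq] at h <;>
    first
    | (exfalso; omega)
    | (obtain rfl : n = n' := by omega
       first
       | rfl
       | (obtain rfl : m = m' := by omega
          rfl))
    | (obtain rfl : m = m' := by omega
       rfl)

theorem deg_ne_neg (a b : Pivot) : deg a ≠ -deg b := by
  rcases a with (n | m | ⟨n, m⟩ | ⟨n, m⟩) <;> rcases b with (n' | m' | ⟨n', m'⟩ | ⟨n', m'⟩) <;>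
    simp only [deg, Prod.neg_mk, ne_eq, Prod.mk.injEq] <;> omega

/-- The pivot is z^{1-n} times the square of the first entry of Φ. Its exponents run from 1-n to
n+1, so the top one alone has rank n+1. -/
theorem hasLead_right (h : Good u L n 0) :
    HasLead (right n).deg {b | rank b < rank (right n).deg} ((right n).poly u) := by
  have h1 := (h.lead_first.mul h.lead_first
    (C := {b | 0 ≤ b.1 ∧ b.1 < n + n ∧ b.2 = 0}) ?_ ?_ ?_).mono_mul (1 - n) 0
    (C := {b | rank b < rank (right n).deg}) ?_
  · have e1 : ((1 - n : ℤ), (0 : ℤ)) + (((n : ℤ), ((0 : ℕ) : ℤ)) + ((n : ℤ), ((0 : ℕ) : ℤ))) =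
        (right n).deg := by
      ext <;> simp [deg]
      ring
    have e2 : mono (1 - n) 0 * ((level u n 0).Φ 0 * (level u n 0).Φ 0) = (right n).poly u := by
      have : mono (1 - n) 0 = zz * dagger (mono n (0 : ℕ)) := by
        rw [dagger_mono, zz, mono_mul_mono]
        congr 1
      simp only [poly, scale, rvv, dagger_mul, dagger_dagger, zz_pow_mul_ww_pow, this]
      ring
    rwa [e1, e2] at h1
  all_goals
    simp only [rectCorner, rank, deg, Prod.forall, Prod.mk_add_mk, Set.mem_ofPred_eq]
    intros
    omega

theorem hasLead_up (h : Good u L 0 m) :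
    HasLead (up m).deg {b | rank b < rank (up m).deg} ((up m).poly u) := by
  have h1 := (h.leadt_first.mul h.leadt_first
    (C := {b | 0 ≤ b.2 ∧ b.2 < m + m ∧ b.1 = 0}) ?_ ?_ ?_).mono_mul 0 (1 - m)
    (C := {b | rank b < rank (up m).deg}) ?_
  · have e1 : ((0 : ℤ), (1 - m : ℤ)) + ((((0 : ℕ) : ℤ), (m : ℤ)) + (((0 : ℕ) : ℤ), (m : ℤ))) =
        (up m).deg := by
      ext <;> simp [deg]
      ring
    have e2 : mono 0 (1 - m) * ((level u 0 m).Φt 0 * (level u 0 m).Φt 0) = (up m).poly u := by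
      have : mono 0 (1 - m) = ww * dagger (mono (0 : ℕ) m) := by
        rw [dagger_mono, ww, mono_mul_mono]
        congr 1
      simp only [poly, scale, rvv, dagger_mul, dagger_dagger, zz_pow_mul_ww_pow, this]
      ring
    rwa [e1, e2] at h1
  all_goals
    simp only [rectCorner, rank, deg, Prod.forall, Prod.mk_add_mk, Set.mem_ofPred_eq]
    intros
    omega

/-- The last entries of Φ and Φt have leading monomials z^{n+1} and w^{m+1}. The conjugation turns
the second into w^{-(m+1)}, which yields the mixed exponent that carries u_{-(n+1),m+1}. -/
theorem hasLead_last (hP : Good u L (n + 1) m) (hQ : Good u L n (m + 1)) :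
    HasLead (last n m).deg {b | rank b < rank (last n m).deg} ((last n m).poly u) := by
  have h1 := hP.lead_last.mul (hQ.leadt_last.dagger
    (C := {b | -n ≤ b.1 ∧ b.1 ≤ 0 ∧ -m ≤ b.2 ∧ b.2 ≤ 0}) ?_)
    (C := {b | rank b < rank (last n m).deg}) ?_ ?_ ?_
  · have e1 : (((n + 1 : ℕ) : ℤ), (0 : ℤ)) + -((0 : ℤ), ((m + 1 : ℕ) : ℤ)) =
        (last n m).deg := by
      ext <;> simp [deg]
    rwa [e1] at h1
  all_goals
    simp only [rect, rank, deg, Prod.forall, Prod.mk_add_mk, Prod.neg_mk, Set.mem_ofPred_eq]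
    intros
    omega

/-- The pivot is z^{-n} w^{-m} times the product of the first entries. Its exponents lie in [-n,
n+1] × [-m, m+1], where only the corner (n+1, m+1) has rank n+m+2. -/
theorem hasLead_first (hP : Good u L (n + 1) m) (hQ : Good u L n (m + 1)) :
    HasLead (first n m).deg {b | rank b < rank (first n m).deg} ((first n m).poly u) := by
  have h1 := (hP.lead_first.mul hQ.leadt_first (C := {b | 0 ≤ b.1 ∧ b.1 ≤ 2 * n + 1 ∧ 0 ≤ b.2 ∧
    b.2 ≤ 2 * m + 1 ∧ b.1 + b.2 < 2 * n + 2 * m + 2}) ?_ ?_ ?_).mono_mul (-n) (-m)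
    (C := {b | rank b < rank (first n m).deg}) ?_
  · have e1 : ((-n : ℤ), (-m : ℤ)) + ((((n + 1 : ℕ) : ℤ), (m : ℤ)) + ((n : ℤ), ((m + 1 : ℕ) : ℤ))) =
        (first n m).deg := by
      ext <;> simp [deg]
    have e2 : mono (-n) (-m) * ((level u (n + 1) m).Φ 0 * (level u n (m + 1)).Φt 0) =
        (first n m).poly u := by
      have : mono (-n) (-m) = zz * ww * dagger (mono (n + 1 : ℕ) (m + 1 : ℕ)) := by
        rw [dagger_mono, zz, ww, mono_mul_mono, mono_mul_mono]
        congr 1 <;> push_cast <;> ring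
      simp only [poly, scale, rvv, dagger_mul, dagger_dagger, zz_pow_mul_ww_pow, this]
      ring
    rwa [e1, e2] at h1
  all_goals
    simp only [rectCorner, rank, deg, Prod.forall, Prod.mk_add_mk, Set.mem_ofPred_eq]
    intros
    omega

end Pivot

/-- If the parameters are admissible, there is a functional to which all levels belong. -/
theorem exists_good (hu : ∀ i j : ℤ, u i (-j) = star (u (-i) j)) (h : Admissible u) :
    ∃ L : BiLaurent →ₗ[ℂ] ℂ, Herm L ∧ ∀ n m, Good u L n m := by
  obtain ⟨L, hL, h1, hp⟩ := exists_herm_functional Pivot.deg_injective Pivot.deg_ne_neg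
    (Pivot.poly u) (Pivot.val u) (c := u 0 0) (by simpa using (hu 0 0).symm)
  refine ⟨L, hL, fun n => ?_⟩
  -- The functional is already fixed. Column by column, each level uses its left, lower and diagonal
  -- neighbours, and strong induction also supplies the ones two steps back; the leading terms
  -- needed for the prescribed values come from these levels.
  induction n using Nat.strong_induction_on with
  | _ n ihn =>
    intro m
    induction m using Nat.strong_induction_on with
    | _ m ihm =>
      obtain _ | n := n
      · obtain _ | m := m
        · exact good_origin hL h.origin h1
        · have hG := ihm m (Nat.lt_succ_self m)
          exact good_up h hL hG (fs_lex fun k hk => ihm k (hk.trans (Nat.lt_succ_self m)))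
            (hp (Pivot.up m) (Pivot.hasLead_up hG))
      · obtain _ | m := m
        · have hG := ihn n (Nat.lt_succ_self n) 0
          exact good_right h hL hG
            (fts_lex fun k hk => ihn k (hk.trans (Nat.lt_succ_self n)) 0)
            (hp (Pivot.right n) (Pivot.hasLead_right hG))
        · have hP := ihm m (Nat.lt_succ_self m)
          have hQ := ihn n (Nat.lt_succ_self n) (m + 1)
          exact good_step h hL hP hQ (ihn n (Nat.lt_succ_self n) m)
            (fs_lex fun k hk => ihm k (hk.trans (Nat.lt_succ_self m)))
            (fts_lex fun k hk => ihn k (hk.trans (Nat.lt_succ_self n)) (m + 1))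
            (hp (Pivot.last n m) (Pivot.hasLead_last hP hQ))
            (hp (Pivot.first n m) (Pivot.hasLead_first hP hQ))

end Bicircle
end

noncomputable section
namespace Bicircle

variable {L : BiLaurent →ₗ[ℂ] ℂ} {n m : ℕ} {u : ℤ → ℤ → ℂ}

/-! ### Positive definiteness and uniqueness -/

theorem exists_shift_mem_box (p : BiLaurent) :
    ∃ N : ℕ, ∀ K ≥ N, mono K K * p ∈ box zz ww (2 * K + 1) (2 * K + 1) := by
  induction p using AddMonoidAlgebra.induction_linear with
  | zero => exact ⟨0, fun K _ => by rw [mul_zero]; exact Submodule.zero_mem _⟩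
  | add p q hp hq =>
    obtain ⟨N, hp⟩ := hp
    obtain ⟨N', hq⟩ := hq
    refine ⟨max N N', fun K hK => ?_⟩
    rw [mul_add]
    exact Submodule.add_mem _ (hp K (le_of_max_le_left hK)) (hq K (le_of_max_le_right hK))
  | single a c =>
    obtain ⟨i, j⟩ := a
    refine ⟨max i.natAbs j.natAbs, fun K hK => ?_⟩
    have h1 := le_of_max_le_left hK
    have h2 := le_of_max_le_right hK
    have e : mono K K * AddMonoidAlgebra.single (i, j) c =
        c • (zz ^ (K + i).toNat * ww ^ (K + j).toNat) := by
      rw [zz_pow_mul_ww_pow, Int.toNat_of_nonneg (by omega), Int.toNat_of_nonneg (by omega),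
        ← mono_mul_mono, ← mul_smul_comm, mono, mono, AddMonoidAlgebra.smul_single, smul_eq_mul,
        mul_one]
    rw [e]
    exact Submodule.smul_mem _ _ (mem_box (by omega) (by omega))

/-- A monomial factor does not change p p† and moves p into a box, where the form is positive
definite. -/
theorem isPositiveDefinite_of_good (hL : Herm L) (h : ∀ n m, Good u L n m) :
    IsPositiveDefinite L := by
  intro p hp
  constructor
  · obtain ⟨N, hN⟩ := exists_shift_mem_box p
    have hu := isUni_mono N N
    have h1 := (h (2 * N) (2 * N)).pd _ (hN N le_rfl) (fun h0 => hp (by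
      rw [← one_mul p, ← hu, mul_comm (mono _ _), mul_assoc, h0, mul_zero]))
    rwa [dagger_mul, mul_mul_mul_comm, hu, one_mul] at h1
  · exact Complex.conj_eq_iff_im.1 (hL.swap p p)

/-- For i < j the entries of the earlier vector lie in the box to which the later vector is
orthogonal; within one level the system is orthonormal. -/
theorem isBuiltFrom_of_good (hL : Herm L) (h : ∀ n m, Good u L n m) : IsBuiltFrom u L := by
  constructor
  · intro m i j a b
    rcases lt_trichotomy i j with hij | rfl | hij
    · rw [if_neg fun h => hij.ne h.1, ← star_inj, hL.swap, star_zero]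
      exact (h j m).lex.perp b _ (box_mono hij le_rfl ((h i m).lex.inn a))
    · have := congrFun (congrFun (h i m).lex.norm a) b
      rw [gram_apply] at this
      rw [this, Matrix.one_apply]
      simp
    · rw [if_neg fun h => hij.ne h.1.symm]
      exact (h i m).lex.perp a _ (box_mono hij le_rfl ((h j m).lex.inn b))
  · intro n i j a b
    rcases lt_trichotomy i j with hij | rfl | hij
    · rw [if_neg fun h => hij.ne h.1, ← star_inj, hL.swap, star_zero]
      exact (h n j).lext.perp b _ (box_mono hij le_rfl ((h n i).lext.inn a))
    · have := congrFun (congrFun (h n i).lext.norm a) b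
      rw [gram_apply] at this
      rw [this, Matrix.one_apply]
      simp
    · rw [if_neg fun h => hij.ne h.1.symm]
      exact (h n i).lext.perp a _ (box_mono hij le_rfl ((h n j).lext.inn b))

theorem box_le_span_levels (h : ∀ n m, Good u L n m) (N m : ℕ) : box zz ww N (m + 1) ≤
    Submodule.span ℂ {p | ∃ i : ℕ, ∃ a : Fin (m + 1), (level u i m).Φ a = p} := by
  induction N with
  | zero => rw [box_zero_left]; exact bot_le
  | succ n ih =>
    intro p hp
    obtain ⟨C, hC⟩ := (h n m).lex.comp.red p hp
    have := Submodule.add_mem _ (ih hC) (Submodule.sum_mem _ fun b (_ : b ∈ Finset.univ) =>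
      Submodule.smul_mem _ (C b) (Submodule.subset_span
        (⟨n, b, rfl⟩ : (level u n m).Φ b ∈
          {p | ∃ i : ℕ, ∃ a : Fin (m + 1), (level u i m).Φ a = p})))
    rwa [sub_add_cancel] at this

theorem eq_of_isBuiltFrom (h : ∀ n m, Good u L n m) {L₁ L₂ : BiLaurent →ₗ[ℂ] ℂ}
    (h₁ : IsBuiltFrom u L₁) (h₂ : IsBuiltFrom u L₂) : L₁ = L₂ := by
  have key : ∀ m, ∀ p ∈ Submodule.span ℂ {p | ∃ i : ℕ, ∃ a : Fin (m + 1), (level u i m).Φ a = p},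
      ∀ q ∈ Submodule.span ℂ {p | ∃ i : ℕ, ∃ a : Fin (m + 1), (level u i m).Φ a = p},
        L₁ (p * dagger q) = L₂ (p * dagger q) := by
    intro m p hp q hq
    induction hp using Submodule.span_induction with
    | mem p hp =>
      obtain ⟨i, a, rfl⟩ := hp
      induction hq using Submodule.span_induction with
      | mem q hq =>
        obtain ⟨j, b, rfl⟩ := hq
        rw [h₁.1, h₂.1]
      | zero => rw [dagger_zero, mul_zero, map_zero, map_zero]
      | add q r _ _ hq hr => rw [dagger_add, mul_add, map_add, map_add, hq, hr]
      | smul c q _ hq => rw [dagger_smul, mul_smul_comm, map_smul, map_smul, hq]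
    | zero => rw [zero_mul, map_zero, map_zero]
    | add p r _ _ hp hr => rw [add_mul, map_add, map_add, hp, hr]
    | smul c p _ hp => rw [smul_mul_assoc, map_smul, map_smul, hp]
  have hm : ∀ i j : ℤ, L₁ (mono i j) = L₂ (mono i j) := by
    intro i j
    -- Positive and negative parts of the exponents go to the two factors of p q†, so both lie in a
    -- box, hence in the span of vectors whose inner products are prescribed.
    have e : mono i j = zz ^ i.toNat * ww ^ j.toNat *
        dagger (zz ^ (-i).toNat * ww ^ (-j).toNat) := by
      rw [zz_pow_mul_ww_pow, zz_pow_mul_ww_pow, dagger_mono, mono_mul_mono]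
      congr 1 <;> omega
    rw [e]
    exact key (max j.toNat (-j).toNat) _
      (box_le_span_levels h (max i.toNat (-i).toNat + 1) _ (mem_box (by omega) (by omega))) _
      (box_le_span_levels h (max i.toNat (-i).toNat + 1) _ (mem_box (by omega) (by omega)))
  refine LinearMap.ext fun p => ?_
  induction p using AddMonoidAlgebra.induction_linear with
  | zero => rw [map_zero, map_zero]
  | add p q hp hq => rw [map_add, map_add, hp, hq]
  | single a c =>
    have : (AddMonoidAlgebra.single a c : BiLaurent) = c • mono a.1 a.2 := by
      rw [mono, AddMonoidAlgebra.smul_single, smul_eq_mul, mul_one]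
    rw [this, map_smul, map_smul, hm]

end Bicircle
end

noncomputable section
namespace Bicircle

variable {L : BiLaurent →ₗ[ℂ] ℂ}

/-! ### The representing measure -/

/-- The number of pairs `i, j < N` with `i - j = a`. -/
def pairCount (N : ℕ) (a : ℤ) : ℕ :=
  ((Finset.range N ×ˢ Finset.range N).filter fun p => (p.1 : ℤ) - p.2 = a).card

theorem pairCount_eq (N : ℕ) (a : ℤ) : pairCount N a = N - a.natAbs := by
  have : ((Finset.range N ×ˢ Finset.range N).filter fun p => (p.1 : ℤ) - p.2 = a) =
      (Finset.range (N - a.natAbs)).image fun t => (t + a.toNat, t + (-a).toNat) := by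
    ext ⟨i, j⟩
    simp only [Finset.mem_filter, Finset.mem_product, Finset.mem_range, Finset.mem_image,
      Prod.mk.injEq]
    constructor
    · rintro ⟨⟨hi, hj⟩, h⟩
      exact ⟨min i j, by omega, by omega, by omega⟩
    · rintro ⟨t, ht, h1, h2⟩
      omega
  rw [pairCount, this, Finset.card_image_of_injective, Finset.card_range]
  intro s t h
  have := congrArg Prod.fst h
  simpa using this

theorem tendsto_pairCount (a : ℤ) :
    Filter.Tendsto (fun N : ℕ => ((pairCount N a : ℝ) / N)) Filter.atTop (nhds 1) := by
  have h1 : Filter.Tendsto (fun N : ℕ => 1 - (a.natAbs : ℝ) / N) Filter.atTop (nhds (1 - 0)) :=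
    tendsto_const_nhds.sub (tendsto_const_div_atTop_nhds_zero_nat _)
  rw [sub_zero] at h1
  refine h1.congr' ?_
  filter_upwards [Filter.eventually_ge_atTop (a.natAbs + 1)] with N hN
  rw [pairCount_eq, Nat.cast_sub (by omega), sub_div, div_self]
  exact_mod_cast (by omega : N ≠ 0)

/-- The Dirichlet polynomial `∑ i < N, (x / s) ^ i`. -/
def dirichlet (x : BiLaurent) (N : ℕ) (s : ℂ) : BiLaurent :=
  ∑ i ∈ Finset.range N, star s ^ i • x ^ i

theorem sum_pow_rootOfUnity {M : ℕ} {ζ : ℂ} (hζ : IsPrimitiveRoot ζ M) {d : ℤ}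
    (hd : d.natAbs < M) : ∑ k ∈ Finset.range M, (ζ ^ d) ^ k = if d = 0 then (M : ℂ) else 0 := by
  split_ifs with h
  · simp [h]
  · have h1 : ζ ^ d ≠ 1 := fun h1 => by
      have := (hζ.zpow_eq_one_iff_dvd d).1 h1
      exact h (Int.eq_zero_of_abs_lt_dvd this (by rw [Int.abs_eq_natAbs]; omega))
    rw [geom_sum_eq h1, ← zpow_natCast, ← zpow_mul, mul_comm, zpow_mul, zpow_natCast,
      hζ.pow_eq_one, one_zpow, sub_self, zero_div]

/-- In D D† the exponent a occurs once for each pair i - j = a, and averaging over the M-th roots of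
unity selects it. The bound on `a` keeps all differences below M, so that there is no aliasing. -/
theorem fejer_sum {x : BiLaurent} {X : ℤ → BiLaurent}
    (hX : ∀ i j : ℕ, x ^ i * dagger (x ^ j) = X (i - j)) {N M : ℕ} {ζ : ℂ}
    (hζ : IsPrimitiveRoot ζ M) (hζ' : star ζ * ζ = 1) {a : ℤ} (ha : a.natAbs + N ≤ M) :
    ∑ k ∈ Finset.range M, (ζ ^ k) ^ a •
      (dirichlet x N (ζ ^ k) * dagger (dirichlet x N (ζ ^ k))) =
      ((M * pairCount N a : ℕ) : ℂ) • X a := by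
  have hζ0 : ζ ≠ 0 := right_ne_zero_of_mul_eq_one hζ'
  have e1 : ∀ k, (ζ ^ k) ^ a • (dirichlet x N (ζ ^ k) * dagger (dirichlet x N (ζ ^ k))) =
      ∑ p ∈ Finset.range N ×ˢ Finset.range N, (ζ ^ (a - (p.1 - p.2))) ^ k • X (p.1 - p.2) := by
    intro k
    rw [dirichlet, dagger_sum, Finset.sum_mul_sum, ← Finset.sum_product', Finset.smul_sum]
    refine Finset.sum_congr rfl fun p _ => ?_
    rw [dagger_smul, smul_mul_smul_comm, hX, smul_smul]
    congr 1
    have hs : star ζ = ζ⁻¹ := eq_inv_of_mul_eq_one_left hζ'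
    have hk : ζ ^ k ≠ 0 := pow_ne_zero k hζ0
    simp only [star_pow, star_star]
    simp only [hs, inv_pow]
    rw [← zpow_natCast (ζ ^ _) k, ← zpow_mul, mul_comm _ (k : ℤ), zpow_mul, zpow_natCast,
      zpow_sub₀ hk, zpow_sub₀ hk, zpow_natCast, zpow_natCast]
    field_simp
  rw [Finset.sum_congr rfl fun k _ => e1 k, Finset.sum_comm]
  have e2 : ∀ p ∈ Finset.range N ×ˢ Finset.range N,
      ∑ k ∈ Finset.range M, (ζ ^ (a - (p.1 - p.2 : ℤ))) ^ k • X (p.1 - p.2) =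
        if (p.1 : ℤ) - p.2 = a then (M : ℂ) • X a else 0 := by
    intro p hp
    rw [Finset.mem_product, Finset.mem_range, Finset.mem_range] at hp
    rw [← Finset.sum_smul, sum_pow_rootOfUnity hζ (by omega)]
    by_cases h : (p.1 : ℤ) - p.2 = a
    · rw [if_pos (by omega), if_pos h, h]
    · rw [if_neg (by omega), if_neg h, zero_smul]
  rw [Finset.sum_congr rfl e2, ← Finset.sum_filter, Finset.sum_const, ← pairCount,
    ← Nat.cast_smul_eq_nsmul ℂ, smul_smul, Nat.cast_mul, mul_comm]

theorem fejer_sum_two {N M : ℕ} {ζ : ℂ} (hζ : IsPrimitiveRoot ζ M) (hζ' : star ζ * ζ = 1)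
    {a b : ℤ} (ha : a.natAbs + N ≤ M) (hb : b.natAbs + N ≤ M) :
    ∑ k ∈ Finset.range M, ∑ l ∈ Finset.range M, ((ζ ^ k) ^ a * (ζ ^ l) ^ b) *
      L (dirichlet zz N (ζ ^ k) * dirichlet ww N (ζ ^ l) *
        dagger (dirichlet zz N (ζ ^ k) * dirichlet ww N (ζ ^ l))) =
      (M : ℂ) ^ 2 * (pairCount N a * pairCount N b) * L (mono a b) := by
  have h1 := fejer_sum (x := zz) (X := fun a => mono a 0) (N := N) (fun i j => by
    rw [zz, mono_pow, mono_pow, dagger_mono, mono_mul_mono]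
    simp [sub_eq_add_neg]) hζ hζ' ha
  have h2 := fejer_sum (x := ww) (X := fun a => mono 0 a) (N := N) (fun i j => by
    rw [ww, mono_pow, mono_pow, dagger_mono, mono_mul_mono]
    simp [sub_eq_add_neg]) hζ hζ' hb
  have h3 : L ((∑ k ∈ Finset.range M, (ζ ^ k) ^ a •
      (dirichlet zz N (ζ ^ k) * dagger (dirichlet zz N (ζ ^ k)))) *
      ∑ k ∈ Finset.range M, (ζ ^ k) ^ b •
      (dirichlet ww N (ζ ^ k) * dagger (dirichlet ww N (ζ ^ k)))) =
      (M : ℂ) ^ 2 * (pairCount N a * pairCount N b) * L (mono a b) := by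
    rw [h1, h2, smul_mul_smul_comm, map_smul, mono_mul_mono, add_zero, zero_add, smul_eq_mul]
    push_cast
    ring
  rw [← h3, Finset.sum_mul_sum, map_sum]
  refine Finset.sum_congr rfl fun k _ => ?_
  rw [map_sum]
  refine Finset.sum_congr rfl fun l _ => ?_
  rw [smul_mul_smul_comm, map_smul, smul_eq_mul, dagger_mul, mul_mul_mul_comm (dirichlet zz _ _)]

open MeasureTheory

theorem integral_sum_dirac {ι : Type*} (s : Finset ι) {w : ι → ℝ} (hw : ∀ i, 0 ≤ w i)
    (t : ι → Circle × Circle) (f : C(Circle × Circle, ℂ)) :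
    ∫ x, f x ∂(∑ i ∈ s, ENNReal.ofReal (w i) • Measure.dirac (t i)) =
      ∑ i ∈ s, (w i : ℂ) * f (t i) := by
  rw [integral_finsetSum_measure]
  · refine Finset.sum_congr rfl fun i _ => ?_
    rw [integral_smul_measure, integral_dirac, ENNReal.toReal_ofReal (hw i), Complex.real_smul]
  · intro i _
    exact ((BoundedContinuousFunction.mkOfCompact f).integrable (Measure.dirac (t i))).smul_measure
      ENNReal.ofReal_ne_top

/-- The Fejér sums of the functional are integrals with respect to probability measures. -/
theorem exists_fejer_measure (hL : Herm L) (hPD : IsPositiveDefinite L) {N : ℕ} (hN : 0 < N) :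
    ∃ ν : ProbabilityMeasure (Circle × Circle), ∀ a b : ℤ, a.natAbs ≤ N → b.natAbs ≤ N →
      ∫ x, monoFun (a, b) x ∂(ν : Measure (Circle × Circle)) =
        ((pairCount N a / N * (pairCount N b / N) : ℝ) : ℂ) * (L (mono a b) / L 1) := by
  have hNc : (N : ℂ) ≠ 0 := by exact_mod_cast hN.ne'
  have h1 := hPD 1 one_ne_zero
  rw [dagger_one, mul_one] at h1
  have hr : L 1 = ((L 1).re : ℂ) := Complex.ext rfl h1.2
  set r := (L 1).re
  have hrc : (r : ℂ) ≠ 0 := by exact_mod_cast h1.1.ne'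
  have hM : 2 * N ≠ 0 := by omega
  -- With M = 2N the moments up to |a| = N are free of aliasing.
  set M := 2 * N with hMdef
  have hMc : (M : ℂ) ≠ 0 := by exact_mod_cast hM
  set s : Circle := Circle.exp (2 * Real.pi / M) with hs
  have hζ : IsPrimitiveRoot (s : ℂ) M := by
    have := Complex.isPrimitiveRoot_exp M hM
    rw [hs, Circle.coe_exp]
    convert this using 2
    push_cast
    ring
  have hζ' : star (s : ℂ) * s = 1 := by
    rw [Complex.star_def, ← Circle.coe_inv_eq_conj, ← Circle.coe_mul, inv_mul_cancel,
      Circle.coe_one]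
  let Q : ℕ × ℕ → BiLaurent := fun p =>
    dirichlet zz N ((s : ℂ) ^ p.1) * dirichlet ww N ((s : ℂ) ^ p.2)
  -- Point masses at pairs of roots of unity, nonnegative because L(QQ†) is. The zeroth moment, M²
  -- N² L(1) before division, gives the normalisation.
  let w : ℕ × ℕ → ℝ := fun p => (L (Q p * dagger (Q p))).re / ((M : ℝ) ^ 2 * N ^ 2 * r)
  have hQ0 : ∀ p, 0 ≤ (L (Q p * dagger (Q p))).re := fun p => by
    by_cases h : Q p = 0
    · rw [h, zero_mul, map_zero, Complex.zero_re]
    · exact (hPD _ h).1.le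
  have hw : ∀ p, 0 ≤ w p := fun p =>
    div_nonneg (hQ0 p) (mul_nonneg (by positivity) h1.1.le)
  have hwc : ∀ p, (w p : ℂ) = L (Q p * dagger (Q p)) / ((M : ℂ) ^ 2 * N ^ 2 * r) := fun p => by
    have : L (Q p * dagger (Q p)) = ((L (Q p * dagger (Q p))).re : ℂ) :=
      Complex.ext rfl (Complex.conj_eq_iff_im.1 (hL.swap _ _))
    rw [this]
    simp only [w]
    push_cast
    rfl
  let t : ℕ × ℕ → Circle × Circle := fun p => (s ^ p.1, s ^ p.2)
  let I := Finset.range M ×ˢ Finset.range M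
  have key : ∀ a b : ℤ, a.natAbs ≤ N → b.natAbs ≤ N →
      ∑ p ∈ I, (w p : ℂ) * monoFun (a, b) (t p) =
        ((pairCount N a / N * (pairCount N b / N) : ℝ) : ℂ) * (L (mono a b) / L 1) := by
    intro a b ha hb
    have h2 := fejer_sum_two (L := L) (N := N) hζ hζ' (a := a) (b := b) (by omega) (by omega)
    have h3 : ∑ p ∈ I, (w p : ℂ) * monoFun (a, b) (t p) =
        (∑ k ∈ Finset.range M, ∑ l ∈ Finset.range M, (((s : ℂ) ^ k) ^ a * ((s : ℂ) ^ l) ^ b) *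
          L (dirichlet zz N ((s : ℂ) ^ k) * dirichlet ww N ((s : ℂ) ^ l) *
            dagger (dirichlet zz N ((s : ℂ) ^ k) * dirichlet ww N ((s : ℂ) ^ l)))) /
          ((M : ℂ) ^ 2 * N ^ 2 * r) := by
      rw [← Finset.sum_product', Finset.sum_div]
      refine Finset.sum_congr rfl fun p _ => ?_
      have : monoFun (a, b) (t p) = ((s : ℂ) ^ p.1) ^ a * ((s : ℂ) ^ p.2) ^ b := by
        simp [monoFun, t]
      rw [this, hwc]
      ring
    rw [h3, h2, hr]
    push_cast
    field_simp
  have htot : ∑ p ∈ I, w p = 1 := by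
    have h2 := key 0 0 (Nat.zero_le _) (Nat.zero_le _)
    have h3 : ∀ x, monoFun (0, 0) x = 1 := fun x => by simp [monoFun]
    have h4 : ((pairCount N 0 : ℝ) / N) = 1 := by
      rw [pairCount_eq]
      simp [hN.ne']
    simp only [h3, mul_one, h4, mono_zero, Complex.ofReal_one, one_mul] at h2
    rw [hr, div_self hrc] at h2
    exact_mod_cast h2
  refine ⟨⟨∑ p ∈ I, ENNReal.ofReal (w p) • Measure.dirac (t p), ⟨?_⟩⟩, fun a b ha hb => ?_⟩
  · rw [Measure.finsetSum_apply]
    simp only [Measure.smul_apply, measure_univ, smul_eq_mul, mul_one]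
    rw [← ENNReal.ofReal_sum_of_nonneg fun p _ => hw p, htot, ENNReal.ofReal_one]
  · rw [← key a b ha hb]
    exact integral_sum_dirac I hw t _

/-- The probability measures on the compact bicircle form a compact space. Along an ultrafilter the
Fejér measures converge weakly, while the factors pairCount/N tend to 1 for each fixed exponent. -/
theorem exists_moment_measure (hL : Herm L) (hPD : IsPositiveDefinite L) :
    ∃ ν : ProbabilityMeasure (Circle × Circle), ∀ a b : ℤ,
      ∫ x, monoFun (a, b) x ∂(ν : Measure (Circle × Circle)) = L (mono a b) / L 1 := by
  choose ν hν using fun N : ℕ => exists_fejer_measure hL hPD (Nat.succ_pos N)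
  obtain ⟨ν₀, -, h0⟩ := isCompact_univ.ultrafilter_le_nhds
    ((Ultrafilter.of (Filter.atTop : Filter ℕ)).map ν) (by simp)
  refine ⟨ν₀, fun a b => ?_⟩
  have h1 : Filter.Tendsto ν
      ((Ultrafilter.of Filter.atTop : Ultrafilter ℕ) : Filter ℕ) (nhds ν₀) := h0
  have h2 := (ProbabilityMeasure.tendsto_iff_forall_integral_rclike_tendsto ℂ).1 h1
    (BoundedContinuousFunction.mkOfCompact (monoFun (a, b)))
  have h3 : Filter.Tendsto (fun N : ℕ =>
      ∫ x, monoFun (a, b) x ∂(ν N : Measure (Circle × Circle))) Filter.atTop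
      (nhds (L (mono a b) / L 1)) := by
    have h4 := (((tendsto_pairCount a).mul (tendsto_pairCount b)).comp
      (Filter.tendsto_add_atTop_nat 1)).ofReal
    have h5 := h4.mul_const (L (mono a b) / L 1)
    rw [mul_one, Complex.ofReal_one, one_mul] at h5
    refine h5.congr' ?_
    filter_upwards [Filter.eventually_ge_atTop (max a.natAbs b.natAbs)] with N hN
    rw [hν N a b (by omega) (by omega)]
    rfl
  exact tendsto_nhds_unique h2 (h3.mono_left (Ultrafilter.of_le _))

theorem toFun_add (p q : BiLaurent) : toFun (p + q) = toFun p + toFun q := by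
  classical
  simp only [toFun, AddMonoidAlgebra.coeff_add]
  exact Finsupp.sum_add_index (by simp) (by simp [add_smul])

theorem toFun_single (a : ℤ × ℤ) (c : ℂ) :
    toFun (AddMonoidAlgebra.single a c) = c • monoFun a := by
  simp [toFun]

/-- Integration with respect to a finite measure. -/
def integralCLM (ν : Measure (Circle × Circle)) [IsFiniteMeasure ν] :
    C(Circle × Circle, ℂ) →L[ℂ] ℂ :=
  LinearMap.mkContinuous
    { toFun := fun f => ∫ x, f x ∂ν
      map_add' := fun f g => integral_add
        ((BoundedContinuousFunction.mkOfCompact f).integrable ν)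
        ((BoundedContinuousFunction.mkOfCompact g).integrable ν)
      map_smul' := fun c f => integral_const_mul c _ }
    (ν.real Set.univ) fun f => by
      rw [mul_comm]
      exact norm_integral_le_of_norm_le_const (Filter.Eventually.of_forall f.norm_coe_le_norm)

/-- The probability measure with the normalised moments is multiplied by L(1) to represent the
functional; the further factor (2π)² cancels the one in front of the integral. -/
theorem exists_measure (hL : Herm L) (hPD : IsPositiveDefinite L) :
    ∃ Λ : C(Circle × Circle, ℂ) →L[ℂ] ℂ, (∀ p, Λ (toFun p) = L p) ∧
      ∃ μ : Measure (Circle × Circle), IsFiniteMeasure μ ∧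
        ∀ f : C(Circle × Circle, ℂ), Λ f = (1 / (2 * (Real.pi : ℂ))) ^ 2 * ∫ x, f x ∂μ := by
  obtain ⟨ν, hν⟩ := exists_moment_measure hL hPD
  have h1 := hPD 1 one_ne_zero
  rw [dagger_one, mul_one] at h1
  have hr : L 1 = ((L 1).re : ℂ) := Complex.ext rfl h1.2
  have hne : L 1 ≠ 0 := fun h => by simp [h] at h1
  refine ⟨L 1 • integralCLM (ν : Measure (Circle × Circle)), fun p => ?_,
    ENNReal.ofReal ((2 * Real.pi) ^ 2 * (L 1).re) • (ν : Measure (Circle × Circle)),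
    Measure.smul_finite _ ENNReal.ofReal_ne_top, fun f => ?_⟩
  · induction p using AddMonoidAlgebra.induction_linear with
    | zero =>
      have : toFun 0 = 0 := by simp [toFun]
      rw [this, map_zero, map_zero]
    | add p q hp hq => rw [toFun_add, map_add, map_add, hp, hq]
    | single a c =>
      have e : (AddMonoidAlgebra.single a c : BiLaurent) = c • mono a.1 a.2 := by
        rw [mono, AddMonoidAlgebra.smul_single, smul_eq_mul, mul_one]
      rw [toFun_single, map_smul, e, map_smul]
      congr 1
      change L 1 * ∫ x, monoFun a x ∂(ν : Measure (Circle × Circle)) = _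
      rw [show a = (a.1, a.2) from rfl, hν]
      field_simp
  · change L 1 * ∫ x, f x ∂(ν : Measure (Circle × Circle)) = _
    rw [integral_smul_measure, ENNReal.toReal_ofReal (mul_nonneg (by positivity) h1.1.le),
      Complex.real_smul]
    have hpi : (Real.pi : ℂ) ≠ 0 := by exact_mod_cast Real.pi_ne_zero
    push_cast
    rw [← hr]
    field_simp

end Bicircle
end

theorem mainTheorem6 (u : ℤ → ℤ → ℂ)
    (hu : ∀ i j : ℤ, u i (-j) = star (u (-i) j))
    (h : Bicircle.Admissible u) :
    ∃ L : Bicircle.BiLaurent →ₗ[ℂ] ℂ,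
      Bicircle.IsPositiveDefinite L ∧ Bicircle.IsBuiltFrom u L ∧
        (∀ L' : Bicircle.BiLaurent →ₗ[ℂ] ℂ, Bicircle.IsBuiltFrom u L' → L' = L) ∧
        ∃ Λ : C(Circle × Circle, ℂ) →L[ℂ] ℂ,
          (∀ p : Bicircle.BiLaurent, Λ (Bicircle.toFun p) = L p) ∧
            ∃ μ : MeasureTheory.Measure (Circle × Circle), MeasureTheory.IsFiniteMeasure μ ∧
              ∀ f : C(Circle × Circle, ℂ),
                Λ f = (1 / (2 * (Real.pi : ℂ))) ^ 2 * ∫ x, f x ∂μ := by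
  obtain ⟨L, hL, hgood⟩ := Bicircle.exists_good hu h
  have hPD := Bicircle.isPositiveDefinite_of_good hL hgood
  have hbuilt := Bicircle.isBuiltFrom_of_good hL hgood
  exact ⟨L, hPD, hbuilt, fun L' hL' => Bicircle.eq_of_isBuiltFrom hgood hL' hbuilt,
    Bicircle.exists_measure hL hPD⟩
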